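/- **Setting.** Let $\widetilde G=\mathbb C\times\mathbb C$ with $(z,w)(z',w')=(z+z',\,w+e^{z}w')$ be the universal covering group of the group of affine maps of $\mathbb C$, and let $\mathfrak g=\mathrm{aff}(\mathbb C)=\{A=\begin{pmatrix}\alpha&\beta\\0&0\end{pmatrix}:\alpha,\beta\in\mathbb C\}$ be its real Lie algebra, with $\exp A=(\alpha,\beta\frac{e^{\alpha}-1}{\alpha})$ (read as $(0,\beta)$ if $\alpha=0$). Identify $(a,b)\in\mathbb C^2$ with the functional $A\mapsto\mathrm{Re}(a\alpha+b\beta)$ on $\mathfrak g$, and put $\widetilde A(F)=\langle F,A\rangle$ for $F\in\mathfrak g^*$. Let $\Omega\subset\mathfrak g^*$ be the coadjoint orbit of $(0,1)$. For $k\in\mathbb Z$ let $H_k=\{w:2k\pi<\mathrm{Im}\,w<2k\pi+2\pi\}$ and $\varphi_k:\mathbb C\times H_k\to\Omega$, $\varphi_k(z,w)=(z,e^{w})$. On functions on $\mathbb C\times\mathbb C$ with coordinates $z=p_1+ip_2$, $w=q_1+iq_2$ let $u\star v=\sum_{r\ge0}\frac1{r!}\left(\frac1{2i}\right)^{r}P^r(u,v)$,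 with $P^r(u,v)=\Lambda^{i_1j_1}\cdots\Lambda^{i_rj_r}\,\partial_{i_1\cdots i_r}u\;\partial_{j_1\cdots j_r}v$, be the Moyal product of the symplectic form $\omega=\frac12(dz\wedge dw+d\bar z\wedge d\bar w)=dp_1\wedge dq_1-dp_2\wedge dq_2$; that is, the nonzero entries of $\Lambda$ are $\Lambda^{p_1q_1}=-\Lambda^{q_1p_1}=1$ and $\Lambda^{p_2q_2}=-\Lambda^{q_2p_2}=-1$. With $\mathcal F_z g(\xi,w)=\frac1{2\pi}\int_{\mathbb C}e^{-i\mathrm{Re}(\xi\bar z)}g(z,w)\,dp_1dp_2$ and $\mathcal F_z^{-1}f(z,w)=\frac1{2\pi}\int_{\mathbb C}e^{i\mathrm{Re}(\xi\bar z)}f(\xi,w)\,d\xi_1d\xi_2$ put, for $f\in C_c^\infty(\mathbb C\times H_k)$, $$\hat\ell_A^{(k)}f=\mathcal F_z\bigl(i(\widetilde A\circ\varphi_k)\star\mathcal F_z^{-1}f\bigr).$$ For $\theta\in\mathbb R$ (only $\theta$ mod $1$ matters), let $\mathbb R\times S^1$ be the strip $\{x\in\mathbb C:0\le\mathrm{Im}\,x<2\pi\}$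 with Lebesgue measure (that is, $\mathbb C\setminus\{0\}$ in the coordinate $x$ of $e^x$), let $x\oplus z=\mathrm{Re}(x+z)+2\pi i\{\frac{\mathrm{Im}(x+z)}{2\pi}\}$, and $$[T_\theta(z,w)f](x)=\exp\Bigl(i\bigl(\mathrm{Re}(we^{x})+2\pi\theta\bigl[\tfrac{\mathrm{Im}(x+z)}{2\pi}\bigr]\bigr)\Bigr)f(x\oplus z),$$ where $[\cdot]$ and $\{\cdot\}$ are integer and fractional part. The operator induced by $\hat\ell_A^{(k)}$ in $L^2(\mathbb R\times S^1)$ is defined as follows. Write functions of $(\xi,w)$ in the variables $u=w-\frac12\bar\xi$, $v=w+\frac12\bar\xi$. Fix $v\in\mathbb C$ and put $(J_{\theta,v}f)(u)=\sum_{m\in\mathbb Z}e^{-2\pi im\theta}f|_{(u+2\pi im,\,v)}$ (so $J_{\theta,v}f$ is multiplied by $e^{2\pi i\theta}$ under $u\mapsto u+2\pi i$), restricted to $0\le\mathrm{Im}\,u<2\pi$. The induced operator has the graph $\{(J_{\theta,v}f,\;J_{\theta,v}\hat\ell_A^{(k)}f):f\in C_c^\infty(\mathbb C\times H_k)\}$.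 **Theorem.** 1. $\Omega=\{(a,b):b\neq0\}$ is open in the 4-dimensional space $\mathfrak g^*$. Each $\varphi_k$ is a bijection onto $\{(a,b):b\notin[0,\infty)\}$ with everywhere bijective differential, and it carries $\omega$ to the Kirillov form, given by $\omega_F(\xi_A,\xi_B)=\langle F,[A,B]\rangle$ on the fundamental vector fields $\xi_A,\xi_B$ of the coadjoint action. 2. For all $k\in\mathbb Z$, $A\in\mathfrak g$ and $f\in C_c^\infty(\mathbb C\times H_k)$, the Moyal series $i(\widetilde A\circ\varphi_k)\star\mathcal F_z^{-1}f$ converges absolutely at every point, its sum is integrable in $z$ for every $w$, and in the variables $(u,v)$ $$\hat\ell_A^{(k)}f=\alpha\frac{\partial f}{\partial u}+\bar\alpha\frac{\partial f}{\partial\bar u}+\frac i2\bigl(\beta e^{u}+\bar\beta e^{\bar u}\bigr)f .$$ 3. For every $\theta\in\mathbb R$ the formula above defines a strongly continuous irreducible unitary representation $T_\theta$ of $\widetilde G$ on $L^2(\mathbb R\times S^1)$. It is associated with $\Omega$ by the orbit method: for every $F\in\Omega$, the stabilizer of $F$ is $\widetilde G_F=\{(2\pi im,0):m\in\mathbb Z\}$,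 and there are a real polarization $\mathfrak h$ at $F$ (a Lie subalgebra that is maximal isotropic for $\langle F,[\cdot,\cdot]\rangle$ and $\widetilde G_F$-invariant) satisfying the Pukanszky condition $F+\mathfrak h^\perp\subset\Omega$, such that $H=\widetilde G_F\exp\mathfrak h$ is a closed subgroup, and a continuous unitary character $\chi$ of $H$ with $\chi(\exp X)=e^{2\pi i\langle F,X\rangle}$ for $X\in\mathfrak h$ and $\chi(2\pi im,0)=e^{2\pi im\theta}$ for $m\in\mathbb Z$, such that $T_\theta$ is unitarily equivalent to $\mathrm{Ind}_H^{\widetilde G}\chi$. 4. For all $\theta\in\mathbb R$, $k\in\mathbb Z$, $v\in\mathbb C$ and $A\in\mathfrak g$, the operator induced by $\hat\ell_A^{(k)}$ in $L^2(\mathbb R\times S^1)$ is closable, its closure is the infinitesimal generator of a strongly continuous one-parameter group of unitary operators, and the value of this group at time $1$ is $T_\theta(\exp A)$: $$\exp(\hat\ell_A^{(k)})f=T_\theta(\exp A)f\qquad(f\in L^2(\mathbb R\times S^1)).$$ -/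

import Mathlib

open MeasureTheory Set Filter Topology
open scoped ContDiff

namespace AffC

noncomputable section

/-! ### The group, its Lie algebra, and the coadjoint action -/

/-- The universal covering group of the group of affine maps of the complex line:
pairs `(z, w)` of complex numbers with `(z, w) (z', w') = (z + z', w + e ^ z w')`. -/
@[ext]
structure Cover where
  z : ℂ
  w : ℂ

namespace Cover

instance : Mul Cover := ⟨fun g h => ⟨g.z + h.z, g.w + Complex.exp g.z * h.w⟩⟩
instance : One Cover := ⟨⟨0, 0⟩⟩
instance : Inv Cover := ⟨fun g => ⟨-g.z, -(Complex.exp (-g.z) * g.w)⟩⟩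

@[simp] lemma mul_z (g h : Cover) : (g * h).z = g.z + h.z := rfl
@[simp] lemma mul_w (g h : Cover) : (g * h).w = g.w + Complex.exp g.z * h.w := rfl
@[simp] lemma one_z : (1 : Cover).z = 0 := rfl
@[simp] lemma one_w : (1 : Cover).w = 0 := rfl
@[simp] lemma inv_z (g : Cover) : (g⁻¹).z = -g.z := rfl
@[simp] lemma inv_w (g : Cover) : (g⁻¹).w = -(Complex.exp (-g.z) * g.w) := rfl

instance : Group Cover :=
  Group.ofLeftAxioms
    (fun a b c => by
      ext
      · simp [add_assoc]
      · simp [Complex.exp_add]; ring)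
    (fun a => by ext <;> simp)
    (fun a => by ext <;> simp)

/-- The manifold topology, that of `ℂ × ℂ`. -/
instance : TopologicalSpace Cover := TopologicalSpace.induced (fun g => (g.z, g.w)) inferInstance

lemma continuous_pair : Continuous (fun g : Cover => (g.z, g.w)) := continuous_induced_dom

instance : ContinuousMul Cover := ⟨by
  refine continuous_induced_rng.2 ?_
  have hz : Continuous (fun g : Cover => g.z) := continuous_fst.comp continuous_pair
  have hw : Continuous (fun g : Cover => g.w) := continuous_snd.comp continuous_pair
  have h1 := hz.comp (continuous_fst (X := Cover) (Y := Cover))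
  have h2 := hz.comp (continuous_snd (X := Cover) (Y := Cover))
  have h3 := hw.comp (continuous_fst (X := Cover) (Y := Cover))
  have h4 := hw.comp (continuous_snd (X := Cover) (Y := Cover))
  exact (h1.add h2).prodMk (h3.add ((Complex.continuous_exp.comp h1).mul h4))⟩

instance : MeasurableSpace Cover := borel Cover
instance : BorelSpace Cover := ⟨rfl⟩

/-- The covering map onto the matrix group of the `(a, b; 0, 1)` with `a ≠ 0`. -/
def toMatrix (g : Cover) : Matrix (Fin 2) (Fin 2) ℂ := !![Complex.exp g.z, g.w; 0, 1]

lemma toMatrix_mul (g h : Cover) : (g * h).toMatrix = g.toMatrix * h.toMatrix := by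
  ext i j
  fin_cases i <;> fin_cases j <;>
    simp [toMatrix, Matrix.mul_apply, Fin.sum_univ_two, Complex.exp_add, add_comm]

end Cover

/-- The real Lie algebra `aff(ℂ)`; the pair `(α, β)` stands for the matrix `(α, β; 0, 0)`. -/
abbrev Alg : Type := ℂ × ℂ

/-- The matrix `(α, β; 0, 0)`. -/
def algMatrix (A : Alg) : Matrix (Fin 2) (Fin 2) ℂ := !![A.1, A.2; 0, 0]

/-- The Lie bracket, i.e. the commutator of matrices. -/
def bracket (A B : Alg) : Alg := (0, A.1 * B.2 - B.1 * A.2)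

lemma algMatrix_bracket (A B : Alg) :
    algMatrix (bracket A B) = algMatrix A * algMatrix B - algMatrix B * algMatrix A := by
  ext i j
  fin_cases i <;> fin_cases j <;>
    simp [algMatrix, bracket, mul_comm]

/-- The adjoint action of the covering group. -/
def Ad (g : Cover) : Alg →L[ℝ] Alg :=
  LinearMap.toContinuousLinearMap
    { toFun := fun A => (A.1, Complex.exp g.z * A.2 - A.1 * g.w)
      map_add' := fun A B => by ext1 <;> simp; ring
      map_smul' := fun c A => by ext1 <;> simp; ring }

@[simp] lemma Ad_apply (g : Cover) (A : Alg) :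
    Ad g A = (A.1, Complex.exp g.z * A.2 - A.1 * g.w) := rfl

/-- `Ad g A = g A g⁻¹` in terms of matrices. -/
lemma algMatrix_Ad (g : Cover) (A : Alg) :
    algMatrix (Ad g A) * g.toMatrix = g.toMatrix * algMatrix A := by
  ext i j
  fin_cases i <;> fin_cases j <;>
    simp [algMatrix, Cover.toMatrix, Matrix.mul_apply, Fin.sum_univ_two, mul_comm]

/-- The exponential map `aff(ℂ) → Cover`: `exp (α, β) = (α, β (e ^ α - 1) / α)`, which for
`α = 0` is read as `(0, β)`. -/
def expo (A : Alg) : Cover :=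
  ⟨A.1, if A.1 = 0 then A.2 else A.2 * ((Complex.exp A.1 - 1) / A.1)⟩

/-- `t ↦ expo (t A)` is a one-parameter subgroup. -/
lemma expo_add (A : Alg) (s t : ℝ) : expo ((s + t) • A) = expo (s • A) * expo (t • A) := by
  obtain ⟨α, β⟩ := A
  by_cases hα : α = 0
  · subst hα
    ext <;> simp [expo]; ring
  by_cases hs : s = 0
  · subst hs
    ext <;> simp [expo]
  by_cases ht : t = 0
  · subst ht
    ext <;> simp [expo]
  ext
  · simp [expo]; ring
  have hs' : (s : ℂ) ≠ 0 := by exact_mod_cast hs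
  have ht' : (t : ℂ) ≠ 0 := by exact_mod_cast ht
  by_cases hst : s + t = 0
  · have e : (t : ℂ) = -s := by
      have : t = -s := by linarith
      simp [this]
    simp only [expo, hst, Cover.mul_w]
    simp [hα, hs, e]
    have := Complex.exp_ne_zero ((s : ℂ) * α)
    rw [Complex.exp_neg]
    field_simp
    ring
  · have hst' : (s : ℂ) + t ≠ 0 := by exact_mod_cast hst
    have hst2 : ((s + t : ℝ) : ℂ) ≠ 0 := by exact_mod_cast hst
    simp only [expo, Cover.mul_w, Prod.smul_fst, Prod.smul_snd, Complex.real_smul]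
    rw [if_neg (mul_ne_zero hst2 hα), if_neg (mul_ne_zero hs' hα), if_neg (mul_ne_zero ht' hα)]
    push_cast
    rw [add_mul (s : ℂ) t α, Complex.exp_add]
    have h3 : (s : ℂ) * α + t * α ≠ 0 := by rw [← add_mul]; exact mul_ne_zero hst' hα
    field_simp
    ring

/-- The velocity at `0` of `t ↦ expo (t A)` is `A`. -/
lemma expo_hasDerivAt (A : Alg) :
    HasDerivAt (fun t : ℝ => ((expo (t • A)).z, (expo (t • A)).w)) A 0 := by
  obtain ⟨α, β⟩ := A
  have h1 : HasDerivAt (fun t : ℝ => (t : ℂ) * α) α 0 := by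
    simpa using (Complex.ofRealCLM.hasDerivAt (x := (0 : ℝ))).mul_const α
  refine HasDerivAt.prodMk (by simpa [expo] using h1) ?_
  by_cases hα : α = 0
  · subst hα
    simpa [expo] using (Complex.ofRealCLM.hasDerivAt (x := (0 : ℝ))).mul_const β
  have h2 : HasDerivAt (fun t : ℝ => β * ((Complex.exp ((t : ℂ) * α) - 1) / α)) β 0 := by
    have := (((h1.cexp).sub_const 1).div_const α).const_mul β
    simpa [hα] using this
  refine h2.congr_of_eventuallyEq (Eventually.of_forall fun t => ?_)
  by_cases ht : t = 0
  · subst ht; simp [expo]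
  · have ht' : (t : ℂ) ≠ 0 := by exact_mod_cast ht
    simp [expo, hα, ht]
    field_simp

/-- The real dual space of the Lie algebra. -/
abbrev DualAlg : Type := Alg →L[ℝ] ℝ

/-- The coadjoint action `⟨K(g) F, A⟩ = ⟨F, Ad(g⁻¹) A⟩`. -/
def coad (g : Cover) (F : DualAlg) : DualAlg := F.comp (Ad g⁻¹)

/-- The coadjoint orbit through `F`. -/
def coadOrbit (F : DualAlg) : Set DualAlg := Set.range fun g => coad g F

/-- The stabilizer of `F` under the coadjoint action. -/
def coadStab (F : DualAlg) : Set Cover := {g | coad g F = F}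

/-- Complex coordinates on the dual: `(a, b)` is the functional `(α, β) ↦ Re (a α + b β)`. -/
def functional (p : ℂ × ℂ) : DualAlg :=
  LinearMap.toContinuousLinearMap
    { toFun := fun A => (p.1 * A.1 + p.2 * A.2).re
      map_add' := fun A B => by simp; ring
      map_smul' := fun c A => by simp; ring }

@[simp] lemma functional_apply (p : ℂ × ℂ) (A : Alg) :
    functional p A = (p.1 * A.1 + p.2 * A.2).re := rfl

/-- The orbit `Ω` through the functional `(α, β) ↦ Re β`. -/
def Omega : Set DualAlg := coadOrbit (functional (0, 1))

/-- The value at `F` of the fundamental vector field `d/dt K(exp (-tA)) F |_{t = 0}` of `A`. -/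
def fundField (A : Alg) (F : DualAlg) : DualAlg :=
  deriv (fun t : ℝ => coad (expo ((-t) • A)) F) 0

/-! ### Charts of the orbit and the Moyal product -/

/-- The strip `H_k = {2kπ < Im w < 2kπ + 2π}`. -/
def strip (k : ℤ) : Set ℂ := {w | 2 * k * Real.pi < w.im ∧ w.im < 2 * k * Real.pi + 2 * Real.pi}

/-- The domain `ℂ × H_k` of the chart `φ_k`. -/
def chartDomain (k : ℤ) : Set (ℂ × ℂ) := Set.univ ×ˢ strip k

/-- The map `(z, w) ↦ (z, e ^ w)` into the orbit; its restriction to `chartDomain k` is `φ_k`. -/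
def chart (p : ℂ × ℂ) : DualAlg := functional (p.1, Complex.exp p.2)

/-- The symplectic form `½ (dz ∧ dw + dz̄ ∧ dw̄)` of `ℂ × ℂ`. -/
def omegaStd (X Y : ℂ × ℂ) : ℝ := (X.1 * Y.2 - X.2 * Y.1).re

/-- The Hamiltonian function `Ã ∘ φ_k` where `Ã(F) = ⟨F, A⟩`, as a complex-valued function. -/
def hamiltonian (A : Alg) (p : ℂ × ℂ) : ℂ := ((chart p A : ℝ) : ℂ)

/-- The coordinate directions `(p₁, q₁, p₂, q₂)`, where `z = p₁ + i p₂` and `w = q₁ + i q₂`. -/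
def coordVec : Fin 4 → ℂ × ℂ := ![(1, 0), (0, 1), (Complex.I, 0), (0, Complex.I)]

/-- The Poisson tensor of `dp₁ ∧ dq₁ - dp₂ ∧ dq₂` in the coordinates `(p₁, q₁, p₂, q₂)`. -/
def poissonTensor : Matrix (Fin 4) (Fin 4) ℂ :=
  !![0, 1, 0, 0; -1, 0, 0, 0; 0, 0, 0, -1; 0, 0, 1, 0]

/-- The bidifferential operator
`P^r(u, v) = Λ^{i₁ j₁} ⋯ Λ^{i_r j_r} ∂_{i₁ ⋯ i_r} u ∂_{j₁ ⋯ j_r} v`. -/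
def moyalP (r : ℕ) (u v : ℂ × ℂ → ℂ) (x : ℂ × ℂ) : ℂ :=
  ∑ i : Fin r → Fin 4, ∑ j : Fin r → Fin 4,
    (∏ s, poissonTensor (i s) (j s)) *
      (iteratedFDeriv ℝ r u x fun s => coordVec (i s)) *
      (iteratedFDeriv ℝ r v x fun s => coordVec (j s))

/-- The `r`-th term of the Moyal product. -/
def moyalTerm (u v : ℂ × ℂ → ℂ) (x : ℂ × ℂ) (r : ℕ) : ℂ :=
  (1 / (r.factorial : ℂ)) * (1 / (2 * Complex.I)) ^ r * moyalP r u v x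

/-- The Moyal product `u ⋆ v = ∑_{r ≥ 0} (1 / r!) (1 / 2i) ^ r P^r(u, v)`. -/
def moyal (u v : ℂ × ℂ → ℂ) (x : ℂ × ℂ) : ℂ := ∑' r, moyalTerm u v x r

/-- The partial Fourier transform from the variable `z` to the variable `ξ`. -/
def fourierZ (g : ℂ × ℂ → ℂ) (p : ℂ × ℂ) : ℂ :=
  (1 / (2 * Real.pi) : ℂ) *
    ∫ z : ℂ, Complex.exp (-Complex.I * (p.1 * starRingEnd ℂ z).re) * g (z, p.2)

/-- The inverse partial Fourier transform from the variable `ξ` to the variable `z`. -/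
def fourierZInv (f : ℂ × ℂ → ℂ) (p : ℂ × ℂ) : ℂ :=
  (1 / (2 * Real.pi) : ℂ) *
    ∫ ξ : ℂ, Complex.exp (Complex.I * (ξ * starRingEnd ℂ p.1).re) * f (ξ, p.2)

/-- Left Moyal multiplication by `i Ã`. -/
def ell (A : Alg) (g : ℂ × ℂ → ℂ) : ℂ × ℂ → ℂ :=
  moyal (fun p => Complex.I * hamiltonian A p) g

/-- The operator `ℓ̂_A = F_z ∘ ℓ_A ∘ F_z⁻¹`. -/
def ellHat (A : Alg) (f : ℂ × ℂ → ℂ) : ℂ × ℂ → ℂ := fourierZ (ell A (fourierZInv f))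

/-- `f ∈ C_c^∞(ℂ × H_k)`, extended by zero. The operator `ℓ̂_A^{(k)}` is `ellHat A` on these `f`. -/
structure IsTest (k : ℤ) (f : ℂ × ℂ → ℂ) : Prop where
  smooth : ContDiff ℝ ∞ f
  compact : HasCompactSupport f
  supp : tsupport f ⊆ chartDomain k

/-- A function of `(ξ, w)` expressed in `u = w - ξ̄ / 2` and `v = w + ξ̄ / 2`. -/
def inUV (f : ℂ × ℂ → ℂ) (u v : ℂ) : ℂ := f (starRingEnd ℂ (v - u), (u + v) / 2)

/-- The Wirtinger derivative `∂h/∂u`. -/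
def dWirt (h : ℂ → ℂ) (u : ℂ) : ℂ := (fderiv ℝ h u 1 - Complex.I * fderiv ℝ h u Complex.I) / 2

/-- The Wirtinger derivative `∂h/∂ū`. -/
def dWirtBar (h : ℂ → ℂ) (u : ℂ) : ℂ := (fderiv ℝ h u 1 + Complex.I * fderiv ℝ h u Complex.I) / 2

/-! ### The Hilbert space `L²(ℝ × S¹)` and exponentials of operators -/

/-- `ℝ × S¹`, as the strip `0 ≤ Im x < 2π` with Lebesgue measure. -/
def cylMeasure : Measure ℂ := volume.restrict {x : ℂ | 0 ≤ x.im ∧ x.im < 2 * Real.pi}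

/-- `L²(ℝ × S¹)`. -/
abbrev L2Cyl : Type := Lp ℂ 2 cylMeasure

/-- `x ⊕ z = Re (x + z) + 2πi {Im (x + z) / 2π}`. -/
def oplus (x z : ℂ) : ℂ :=
  ((x + z).re : ℂ) + 2 * Real.pi * Complex.I * (Int.fract ((x + z).im / (2 * Real.pi)) : ℝ)

/-- The action of `(z, w)` in the representation `T_θ`, on functions. -/
def TFun (θ : ℝ) (g : Cover) (f : ℂ → ℂ) (x : ℂ) : ℂ :=
  Complex.exp (Complex.I * (((g.w * Complex.exp x).re
    + 2 * Real.pi * θ * (⌊(x + g.z).im / (2 * Real.pi)⌋ : ℝ) : ℝ) : ℂ)) * f (oplus x g.z)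

/-- Passage from functions of `(u, v)` to functions on `ℝ × S¹` twisted by the character
`m ↦ e ^ {2πi m θ}` of `π₁(ℝ × S¹) = ℤ`: the variable `v` is frozen, and
`h(u) = ∑_m e ^ {-2πi m θ} f(u + 2πi m, v)`, so that `h(u + 2πi) = e ^ {2πi θ} h(u)`. -/
def descend (θ : ℝ) (v : ℂ) (f : ℂ × ℂ → ℂ) (u : ℂ) : ℂ :=
  ∑' m : ℤ, Complex.exp (-(2 * Real.pi * Complex.I * m * θ)) *
    inUV f (u + 2 * Real.pi * Complex.I * m) v

/-- The graph of the operator induced by `ℓ̂_A^{(k)}` in `L²(ℝ × S¹)`. -/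
def ellHatGraph (k : ℤ) (θ : ℝ) (v : ℂ) (A : Alg) : Set (L2Cyl × L2Cyl) :=
  {p | ∃ f, IsTest k f ∧ p.1 =ᵐ[cylMeasure] descend θ v f ∧
    p.2 =ᵐ[cylMeasure] descend θ v (ellHat A f)}

/-- `V = exp L`: the closure of the operator with graph `L` is the infinitesimal generator of a
strongly continuous one-parameter group of unitary operators, whose value at time `1` is `V`. -/
def IsUnitaryExp {E : Type*} [NormedAddCommGroup E] [InnerProductSpace ℂ E]
    (L : Set (E × E)) (V : E ≃ₗᵢ[ℂ] E) : Prop :=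
  ∃ U : ℝ → (E ≃ₗᵢ[ℂ] E), (∀ s t, U (s + t) = U s * U t) ∧ (∀ f, Continuous fun t => U t f) ∧
    closure L = {p | HasDerivAt (fun t => U t p.1) p.2 0} ∧ U 1 = V

/-- A unitary representation is irreducible if the space is nonzero and has no closed invariant
subspaces but the trivial ones. -/
def IsIrred {G E : Type*} [Group G] [NormedAddCommGroup E] [InnerProductSpace ℂ E]
    (T : G →* (E ≃ₗᵢ[ℂ] E)) : Prop :=
  Nontrivial E ∧ ∀ W : Submodule ℂ E, IsClosed (W : Set E) →
    (∀ g, ∀ f ∈ W, T g f ∈ W) → W = ⊥ ∨ W = ⊤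

/-! ### Induced representations and the orbit method -/

section Induced

variable {G : Type*} [Group G] [TopologicalSpace G] [ContinuousMul G]

/-- Continuous functions on `G` with `φ(h x) = χ(h) φ(x)` for `h ∈ H`, with compact support
modulo `H`. -/
def sections (H : Subgroup G) (χ : H →* Circle) : Submodule ℂ (G → ℂ) where
  carrier := {φ | Continuous φ ∧ (∀ (h : H) (x : G), φ (h * x) = (χ h : ℂ) * φ x) ∧
    ∃ K : Set G, IsCompact K ∧ ∀ x, φ x ≠ 0 → ∃ h : H, (h : G) * x ∈ K}
  add_mem' := by
    rintro φ ψ ⟨c1, e1, K1, hK1, s1⟩ ⟨c2, e2, K2, hK2, s2⟩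
    refine ⟨c1.add c2, fun h x => by simp [e1, e2, mul_add], K1 ∪ K2, hK1.union hK2, fun x hx => ?_⟩
    by_cases h1 : φ x = 0
    · obtain ⟨h, hh⟩ := s2 x (by intro h2; simp [h1, h2] at hx)
      exact ⟨h, Or.inr hh⟩
    · obtain ⟨h, hh⟩ := s1 x h1
      exact ⟨h, Or.inl hh⟩
  zero_mem' := ⟨continuous_const, fun _ _ => by simp, ∅, isCompact_empty, fun _ hx => by simp at hx⟩
  smul_mem' := by
    rintro c φ ⟨c1, e1, K1, hK1, s1⟩
    refine ⟨c1.const_smul c, fun h x => by simp [e1]; ring, K1, hK1, fun x hx => s1 x ?_⟩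
    intro h1
    simp [h1] at hx

/-- Right translation `(R(g) φ)(x) = φ(x g)` of sections. -/
def sectionTranslate (H : Subgroup G) (χ : H →* Circle) (g : G) (φ : sections H χ) :
    sections H χ :=
  ⟨fun x => φ.1 (x * g), by
    obtain ⟨φ, c1, e1, K1, hK1, s1⟩ := φ
    refine ⟨c1.comp (continuous_mul_const g), fun h x => by simpa [mul_assoc] using e1 h (x * g),
      (fun y => y * g⁻¹) '' K1, hK1.image (continuous_mul_const _), fun x hx => ?_⟩
    obtain ⟨h, hh⟩ := s1 _ hx
    exact ⟨h, _, hh, by group⟩⟩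

/-- The space `H \ G` of right cosets `H x`. -/
abbrev RightCosets (H : Subgroup G) : Type _ := Quotient (QuotientGroup.rightRel H)

/-- The right action of `G` on `H \ G`. -/
def cosetTranslate (H : Subgroup G) (g : G) : RightCosets H → RightCosets H :=
  Quotient.map (fun x => x * g) (by
    intro a b hab
    change QuotientGroup.rightRel H a b at hab
    change QuotientGroup.rightRel H _ _
    rw [QuotientGroup.rightRel_apply] at hab ⊢
    simpa [mul_assoc] using hab)

/-- `T` is (unitarily equivalent to) the representation `Ind_H^G χ`, the completion of the space
of sections in the norm of `L²(H \ G)`, for a nonzero `G`-invariant measure on `H \ G`, with `G`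
acting by right translations. As `|φ|` is constant on cosets, it may be evaluated at any
representative. -/
def IsInduced [MeasurableSpace G] {E : Type*} [NormedAddCommGroup E] [InnerProductSpace ℂ E]
    (H : Subgroup G) (χ : H →* Circle) (T : G →* (E ≃ₗᵢ[ℂ] E)) : Prop :=
  ∃ μ : Measure (RightCosets H), μ ≠ 0 ∧ IsFiniteMeasureOnCompacts μ ∧
    (∀ g, μ.map (cosetTranslate H g) = μ) ∧
    ∃ J : sections H χ →ₗ[ℂ] E, DenseRange J ∧
      (∀ φ : sections H χ, Integrable (fun y : RightCosets H => ‖φ.1 y.out‖ ^ 2) μ ∧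
        ‖J φ‖ ^ 2 = ∫ y : RightCosets H, ‖φ.1 y.out‖ ^ 2 ∂μ) ∧
      ∀ g φ, T g (J φ) = J (sectionTranslate H χ g φ)

end Induced

/-- `𝔥` is a real polarization at `F`, invariant under the stabilizer of `F`, that satisfies the
Pukanszky condition. -/
structure IsPolarization (F : DualAlg) (𝔥 : Submodule ℝ Alg) : Prop where
  lie : ∀ A ∈ 𝔥, ∀ B ∈ 𝔥, bracket A B ∈ 𝔥
  maximal_isotropic : ∀ A, A ∈ 𝔥 ↔ ∀ B ∈ 𝔥, F (bracket A B) = 0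
  invariant : ∀ g ∈ coadStab F, ∀ A ∈ 𝔥, Ad g A ∈ 𝔥
  pukanszky : ∀ F' : DualAlg, (∀ A ∈ 𝔥, F' A = F A) → F' ∈ coadOrbit F

/-- `T` is obtained by the orbit method from `F` and the character `(2πi m, 0) ↦ e ^ {2πi m θ}` of
the stabilizer of `F`: it is induced from the subgroup `H = G_F exp 𝔥`, for a polarization `𝔥`,
and from a character of `H` that is `exp A ↦ e ^ {2πi ⟨F, A⟩}` on `exp 𝔥` and that is the given
character on the stabilizer. -/
def IsOrbitMethodRep {E : Type*} [NormedAddCommGroup E] [InnerProductSpace ℂ E]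
    (F : DualAlg) (θ : ℝ) (T : Cover →* (E ≃ₗᵢ[ℂ] E)) : Prop :=
  (coadStab F = {g | ∃ m : ℤ, g = ⟨2 * Real.pi * Complex.I * m, 0⟩}) ∧
  ∃ (𝔥 : Submodule ℝ Alg) (H : Subgroup Cover) (χ : H →* Circle),
    IsPolarization F 𝔥 ∧
    (H : Set Cover) = {g | ∃ s ∈ coadStab F, ∃ A ∈ 𝔥, g = s * expo A} ∧
    IsClosed (H : Set Cover) ∧ Continuous χ ∧
    (∀ h : H, ∀ A ∈ 𝔥, (h : Cover) = expo A → χ h = Circle.exp (2 * Real.pi * F A)) ∧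
    (∀ (h : H) (m : ℤ), (h : Cover) = ⟨2 * Real.pi * Complex.I * m, 0⟩ →
      χ h = Circle.exp (2 * Real.pi * m * θ)) ∧
    IsInduced H χ T

end

end AffC

/-! ### The coadjoint orbit and its charts -/

namespace AffC

noncomputable section

/-! In complex coordinates the coadjoint action of `(z, w)` sends `(a, b)` to `(a + b e^{-z} w, b
e^{-z})`. The first group of statements is read off from this: `b` can be moved to any nonzero value
and then `a` to any value, `w ↦ e^w` is a bijection of each strip onto the slit plane, and the
Kirillov form becomes a short computation (`omegaStd_eq_kirillov`).

The function `i Ã ∘ φ_k` is the sum of a real-linear form in `z` and of the exponentials `(i/2) β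
e^w` and `(i/2) β̄ e^{w̄}`. The Moyal series of the linear form stops at order one. Differentiating
an exponential only produces constants, and these pair with `z`-derivatives of the other factor,
which are multiplications on the Fourier side. So the Moyal series is there an exponential series:
it turns `e^w` into `e^{w - ξ̄/2} = e^u`. The linear form becomes a derivative along `(-ᾱ, α/2)` in
`(ξ, w)`, which is the direction `α` in `u` with `v` fixed. This is `hasSum_moyalTerm_hamiltonian`.

On functions with `h(u + 2πi) = e^{2πiθ} h(u)`, `T_θ(z, w)` is the shift by `z` followed by
multiplication by `e^{i Re(w e^x)}`. For irreducibility let `g` be orthogonal to all `T_θ(z, w) f`.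
Varying `w`, uniqueness of the Fourier transform in the variable `e^x` gives `g(x) f(x ⊕ z) = 0` for
almost all `x`, and integrating over `z` gives `‖f‖ ‖g‖ = 0`. Irreducibility is then reused: a
nonzero invariant subspace is dense, so neither smooth quasi-periodic functions nor induced sections
need an approximation argument. The polarization is the ideal of translations; restricting a section
to the points `(x - c, 0)` with `e^c = 2πb` intertwines the induced representation with `T_θ`
(`TRep_sectionEmbed`).

For the exponentials, twisted periodization commutes with the operator because its coefficients are
`2πi`-periodic in `u`. A partition of unity shows that every smooth quasi-periodic function
supported in a slab `|Re u| ≤ R` is the periodization of a test function on any given chart, for any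
frozen `v`. Hence the graph depends on neither `k` nor `v` (`ellHatGraph_eq`). Its domain is dense,
invariant under `T_θ` and contained in the domain of the generator of `t ↦ T_θ(exp tA)`, so it is a
core (`closure_eq_generator`). -/

/-- The complex coordinates `(a, b)` of a functional on `aff(ℂ)`. -/
def dualCoord (F : DualAlg) : ℂ × ℂ :=
  ((F (1, 0) : ℂ) - Complex.I * F (Complex.I, 0), (F (0, 1) : ℂ) - Complex.I * F (0, Complex.I))

lemma continuous_dualCoord : Continuous dualCoord := by
  unfold dualCoord
  fun_prop

lemma dualCoord_functional (p : ℂ × ℂ) : dualCoord (functional p) = p := by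
  ext1 <;> simp [dualCoord, mul_comm Complex.I]

lemma functional_dualCoord (F : DualAlg) : functional (dualCoord F) = F := by
  refine ContinuousLinearMap.ext fun A => ?_
  obtain ⟨α, β⟩ := A
  have h : ((α, β) : Alg) = α.re • ((1 : ℂ), (0 : ℂ)) + α.im • (Complex.I, (0 : ℂ))
      + β.re • ((0 : ℂ), (1 : ℂ)) + β.im • ((0 : ℂ), Complex.I) := by
    ext1 <;> simp
  rw [h]
  simp only [map_add, map_smul]
  simp [dualCoord]

lemma functional_injective : Function.Injective functional :=
  Function.LeftInverse.injective dualCoord_functional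

/-- The linear isomorphism of `ℂ²` with the dual of `aff(ℂ)`. -/
def functionalCLM : (ℂ × ℂ) →L[ℝ] DualAlg :=
  LinearMap.toContinuousLinearMap
    { toFun := functional
      map_add' := fun p q => by refine ContinuousLinearMap.ext fun A => ?_; simp; ring
      map_smul' := fun c p => by refine ContinuousLinearMap.ext fun A => ?_; simp; ring }

lemma coad_functional (g : Cover) (a b : ℂ) :
    coad g (functional (a, b)) =
      functional (a + b * Complex.exp (-g.z) * g.w, b * Complex.exp (-g.z)) := by
  refine ContinuousLinearMap.ext fun A => ?_
  simp only [coad, ContinuousLinearMap.comp_apply, Ad_apply, functional_apply, Cover.inv_z,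
    Cover.inv_w]
  congr 1
  ring

lemma coadOrbit_functional {a b : ℂ} (hb : b ≠ 0) :
    coadOrbit (functional (a, b)) = {F | ∃ a b : ℂ, b ≠ 0 ∧ F = functional (a, b)} := by
  ext F
  constructor
  · rintro ⟨g, rfl⟩
    exact ⟨_, _, mul_ne_zero hb (Complex.exp_ne_zero _), coad_functional g a b⟩
  · rintro ⟨a', b', hb', rfl⟩
    -- The first entry scales `b` to `b'`; the second then shifts `a` by `b' w = a' - a`.
    refine ⟨⟨-Complex.log (b' / b), (a' - a) / b'⟩, ?_⟩
    simp only
    rw [coad_functional]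
    simp only [neg_neg]
    rw [Complex.exp_log (div_ne_zero hb' hb), mul_div_cancel₀ _ hb, mul_div_cancel₀ _ hb']
    simp

lemma Omega_eq : Omega = {F | ∃ a b : ℂ, b ≠ 0 ∧ F = functional (a, b)} :=
  coadOrbit_functional one_ne_zero

lemma isOpen_Omega : IsOpen Omega := by
  have h : Omega = dualCoord ⁻¹' {p | p.2 ≠ 0} := by
    rw [Omega_eq]
    ext F
    constructor
    · rintro ⟨a, b, hb, rfl⟩
      simpa [dualCoord_functional] using hb
    · intro hF
      exact ⟨_, _, hF, (functional_dualCoord F).symm⟩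
  rw [h]
  exact (isOpen_ne.preimage continuous_snd).preimage continuous_dualCoord

/-- Measured from the middle of the strip, `t = Im w - 2kπ - π` lies in `(-π, π)` and turns sine and
cosine into `-sin t` and `-cos t`. A vanishing sine forces `t = 0`, where the real part is negative.
-/
lemma strip_eq_log_range (k : ℤ) {w : ℂ} (hw : w ∈ strip k) :
    ¬ ((Complex.exp w).im = 0 ∧ 0 ≤ (Complex.exp w).re) := by
  rintro ⟨h1, h2⟩
  obtain ⟨hw1, hw2⟩ := hw
  have he : 0 < Real.exp w.re := Real.exp_pos _
  rw [Complex.exp_im] at h1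
  rw [Complex.exp_re] at h2
  have hs : Real.sin w.im = 0 := by simpa [he.ne'] using h1
  have hc : 0 ≤ Real.cos w.im := nonneg_of_mul_nonneg_right h2 he
  have e : w.im = (w.im - 2 * k * Real.pi - Real.pi) + Real.pi + k * (2 * Real.pi) := by ring
  set t := w.im - 2 * k * Real.pi - Real.pi with ht
  rw [e, Real.sin_add_int_mul_two_pi, Real.sin_add_pi] at hs
  rw [e, Real.cos_add_int_mul_two_pi, Real.cos_add_pi] at hc
  have h3 : t = 0 := (Real.sin_eq_zero_iff_of_lt_of_lt (by linarith) (by linarith)).1 (by linarith)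
  rw [h3, Real.cos_zero] at hc
  linarith

lemma bijOn_chart (k : ℤ) : BijOn chart (chartDomain k)
    {F | ∃ a b : ℂ, ¬ (b.im = 0 ∧ 0 ≤ b.re) ∧ F = functional (a, b)} := by
  refine ⟨?_, ?_, ?_⟩
  · rintro ⟨z, w⟩ ⟨-, hw⟩
    exact ⟨z, _, strip_eq_log_range k hw, rfl⟩
  · rintro ⟨z, w⟩ ⟨-, hw⟩ ⟨z', w'⟩ ⟨-, hw'⟩ h
    have h' := functional_injective h
    simp only [Prod.mk.injEq] at h'
    obtain ⟨rfl, h2⟩ := h'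
    obtain ⟨n, hn⟩ := Complex.exp_eq_exp_iff_exists_int.1 h2
    have him : w.im = w'.im + n * (2 * Real.pi) := by
      rw [hn]; simp
    obtain ⟨a1, a2⟩ := hw
    obtain ⟨b1, b2⟩ := hw'
    simp only at a1 a2 b1 b2
    have hp := Real.pi_pos
    have n1 : (n : ℝ) < 1 := by
      by_contra hc
      push Not at hc
      nlinarith
    have n2 : (-1 : ℝ) < n := by
      by_contra hc
      push Not at hc
      nlinarith
    have n0 : n = 0 := by
      have := (by exact_mod_cast n1 : n < 1)
      have := (by exact_mod_cast n2 : -1 < n)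
      omega
    simp [hn, n0]
  · rintro F ⟨a, b, hb, rfl⟩
    have hb0 : b ≠ 0 := by
      rintro rfl
      simp at hb
    have hnb : -b ∈ Complex.slitPlane := by
      rw [Complex.mem_slitPlane_iff]
      by_contra hc
      push Not at hc
      apply hb
      simp at hc
      exact ⟨hc.2, hc.1⟩
    have harg : Complex.arg (-b) < Real.pi := by
      rcases (Complex.arg_le_pi (-b)).lt_or_eq with h | h
      · exact h
      · exact absurd h (Complex.mem_slitPlane_iff_arg.1 hnb).1
    -- The principal logarithm has its cut on the negative axis; taking it at `-b` and adding `πi`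
    -- moves the cut to `[0, ∞)`.
    refine ⟨(a, Complex.log (-b) + Real.pi * Complex.I + k * (2 * Real.pi * Complex.I)), ?_, ?_⟩
    · refine ⟨mem_univ _, ?_, ?_⟩
      · have := Complex.neg_pi_lt_arg (-b)
        simp [Complex.log_im]
        linarith
      · simp [Complex.log_im]
        linarith
    · simp only [chart]
      rw [Complex.exp_add, Complex.exp_int_mul_two_pi_mul_I, mul_one, Complex.exp_add,
        Complex.exp_log (neg_ne_zero.2 hb0), Complex.exp_pi_mul_I]
      simp

lemma hasFDerivAt_chart (p : ℂ × ℂ) :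
    HasFDerivAt chart (functionalCLM.comp
      ((ContinuousLinearMap.fst ℝ ℂ ℂ).prod
        (Complex.exp p.2 • ContinuousLinearMap.snd ℝ ℂ ℂ))) p := by
  have h1 : HasFDerivAt (fun q : ℂ × ℂ => Complex.exp q.2)
      (Complex.exp p.2 • ContinuousLinearMap.snd ℝ ℂ ℂ) p :=
    (hasFDerivAt_snd (𝕜 := ℝ)).cexp
  exact functionalCLM.hasFDerivAt.comp p ((hasFDerivAt_fst (𝕜 := ℝ)).prodMk h1)

lemma fderiv_chart (p X : ℂ × ℂ) :
    fderiv ℝ chart p X = functional (X.1, Complex.exp p.2 * X.2) := by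
  rw [(hasFDerivAt_chart p).fderiv]
  rfl

lemma bijective_fderiv_chart (p : ℂ × ℂ) : Function.Bijective (fderiv ℝ chart p) := by
  constructor
  · intro X Y h
    rw [fderiv_chart, fderiv_chart] at h
    have h' := functional_injective h
    simp only [Prod.mk.injEq] at h'
    exact Prod.ext h'.1 (mul_left_cancel₀ (Complex.exp_ne_zero _) h'.2)
  · intro F
    refine ⟨((dualCoord F).1, (Complex.exp p.2)⁻¹ * (dualCoord F).2), ?_⟩
    rw [fderiv_chart]
    simp only
    rw [mul_inv_cancel_left₀ (Complex.exp_ne_zero _)]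
    exact functional_dualCoord F

lemma fundField_functional (A : Alg) (a b : ℂ) :
    fundField A (functional (a, b)) = functional (-(b * A.2), b * A.1) := by
  have h0 : HasDerivAt (fun t : ℝ => ((expo ((-t) • A)).z, (expo ((-t) • A)).w)) (-A) 0 := by
    have h1 : HasDerivAt (fun t : ℝ => -t) (-1) 0 := (hasDerivAt_id 0).neg
    have h2 := HasDerivAt.scomp (x := (0 : ℝ)) (h := fun t : ℝ => -t) (h' := -1)
      (by simpa using expo_hasDerivAt A) h1
    simpa [Function.comp_def] using h2
  have hz : HasDerivAt (fun t : ℝ => (expo ((-t) • A)).z) (-A.1) 0 :=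
    (ContinuousLinearMap.fst ℝ ℂ ℂ).hasFDerivAt.comp_hasDerivAt (0 : ℝ) h0
  have hw : HasDerivAt (fun t : ℝ => (expo ((-t) • A)).w) (-A.2) 0 :=
    (ContinuousLinearMap.snd ℝ ℂ ℂ).hasFDerivAt.comp_hasDerivAt (0 : ℝ) h0
  have z0 : (expo ((-(0:ℝ)) • A)).z = 0 := by simp [expo]
  have w0 : (expo ((-(0:ℝ)) • A)).w = 0 := by simp [expo]
  have he : HasDerivAt (fun t : ℝ => b * Complex.exp (-(expo ((-t) • A)).z)) (b * A.1) 0 :=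
    ((hz.fun_neg.cexp).const_mul b).congr_deriv (by rw [z0]; simp)
  have h3 : HasDerivAt (fun t : ℝ => (a + b * Complex.exp (-(expo ((-t) • A)).z) *
      (expo ((-t) • A)).w, b * Complex.exp (-(expo ((-t) • A)).z))) (-(b * A.2), b * A.1) 0 := by
    exact HasDerivAt.prodMk (((he.fun_mul hw).const_add a).congr_deriv (by rw [z0, w0]; simp)) he
  unfold fundField
  simp only [coad_functional]
  exact (functionalCLM.hasFDerivAt.comp_hasDerivAt (0 : ℝ) h3).deriv

/-- In the chart the fundamental field of `(α, β)` is `(-e^w β, α)`, since the factor `e^w` of the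
differential cancels in the second component. -/
lemma omegaStd_eq_kirillov {A B : Alg} {p X Y : ℂ × ℂ}
    (hX : fderiv ℝ chart p X = fundField A (chart p))
    (hY : fderiv ℝ chart p Y = fundField B (chart p)) :
    omegaStd X Y = chart p (bracket A B) := by
  rw [fderiv_chart, chart, fundField_functional] at hX hY
  have hX' := functional_injective hX
  have hY' := functional_injective hY
  simp only [Prod.mk.injEq] at hX' hY'
  have e := Complex.exp_ne_zero p.2
  have x2 := mul_left_cancel₀ e hX'.2
  have y2 := mul_left_cancel₀ e hY'.2
  rw [omegaStd, hX'.1, hY'.1, x2, y2]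
  simp only [chart, functional_apply, bracket]
  congr 1
  ring

/-! ### Smooth parametric integrals -/

/-- The integral is the convolution of the constant `1` with `ξ ↦ G(p, -ξ)`, evaluated at `0`, so
smoothness of convolutions with a parameter applies. -/
lemma contDiff_parametric_integral {P : Type*} [NormedAddCommGroup P] [NormedSpace ℝ P]
    {G : P × ℂ → ℂ} (hG : ContDiff ℝ ∞ G) {K : Set ℂ} (hK : IsCompact K)
    (h0 : ∀ p ξ, ξ ∉ K → G (p, ξ) = 0) : ContDiff ℝ ∞ fun p => ∫ ξ, G (p, ξ) := by
  have h := contDiffOn_convolution_right_with_param (n := ⊤) (μ := (volume : Measure ℂ))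
    (f := fun _ : ℂ => (1 : ℝ)) (ContinuousLinearMap.lsmul ℝ ℝ) (g := fun (p : P) ξ => G (p, -ξ))
    (s := univ) (k := -K) isOpen_univ hK.neg (fun p x _ hx => h0 p _ (by simpa using hx))
    (locallyIntegrable_const _)
    ((hG.comp (contDiff_fst.prodMk contDiff_snd.neg)).contDiffOn)
  rw [univ_prod_univ, contDiffOn_univ] at h
  have h2 := h.comp (contDiff_prodMk_left (0 : ℂ))
  convert h2 using 2 with p
  simp [convolution]

lemma integrable_of_compact {g : ℂ → ℂ} (hg : Continuous g) {K : Set ℂ} (hK : IsCompact K)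
    (h0 : ∀ ξ, ξ ∉ K → g ξ = 0) : Integrable g :=
  hg.integrable_of_hasCompactSupport (HasCompactSupport.intro hK h0)

/-- Differentiability is already known, so only directional derivatives have to be identified. Along
the line `p + t m` this is dominated differentiation; outside `K` the integrand is constantly zero,
so a bound on `K` is enough. -/
lemma fderiv_parametric_integral {P : Type*} [NormedAddCommGroup P] [NormedSpace ℝ P]
    {G : P × ℂ → ℂ} (hG : ContDiff ℝ ∞ G) {K : Set ℂ} (hK : IsCompact K)
    (h0 : ∀ p ξ, ξ ∉ K → G (p, ξ) = 0) (p m : P) :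
    fderiv ℝ (fun p => ∫ ξ, G (p, ξ)) p m = ∫ ξ, fderiv ℝ G (p, ξ) (m, 0) := by
  have hd : DifferentiableAt ℝ (fun p => ∫ ξ, G (p, ξ)) p :=
    (contDiff_parametric_integral hG hK h0).differentiable (by simp) p
  have hline : ∀ t : ℝ, HasDerivAt (fun t : ℝ => p + t • m) m t := fun t => by
    simpa using ((hasDerivAt_id t).smul_const m).const_add p
  have h1 : HasDerivAt (fun t : ℝ => ∫ ξ, G (p + t • m, ξ))
      (fderiv ℝ (fun p => ∫ ξ, G (p, ξ)) p m) 0 := by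
    have := HasFDerivAt.comp_hasDerivAt (0 : ℝ) (f := fun t : ℝ => p + t • m)
      (l := fun p => ∫ ξ, G (p, ξ)) (by simpa using hd.hasFDerivAt) (hline 0)
    simpa [Function.comp_def] using this
  have hder : ∀ (t : ℝ) (ξ : ℂ), HasDerivAt (fun t : ℝ => G (p + t • m, ξ))
      (fderiv ℝ G (p + t • m, ξ) (m, 0)) t := fun t ξ =>
    ((hG.differentiable (by simp) _).hasFDerivAt).comp_hasDerivAt t
      ((hline t).prodMk (hasDerivAt_const t ξ))
  have hz : ∀ (t : ℝ) (ξ : ℂ), ξ ∉ K → fderiv ℝ G (p + t • m, ξ) (m, 0) = 0 := fun t ξ hξ => by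
    refine (hder t ξ).unique ?_
    simpa [h0 _ _ hξ] using hasDerivAt_const t (0 : ℂ)
  have hc : Continuous fun q : ℝ × ℂ => fderiv ℝ G (p + q.1 • m, q.2) (m, 0) := by
    have := hG.continuous_fderiv (by simp)
    fun_prop
  obtain ⟨C, hC⟩ := ((isCompact_closedBall (0 : ℝ) 1).prod hK).exists_bound_of_continuousOn
    hc.continuousOn
  have h2 := hasDerivAt_integral_of_dominated_loc_of_deriv_le (μ := (volume : Measure ℂ))
    (F := fun t ξ => G (p + t • m, ξ)) (F' := fun t ξ => fderiv ℝ G (p + t • m, ξ) (m, 0))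
    (x₀ := (0 : ℝ)) (s := Metric.ball 0 1) (bound := K.indicator fun _ => C)
    (Metric.ball_mem_nhds _ one_pos)
    (Eventually.of_forall fun t => by
      have := hG.continuous
      exact Continuous.aestronglyMeasurable (by fun_prop))
    (integrable_of_compact (by have := hG.continuous; fun_prop) hK fun ξ hξ => h0 _ _ hξ)
    (Continuous.aestronglyMeasurable (hc.comp (by fun_prop : Continuous fun ξ : ℂ => ((0:ℝ), ξ))))
    (Eventually.of_forall fun ξ t ht => by
      by_cases hξ : ξ ∈ K
      · rw [indicator_of_mem hξ]
        exact hC (t, ξ) ⟨Metric.ball_subset_closedBall ht, hξ⟩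
      · rw [hz t ξ hξ, indicator_of_notMem hξ, norm_zero])
    ((integrable_indicator_iff hK.measurableSet).2 (integrableOn_const hK.measure_lt_top.ne))
    (Eventually.of_forall fun ξ t _ => hder t ξ)
  simpa using h1.unique h2.2

/-! ### The partial Fourier transform of smooth functions with compact support -/

/-- Smooth functions with compact support on `ℂ × ℂ`. -/
structure IsCc (f : ℂ × ℂ → ℂ) : Prop where
  smooth : ContDiff ℝ ∞ f
  compact : HasCompactSupport f

lemma IsTest.isCc {k : ℤ} {f : ℂ × ℂ → ℂ} (hf : IsTest k f) : IsCc f := ⟨hf.smooth, hf.compact⟩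

namespace IsCc

variable {f g : ℂ × ℂ → ℂ}

lemma add (hf : IsCc f) (hg : IsCc g) : IsCc fun p => f p + g p :=
  ⟨hf.smooth.add hg.smooth, hf.compact.add hg.compact⟩

lemma mul_left (hf : IsCc f) (hg : ContDiff ℝ ∞ g) : IsCc fun p => g p * f p :=
  ⟨hg.mul hf.smooth, hf.compact.mul_left⟩

lemma fderiv_apply (hf : IsCc f) (m : ℂ × ℂ) : IsCc fun p => fderiv ℝ f p m :=
  ⟨(hf.smooth.fderiv_right (by simp)).clm_apply contDiff_const, hf.compact.fderiv_apply ℝ m⟩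

lemma exists_support (hf : IsCc f) : ∃ K : Set ℂ, IsCompact K ∧ ∀ ξ w, ξ ∉ K → f (ξ, w) = 0 := by
  refine ⟨Prod.fst '' tsupport f, hf.compact.isCompact.image continuous_fst, fun ξ w h => ?_⟩
  exact image_eq_zero_of_notMem_tsupport fun h' => h ⟨_, h', rfl⟩

lemma integrable_kernel (hf : IsCc f) {e : ℂ → ℂ} (he : Continuous e) (w : ℂ) :
    Integrable fun ξ => e ξ * f (ξ, w) := by
  obtain ⟨K, hK, h0⟩ := hf.exists_support
  have := hf.smooth.continuous
  exact integrable_of_compact (by fun_prop) hK fun ξ hξ => by simp [h0 ξ w hξ]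

end IsCc

lemma continuous_kernel (z : ℂ) :
    Continuous fun ξ : ℂ => Complex.exp (Complex.I * (ξ * starRingEnd ℂ z).re) := by fun_prop

lemma fourierZInv_add {f g : ℂ × ℂ → ℂ} (hf : IsCc f) (hg : IsCc g) (p : ℂ × ℂ) :
    fourierZInv (fun q => f q + g q) p = fourierZInv f p + fourierZInv g p := by
  simp only [fourierZInv, mul_add]
  rw [integral_add (hf.integrable_kernel (continuous_kernel _) _)
    (hg.integrable_kernel (continuous_kernel _) _), mul_add]

lemma fourierZInv_sum {ι : Type*} (s : Finset ι) {f : ι → ℂ × ℂ → ℂ} (hf : ∀ i ∈ s, IsCc (f i))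
    (p : ℂ × ℂ) :
    fourierZInv (fun q => ∑ i ∈ s, f i q) p = ∑ i ∈ s, fourierZInv (f i) p := by
  simp only [fourierZInv, Finset.mul_sum]
  rw [integral_finsetSum _ fun i hi => (hf i hi).integrable_kernel (continuous_kernel _) _,
    Finset.mul_sum]

/-- A factor that depends on `w` only can be taken out of the partial Fourier transform. -/
lemma fourierZInv_const_mul (c : ℂ → ℂ) (f : ℂ × ℂ → ℂ) (p : ℂ × ℂ) :
    fourierZInv (fun q => c q.2 * f q) p = c p.2 * fourierZInv f p := by
  simp only [fourierZInv]
  simp_rw [mul_left_comm _ (c p.2)]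
  rw [integral_const_mul]
  ring

lemma contDiff_fourier_integrand {f : ℂ × ℂ → ℂ} (hf : IsCc f) :
    ContDiff ℝ ∞ fun q : (ℂ × ℂ) × ℂ =>
      Complex.exp (Complex.I * (q.2 * starRingEnd ℂ q.1.1).re) * f (q.2, q.1.2) := by
  have h1 : ContDiff ℝ ∞ fun q : (ℂ × ℂ) × ℂ => (q.2 * starRingEnd ℂ q.1.1).re :=
    Complex.reCLM.contDiff.comp
      (contDiff_snd.mul (Complex.conjCLE.contDiff.comp (contDiff_fst.comp contDiff_fst)))
  have h2 : ContDiff ℝ ∞ fun q : (ℂ × ℂ) × ℂ => f (q.2, q.1.2) :=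
    hf.smooth.comp (contDiff_snd.prodMk (contDiff_snd.comp contDiff_fst))
  exact (contDiff_const.mul (Complex.ofRealCLM.contDiff.comp h1)).cexp.mul h2

lemma contDiff_fourierZInv {f : ℂ × ℂ → ℂ} (hf : IsCc f) : ContDiff ℝ ∞ (fourierZInv f) := by
  obtain ⟨K, hK, h0⟩ := hf.exists_support
  exact contDiff_const.mul (contDiff_parametric_integral (contDiff_fourier_integrand hf) hK
    fun p ξ hξ => by simp [h0 ξ _ hξ])

lemma isCc_fourier_deriv {f : ℂ × ℂ → ℂ} (hf : IsCc f) (m : ℂ) :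
    IsCc fun q => Complex.I * (q.1 * starRingEnd ℂ m).re * f q := by
  refine hf.mul_left (contDiff_const.mul (Complex.ofRealCLM.contDiff.comp
    (Complex.reCLM.contDiff.comp (contDiff_fst.mul contDiff_const))))

lemma fderiv_fourierZInv {f : ℂ × ℂ → ℂ} (hf : IsCc f) (p m : ℂ × ℂ) :
    fderiv ℝ (fourierZInv f) p m =
      fourierZInv (fun q => Complex.I * (q.1 * starRingEnd ℂ m.1).re * f q
        + fderiv ℝ f q (0, m.2)) p := by
  obtain ⟨K, hK, h0⟩ := hf.exists_support
  have h0' : ∀ (p : ℂ × ℂ) ξ, ξ ∉ K →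
      Complex.exp (Complex.I * (ξ * starRingEnd ℂ p.1).re) * f (ξ, p.2) = 0 :=
    fun p ξ hξ => by simp [h0 ξ _ hξ]
  have hG := contDiff_fourier_integrand hf
  have hd : DifferentiableAt ℝ (fun p : ℂ × ℂ =>
      ∫ ξ, Complex.exp (Complex.I * (ξ * starRingEnd ℂ p.1).re) * f (ξ, p.2)) p :=
    (contDiff_parametric_integral hG hK h0').differentiable (by simp) p
  change fderiv ℝ (fun p : ℂ × ℂ => (1 / (2 * Real.pi) : ℂ) *
      ∫ ξ, Complex.exp (Complex.I * (ξ * starRingEnd ℂ p.1).re) * f (ξ, p.2)) p m = _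
  rw [fderiv_const_mul hd]
  simp only [_root_.smul_apply, smul_eq_mul]
  rw [fderiv_parametric_integral hG hK h0']
  simp only [fourierZInv]
  congr 1
  refine integral_congr_ae (Eventually.of_forall fun ξ => ?_)
  simp only
  have e1 : HasFDerivAt (fun q : (ℂ × ℂ) × ℂ => Complex.I * ((q.2 * starRingEnd ℂ q.1.1).re : ℂ))
      _ (p, ξ) :=
    ((Complex.ofRealCLM.comp Complex.reCLM).hasFDerivAt.comp (p, ξ)
      ((hasFDerivAt_snd (𝕜 := ℝ)).mul (Complex.conjCLE.toContinuousLinearMap.hasFDerivAt.comp _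
        ((hasFDerivAt_fst (𝕜 := ℝ)).comp (p, ξ) (hasFDerivAt_fst (𝕜 := ℝ)))))).const_mul Complex.I
  have e2 : HasFDerivAt (fun q : (ℂ × ℂ) × ℂ => f (q.2, q.1.2)) _ (p, ξ) :=
    (hf.smooth.differentiable (by simp) (ξ, p.2)).hasFDerivAt.comp (p, ξ)
      ((hasFDerivAt_snd (𝕜 := ℝ)).prodMk ((hasFDerivAt_snd (𝕜 := ℝ)).comp (p, ξ)
        (hasFDerivAt_fst (𝕜 := ℝ))))
  rw [(e1.cexp.fun_mul e2).fderiv]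
  simp
  ring

/-! ### The Moyal product with the Hamiltonians -/

/-- Applying the last direction first replaces `g` by another scalar function. The inductions below
quantify over that function. -/
lemma iteratedFDeriv_succ_apply_last {g : ℂ × ℂ → ℂ} (hg : ContDiff ℝ ∞ g) (n : ℕ) (x : ℂ × ℂ)
    (m : Fin (n + 1) → ℂ × ℂ) :
    iteratedFDeriv ℝ (n + 1) g x m =
      iteratedFDeriv ℝ n (fun y => fderiv ℝ g y (m (Fin.last n))) x (Fin.init m) := by
  rw [iteratedFDeriv_succ_apply_right]
  have h : ContDiff ℝ ∞ (fderiv ℝ g) := hg.fderiv_right (by simp)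
  exact (iteratedFDeriv_clm_apply_const_apply (c := fderiv ℝ g) h (i := n)
    (by exact_mod_cast le_top)).symm

/-- The constant `c` is general because each differentiation multiplies it by a value of `ℓ`. -/
lemma iteratedFDeriv_cexp (ℓ : ℂ × ℂ →L[ℝ] ℂ) (n : ℕ) : ∀ (c : ℂ) (x : ℂ × ℂ)
    (m : Fin n → ℂ × ℂ), iteratedFDeriv ℝ n (fun y => c * Complex.exp (ℓ y)) x m =
      (∏ s, ℓ (m s)) * (c * Complex.exp (ℓ x)) := by
  induction n with
  | zero => intro c x m; simp
  | succ n ih =>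
    intro c x m
    have hs : ContDiff ℝ ∞ fun y => c * Complex.exp (ℓ y) := contDiff_const.mul ℓ.contDiff.cexp
    rw [iteratedFDeriv_succ_apply_last hs]
    have hd : (fun y => fderiv ℝ (fun y => c * Complex.exp (ℓ y)) y (m (Fin.last n))) =
        fun y => (ℓ (m (Fin.last n)) * c) * Complex.exp (ℓ y) := by
      funext y
      rw [((ℓ.hasFDerivAt (x := y)).cexp.const_mul c).fderiv]
      simp
      ring
    rw [hd, ih, Fin.prod_univ_castSucc]
    simp only [Fin.init]
    ring

lemma isCc_prod_mul {f : ℂ × ℂ → ℂ} (hf : IsCc f) {n : ℕ} (a : Fin n → ℂ) (m : Fin n → ℂ × ℂ) :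
    IsCc fun q => (∏ s, a s * (Complex.I * (q.1 * starRingEnd ℂ (m s).1).re)) * f q := by
  refine hf.mul_left (contDiff_prod fun s _ => contDiff_const.mul
    (contDiff_const.mul (Complex.ofRealCLM.contDiff.comp
      (Complex.reCLM.contDiff.comp (contDiff_fst.mul contDiff_const)))))

/-- Iterated derivatives of the partial Fourier transform in the directions of the variable `z`. -/
lemma iteratedFDeriv_fourierZInv (n : ℕ) : ∀ {f : ℂ × ℂ → ℂ}, IsCc f → ∀ (x : ℂ × ℂ)
    (m : Fin n → ℂ × ℂ), (∀ s, (m s).2 = 0) → iteratedFDeriv ℝ n (fourierZInv f) x m =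
      fourierZInv (fun q => (∏ s, Complex.I * (q.1 * starRingEnd ℂ (m s).1).re) * f q) x := by
  induction n with
  | zero => intro f _ x m _; simp
  | succ n ih =>
    intro f hf x m hm
    rw [iteratedFDeriv_succ_apply_last (contDiff_fourierZInv hf)]
    simp_rw [fderiv_fourierZInv hf, hm]
    have h0 : ((0 : ℂ), (0 : ℂ)) = 0 := rfl
    simp only [h0, map_zero, add_zero]
    refine (ih (isCc_fourier_deriv hf _) x (Fin.init m) fun s => hm _).trans ?_
    congr 1
    funext q
    rw [Fin.prod_univ_castSucc]
    simp only [Fin.init]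
    ring

/-- Summing over `i` contracts the Poisson tensor with the differential of `ℓ` into the vector `a`.
The sum over multi-indices `j` is then the expansion of an `r`-th power. The conditions on `a` leave
only derivatives along `z`, which act by multiplication on the Fourier side. -/
lemma moyalP_cexp (ℓ : ℂ × ℂ →L[ℝ] ℂ) (c : ℂ) {f : ℂ × ℂ → ℂ} (hf : IsCc f) (x : ℂ × ℂ)
    (r : ℕ) (a : Fin 4 → ℂ) (ha : ∀ j, ∑ i, poissonTensor i j * ℓ (coordVec i) = a j)
    (h1 : a 1 = 0) (h3 : a 3 = 0) :
    moyalP r (fun y => c * Complex.exp (ℓ y)) (fourierZInv f) x =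
      (c * Complex.exp (ℓ x)) * fourierZInv (fun q =>
        (∑ j, a j * (Complex.I * (q.1 * starRingEnd ℂ (coordVec j).1).re)) ^ r * f q) x := by
  have e1 : moyalP r (fun y => c * Complex.exp (ℓ y)) (fourierZInv f) x =
      ∑ j : Fin r → Fin 4, (c * Complex.exp (ℓ x)) * ((∏ s, a (j s)) *
        iteratedFDeriv ℝ r (fourierZInv f) x fun s => coordVec (j s)) := by
    unfold moyalP
    rw [Finset.sum_comm]
    refine Finset.sum_congr rfl fun j _ => ?_
    simp_rw [← ha, Fintype.prod_sum, Finset.prod_mul_distrib, iteratedFDeriv_cexp]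
    rw [Finset.sum_mul, Finset.mul_sum]
    refine Finset.sum_congr rfl fun i _ => ?_
    ring
  have e2 : ∀ j : Fin r → Fin 4, (∏ s, a (j s)) *
      iteratedFDeriv ℝ r (fourierZInv f) x (fun s => coordVec (j s)) =
      fourierZInv (fun q => (∏ s, a (j s) *
        (Complex.I * (q.1 * starRingEnd ℂ (coordVec (j s)).1).re)) * f q) x := by
    intro j
    -- A multi-index containing a `w`-direction makes both sides vanish; otherwise all directions
    -- are along `z`, as `iteratedFDeriv_fourierZInv` requires.
    by_cases hj : ∃ s, a (j s) = 0
    · obtain ⟨s, hs⟩ := hj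
      have z1 : ∏ s, a (j s) = 0 := Finset.prod_eq_zero (Finset.mem_univ s) hs
      simp_rw [Finset.prod_mul_distrib, z1]
      simp [fourierZInv]
    · push Not at hj
      rw [iteratedFDeriv_fourierZInv r hf x]
      · rw [← fourierZInv_const_mul (fun _ => ∏ s, a (j s))]
        simp_rw [Finset.prod_mul_distrib, mul_assoc]
      · intro s
        have hs := hj s
        generalize j s = k at hs
        fin_cases k
        · rfl
        · exact absurd h1 hs
        · rfl
        · exact absurd h3 hs
  rw [e1, ← Finset.mul_sum]
  simp_rw [e2]
  rw [← fourierZInv_sum _ fun j _ => isCc_prod_mul hf _ _]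
  congr 2
  funext q
  rw [← Finset.sum_mul, Fintype.sum_pow]

/-- The kernel has modulus one and `f` has compact support, so the exponential series of `‖q‖` times
`‖f‖` is an integrable majorant and the sum may be exchanged with the integral. -/
lemma hasSum_fourierZInv_exp {f : ℂ × ℂ → ℂ} (hf : IsCc f) {q : ℂ → ℂ} (hq : Continuous q)
    (x : ℂ × ℂ) :
    HasSum (fun r : ℕ => fourierZInv (fun p => (q p.1 ^ r / (r.factorial : ℂ)) * f p) x)
      (fourierZInv (fun p => Complex.exp (q p.1) * f p) x) := by
  simp only [fourierZInv]
  refine HasSum.mul_left _ ?_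
  obtain ⟨K, hK, h0⟩ := hf.exists_support
  have hfc := hf.smooth.continuous
  have hexp : ∀ t : ℝ, HasSum (fun r : ℕ => t ^ r / (r.factorial : ℝ)) (Real.exp t) := fun t => by
    rw [Real.exp_eq_exp_ℝ]
    exact NormedSpace.expSeries_div_hasSum_exp t
  have hexpc : ∀ t : ℂ, HasSum (fun r : ℕ => t ^ r / (r.factorial : ℂ)) (Complex.exp t) :=
    fun t => by
      rw [Complex.exp_eq_exp_ℂ]
      exact NormedSpace.expSeries_div_hasSum_exp t
  refine hasSum_integral_of_dominated_convergence
    (fun r ξ => ‖q ξ‖ ^ r / (r.factorial : ℝ) * ‖f (ξ, x.2)‖) (fun r => ?_) (fun r => ?_)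
    (Eventually.of_forall fun ξ => ((hexp _).mul_right _).summable) ?_
    (Eventually.of_forall fun ξ => ((hexpc _).mul_right _).mul_left _)
  · exact Continuous.aestronglyMeasurable (by fun_prop)
  · refine Eventually.of_forall fun ξ => ?_
    rw [norm_mul, norm_mul, norm_div, norm_pow]
    have : ‖Complex.exp (Complex.I * ((ξ * starRingEnd ℂ x.1).re : ℂ))‖ = 1 := by
      rw [mul_comm, Complex.norm_exp_ofReal_mul_I]
    rw [this]
    simp
  · have : (fun ξ => ∑' r : ℕ, ‖q ξ‖ ^ r / (r.factorial : ℝ) * ‖f (ξ, x.2)‖) =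
        fun ξ => Real.exp ‖q ξ‖ * ‖f (ξ, x.2)‖ :=
      funext fun ξ => ((hexp _).mul_right _).tsum_eq
    rw [this]
    refine Continuous.integrable_of_hasCompactSupport (by fun_prop)
      (HasCompactSupport.intro hK fun ξ hξ => by simp [h0 ξ _ hξ])

lemma hasSum_moyalTerm_cexp (ℓ : ℂ × ℂ →L[ℝ] ℂ) (c : ℂ) {f : ℂ × ℂ → ℂ} (hf : IsCc f)
    (x : ℂ × ℂ) (a : Fin 4 → ℂ) (ha : ∀ j, ∑ i, poissonTensor i j * ℓ (coordVec i) = a j)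
    (h1 : a 1 = 0) (h3 : a 3 = 0) :
    HasSum (moyalTerm (fun y => c * Complex.exp (ℓ y)) (fourierZInv f) x)
      ((c * Complex.exp (ℓ x)) * fourierZInv (fun p => Complex.exp ((1 / (2 * Complex.I)) *
        ∑ j, a j * (Complex.I * (p.1 * starRingEnd ℂ (coordVec j).1).re)) * f p) x) := by
  have h := (hasSum_fourierZInv_exp hf (q := fun ξ => (1 / (2 * Complex.I)) *
    ∑ j, a j * (Complex.I * (ξ * starRingEnd ℂ (coordVec j).1).re)) (by fun_prop) x).mul_left
      (c * Complex.exp (ℓ x))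
  refine h.congr_fun fun r => ?_
  unfold moyalTerm
  rw [moyalP_cexp ℓ c hf x r a ha h1 h3]
  rw [mul_left_comm, ← fourierZInv_const_mul
    (fun _ => 1 / (r.factorial : ℂ) * (1 / (2 * Complex.I)) ^ r)]
  congr 2
  funext p
  rw [mul_pow]
  ring

lemma moyalTerm_add {u u' : ℂ × ℂ → ℂ} (hu : ContDiff ℝ ∞ u) (hu' : ContDiff ℝ ∞ u')
    (v : ℂ × ℂ → ℂ) (x : ℂ × ℂ) (r : ℕ) :
    moyalTerm (fun y => u y + u' y) v x r = moyalTerm u v x r + moyalTerm u' v x r := by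
  have h : ∀ m : Fin r → ℂ × ℂ, iteratedFDeriv ℝ r (fun y => u y + u' y) x m =
      iteratedFDeriv ℝ r u x m + iteratedFDeriv ℝ r u' x m := fun m => by
    have e := iteratedFDeriv_add_apply (𝕜 := ℝ) (i := r) (f := u) (g := u') (x := x)
      ((hu.of_le (by exact_mod_cast le_top)).contDiffAt)
      ((hu'.of_le (by exact_mod_cast le_top)).contDiffAt)
    exact congrArg (fun T => T m) e
  unfold moyalTerm moyalP
  simp_rw [h, mul_add, add_mul, Finset.sum_add_distrib, mul_add]

lemma iteratedFDeriv_linear (ℓ : ℂ × ℂ →L[ℝ] ℂ) (n : ℕ) (x : ℂ × ℂ)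
    (m : Fin (n + 2) → ℂ × ℂ) : iteratedFDeriv ℝ (n + 2) ℓ x m = 0 := by
  rw [iteratedFDeriv_succ_apply_last ℓ.contDiff]
  simp_rw [ContinuousLinearMap.fderiv]
  rw [iteratedFDeriv_const_of_ne (by simp)]
  rfl

/-- Second and higher derivatives of `ℓ` vanish, so the series consists of the terms `r = 0` and `r
= 1`, whatever `v` is. -/
lemma hasSum_moyalTerm_linear (ℓ : ℂ × ℂ →L[ℝ] ℂ) (v : ℂ × ℂ → ℂ) (x : ℂ × ℂ) :
    HasSum (moyalTerm ℓ v x) (ℓ x * v x + (1 / (2 * Complex.I)) *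
      ∑ i, ∑ j, poissonTensor i j * ℓ (coordVec i) * fderiv ℝ v x (coordVec j)) := by
  have h : HasSum (moyalTerm ℓ v x) (∑ r ∈ Finset.range 2, moyalTerm ℓ v x r) := by
    refine hasSum_sum_of_ne_finset_zero fun r hr => ?_
    obtain ⟨n, rfl⟩ : ∃ n, r = n + 2 := ⟨r - 2, by simp at hr; omega⟩
    unfold moyalTerm moyalP
    simp_rw [iteratedFDeriv_linear]
    simp
  convert h using 1
  rw [Finset.sum_range_succ, Finset.sum_range_one]
  congr 1
  · simp [moyalTerm, moyalP]
  · unfold moyalTerm moyalP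
    simp only [Nat.factorial_one, Nat.cast_one, pow_one, div_one, one_mul]
    congr 1
    rw [← (Equiv.funUnique (Fin 1) (Fin 4)).symm.sum_comp]
    refine Finset.sum_congr rfl fun i _ => ?_
    rw [← (Equiv.funUnique (Fin 1) (Fin 4)).symm.sum_comp]
    refine Finset.sum_congr rfl fun j _ => ?_
    simp [iteratedFDeriv_one_apply]

/-! ### The operators `ℓ̂_A` -/

/-! ### Fourier inversion on slices and the closed form of the operators -/

section Inversion

open FourierTransform

variable {f : ℂ × ℂ → ℂ}

/-- The restriction of a function in `C_c^∞` to a slice, as a Schwartz function. -/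
lemma IsCc.exists_schwartz (hf : IsCc f) (w : ℂ) :
    ∃ φ : SchwartzMap ℂ ℂ, ∀ ξ, φ ξ = f (ξ, w) := by
  obtain ⟨K, hK, h0⟩ := hf.exists_support
  have h1 : HasCompactSupport fun ξ => f (ξ, w) := HasCompactSupport.intro hK fun ξ hξ => h0 ξ w hξ
  have h2 : ContDiff ℝ ∞ fun ξ => f (ξ, w) := hf.smooth.comp (contDiff_id.prodMk contDiff_const)
  exact ⟨h1.toSchwartzMap h2, fun ξ => rfl⟩

/-- The kernel here is `e^{i Re(ξ z̄)}`, that of `𝓕⁻` is `e^{2πi⟨·,·⟩}`; rescaling `z` by `1/(2π)`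
matches them. -/
lemma fourierZInv_eq_schwartz {φ : SchwartzMap ℂ ℂ} {w : ℂ} (hφ : ∀ ξ, φ ξ = f (ξ, w)) (z : ℂ) :
    fourierZInv f (z, w) = (1 / (2 * Real.pi) : ℂ) * (𝓕⁻ φ) ((2 * Real.pi)⁻¹ • z) := by
  rw [SchwartzMap.fourierInv_coe, Real.fourierInv_eq']
  simp only [fourierZInv]
  congr 1
  refine integral_congr_ae (Eventually.of_forall fun ξ => ?_)
  simp only [hφ, smul_eq_mul]
  congr 2
  have hp := Real.pi_ne_zero
  have : 2 * Real.pi * inner ℝ ξ ((2 * Real.pi)⁻¹ • z) = (ξ * starRingEnd ℂ z).re := by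
    rw [inner_smul_right, Complex.inner]
    field_simp
    simp
    ring
  rw [this, mul_comm]

lemma integrable_fourierZInv (hf : IsCc f) (w : ℂ) : Integrable fun z => fourierZInv f (z, w) := by
  obtain ⟨φ, hφ⟩ := hf.exists_schwartz w
  simp_rw [fourierZInv_eq_schwartz hφ]
  exact ((𝓕⁻ φ).integrable.comp_smul (inv_ne_zero Real.two_pi_pos.ne')).const_mul _

/-- Inversion for Schwartz functions on each slice. The two factors `1/(2π)` cancel the Jacobian
`(2π)²` of the rescaling in real dimension two. -/
lemma fourierZ_fourierZInv (hf : IsCc f) : fourierZ (fourierZInv f) = f := by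
  funext ⟨ξ, w⟩
  obtain ⟨φ, hφ⟩ := hf.exists_schwartz w
  have hp := Real.pi_ne_zero
  have hpc : (Real.pi : ℂ) ≠ 0 := by exact_mod_cast hp
  simp only [fourierZ]
  simp_rw [fourierZInv_eq_schwartz hφ]
  have h1 : ∀ z : ℂ, Complex.exp (-Complex.I * ((ξ * starRingEnd ℂ z).re : ℂ)) *
      ((1 / (2 * Real.pi) : ℂ) * (𝓕⁻ φ) ((2 * Real.pi)⁻¹ • z)) =
      (fun y : ℂ => Complex.exp (-Complex.I * ((2 * Real.pi * (ξ * starRingEnd ℂ y).re : ℝ) : ℂ)) *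
      ((1 / (2 * Real.pi) : ℂ) * (𝓕⁻ φ) y)) ((2 * Real.pi)⁻¹ • z) := fun z => by
    simp only
    congr 4
    simp
    field_simp
  rw [(integral_congr_ae (Eventually.of_forall h1)).trans
    (Measure.integral_comp_smul (volume : Measure ℂ) (fun y : ℂ => Complex.exp (-Complex.I *
      ((2 * Real.pi * (ξ * starRingEnd ℂ y).re : ℝ) : ℂ)) * ((1 / (2 * Real.pi) : ℂ) * (𝓕⁻ φ) y)) _)]
  have h2 : ∫ y : ℂ, Complex.exp (-Complex.I * ((2 * Real.pi * (ξ * starRingEnd ℂ y).re : ℝ) : ℂ)) *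
      ((1 / (2 * Real.pi) : ℂ) * (𝓕⁻ φ) y) = (1 / (2 * Real.pi) : ℂ) * φ ξ := by
    have h3 : φ ξ = 𝓕 (⇑(𝓕⁻ φ : SchwartzMap ℂ ℂ)) ξ := by
      rw [← SchwartzMap.fourier_coe, FourierTransform.fourier_fourierInv_eq]
    rw [h3, Real.fourier_eq', ← integral_const_mul]
    refine integral_congr_ae (Eventually.of_forall fun y => ?_)
    simp only [smul_eq_mul]
    rw [mul_left_comm]
    congr 3
    rw [Complex.inner]
    push_cast
    ring
  rw [h2, hφ]
  simp only [Complex.finrank_real_complex]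
  rw [Complex.real_smul, abs_of_pos (by positivity)]
  push_cast
  field_simp

end Inversion

/-- `α ∂/∂u + ᾱ ∂/∂ū + (i/2) (β e^u + β̄ e^ū)` in the variables `(ξ, w)`. -/
def fieldOp (A : Alg) (f : ℂ × ℂ → ℂ) (q : ℂ × ℂ) : ℂ :=
  fderiv ℝ f q (-starRingEnd ℂ A.1, A.1 / 2) +
    (Complex.I / 2 * (A.2 * Complex.exp (q.2 - starRingEnd ℂ q.1 / 2) + starRingEnd ℂ A.2 *
      Complex.exp (starRingEnd ℂ (q.2 - starRingEnd ℂ q.1 / 2)))) * f q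

lemma IsCc.fieldOp {f : ℂ × ℂ → ℂ} (hf : IsCc f) (A : Alg) : IsCc (fieldOp A f) := by
  refine (hf.fderiv_apply _).add (hf.mul_left (contDiff_const.mul ?_))
  have h1 : ContDiff ℝ ∞ fun q : ℂ × ℂ => q.2 - starRingEnd ℂ q.1 / 2 :=
    contDiff_snd.sub ((Complex.conjCLE.contDiff.comp contDiff_fst).div_const _)
  exact (contDiff_const.mul h1.cexp).add
    (contDiff_const.mul (Complex.conjCLE.contDiff.comp h1).cexp)

/-- The derivative of the kernel in `ξ` along `ᾱ` is `i Re(αz)` times the kernel; integration by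
parts moves it to `f`. -/
lemma mul_fourierZInv {f : ℂ × ℂ → ℂ} (hf : IsCc f) (α : ℂ) (x : ℂ × ℂ) :
    Complex.I * ((α * x.1).re : ℂ) * fourierZInv f x =
      fourierZInv (fun q => -fderiv ℝ f q (starRingEnd ℂ α, 0)) x := by
  have hc := hf.smooth.continuous
  have hd := (hf.fderiv_apply (starRingEnd ℂ α, 0))
  set e : ℂ → ℂ := fun ξ => Complex.exp (Complex.I * (ξ * starRingEnd ℂ x.1).re) with he
  have hed : ∀ ξ, HasFDerivAt e (e ξ • (Complex.I • (Complex.ofRealCLM.comp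
      (Complex.reCLM.comp ((ContinuousLinearMap.mul ℝ ℂ).flip (starRingEnd ℂ x.1)))))) ξ := fun ξ =>
    (((Complex.ofRealCLM.comp (Complex.reCLM.comp
      ((ContinuousLinearMap.mul ℝ ℂ).flip (starRingEnd ℂ x.1)))).hasFDerivAt (x := ξ)).const_mul
        Complex.I).cexp
  have hfd : ∀ ξ, HasFDerivAt (fun ξ => f (ξ, x.2))
      ((fderiv ℝ f (ξ, x.2)).comp (ContinuousLinearMap.inl ℝ ℂ ℂ)) ξ := fun ξ =>
    (hf.smooth.differentiable (by simp) (ξ, x.2)).hasFDerivAt.comp ξ (hasFDerivAt_prodMk_left ξ x.2)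
  have h1 : ∀ ξ, fderiv ℝ e ξ (starRingEnd ℂ α) = Complex.I * ((α * x.1).re : ℂ) * e ξ := fun ξ => by
    rw [(hed ξ).fderiv]
    simp
    ring
  have h2 : ∀ ξ, fderiv ℝ (fun ξ => f (ξ, x.2)) ξ (starRingEnd ℂ α) =
      fderiv ℝ f (ξ, x.2) (starRingEnd ℂ α, 0) := fun ξ => by
    rw [(hfd ξ).fderiv]
    rfl
  have hec : Continuous e := continuous_kernel x.1
  have h := integral_mul_fderiv_eq_neg_fderiv_mul_of_integrable (μ := (volume : Measure ℂ))
    (f := e) (g := fun ξ => f (ξ, x.2)) (v := starRingEnd ℂ α)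
    (by simp_rw [h1]; exact hf.integrable_kernel (by fun_prop) _)
    (by simp_rw [h2]; exact hd.integrable_kernel hec _)
    (hf.integrable_kernel hec _)
    (fun ξ _ => (hed ξ).differentiableAt) (fun ξ _ => (hfd ξ).differentiableAt)
  simp_rw [h1, h2, mul_assoc, integral_const_mul] at h
  simp only [fourierZInv, mul_neg, integral_neg]
  change _ * (_ * ∫ ξ, e ξ * f (ξ, x.2)) =
    -(_ * ∫ ξ, e ξ * fderiv ℝ f (ξ, x.2) (starRingEnd ℂ α, 0))
  rw [h]
  ring

/-- Writing the real part as half the sum with the conjugate leaves only exponentials of real-linear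
forms, whose Moyal series is available in closed form. -/
lemma hamiltonian_decomp (A : Alg) : (fun p => Complex.I * hamiltonian A p) = fun p =>
    ((Complex.I • Complex.ofRealCLM.comp (Complex.reCLM.comp
      (A.1 • ContinuousLinearMap.fst ℝ ℂ ℂ)) : ℂ × ℂ →L[ℝ] ℂ) p +
    (Complex.I / 2 * A.2) * Complex.exp (ContinuousLinearMap.snd ℝ ℂ ℂ p)) +
    (Complex.I / 2 * starRingEnd ℂ A.2) * Complex.exp
      ((Complex.conjCLE.toContinuousLinearMap.comp (ContinuousLinearMap.snd ℝ ℂ ℂ)) p) := by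
  funext p
  have h : ((A.2 * Complex.exp p.2).re : ℂ) =
      (A.2 * Complex.exp p.2 + starRingEnd ℂ A.2 * Complex.exp (starRingEnd ℂ p.2)) / 2 := by
    rw [Complex.re_eq_add_conj, map_mul, Complex.exp_conj]
  have h2 : hamiltonian A p = ((A.1 * p.1).re : ℂ) + ((A.2 * Complex.exp p.2).re : ℂ) := by
    simp [hamiltonian, chart, mul_comm]
  rw [h2, h]
  simp
  ring

lemma hasSum_moyalTerm_hamiltonian (A : Alg) {f : ℂ × ℂ → ℂ} (hf : IsCc f) (x : ℂ × ℂ) :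
    HasSum (moyalTerm (fun q => Complex.I * hamiltonian A q) (fourierZInv f) x)
      (fourierZInv (fieldOp A f) x) := by
  set ℓ₁ : ℂ × ℂ →L[ℝ] ℂ := Complex.I • Complex.ofRealCLM.comp (Complex.reCLM.comp
      (A.1 • ContinuousLinearMap.fst ℝ ℂ ℂ)) with hℓ₁
  set ℓ₃ : ℂ × ℂ →L[ℝ] ℂ :=
    Complex.conjCLE.toContinuousLinearMap.comp (ContinuousLinearMap.snd ℝ ℂ ℂ) with hℓ₃
  have s1 := hasSum_moyalTerm_linear ℓ₁ (fourierZInv f) x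
  have s2 := hasSum_moyalTerm_cexp (ContinuousLinearMap.snd ℝ ℂ ℂ) (Complex.I / 2 * A.2) hf x
    -- Contraction of the tensor with the differential `(0, 1, 0, i)` of `w`. For `w̄` below, `i` is
    -- replaced by `-i`.
    ![-1, 0, Complex.I, 0]
    (by intro j; fin_cases j <;> simp [Fin.sum_univ_four, poissonTensor, coordVec]) rfl rfl
  have s3 := hasSum_moyalTerm_cexp ℓ₃ (Complex.I / 2 * starRingEnd ℂ A.2) hf x
    ![-1, 0, -Complex.I, 0]
    (by intro j; fin_cases j <;> simp [Fin.sum_univ_four, poissonTensor, coordVec, hℓ₃]) rfl rfl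
  have hc1 : ContDiff ℝ ∞ ℓ₁ := ℓ₁.contDiff
  have hc2 : ContDiff ℝ ∞ fun p : ℂ × ℂ =>
      (Complex.I / 2 * A.2) * Complex.exp (ContinuousLinearMap.snd ℝ ℂ ℂ p) :=
    contDiff_const.mul (ContinuousLinearMap.snd ℝ ℂ ℂ).contDiff.cexp
  have hc3 : ContDiff ℝ ∞ fun p : ℂ × ℂ =>
      (Complex.I / 2 * starRingEnd ℂ A.2) * Complex.exp (ℓ₃ p) :=
    contDiff_const.mul ℓ₃.contDiff.cexp
  have s := (s1.add s2).add s3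
  rw [hamiltonian_decomp]
  have hterm : moyalTerm (fun p => (ℓ₁ p + (Complex.I / 2 * A.2) *
      Complex.exp (ContinuousLinearMap.snd ℝ ℂ ℂ p)) +
      (Complex.I / 2 * starRingEnd ℂ A.2) * Complex.exp (ℓ₃ p)) (fourierZInv f) x = fun r =>
      moyalTerm ℓ₁ (fourierZInv f) x r + moyalTerm (fun p => (Complex.I / 2 * A.2) *
        Complex.exp (ContinuousLinearMap.snd ℝ ℂ ℂ p)) (fourierZInv f) x r +
      moyalTerm (fun p => (Complex.I / 2 * starRingEnd ℂ A.2) * Complex.exp (ℓ₃ p))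
        (fourierZInv f) x r := by
    funext r
    rw [moyalTerm_add (hc1.add hc2) hc3, moyalTerm_add hc1 hc2]
  rw [hterm]
  convert s using 1
  have t1 : ℓ₁ x * fourierZInv f x =
      fourierZInv (fun q => -fderiv ℝ f q (starRingEnd ℂ A.1, 0)) x := by
    rw [← mul_fourierZInv hf]
    simp [hℓ₁]
  -- The contraction is `i (Re α ∂_{q₁} + Im α ∂_{q₂})`; the minus sign in `Λ^{p₂q₂}` is what makes
  -- it `i` times the derivative in `w` along `α`.
  have t2 : (1 / (2 * Complex.I)) * ∑ i, ∑ j, poissonTensor i j * ℓ₁ (coordVec i) *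
      fderiv ℝ (fourierZInv f) x (coordVec j) =
      fourierZInv (fun q => (1 / 2) * fderiv ℝ f q (0, A.1)) x := by
    have e1 : fderiv ℝ (fourierZInv f) x (0, A.1) = fourierZInv (fun q => fderiv ℝ f q (0, A.1)) x := by
      rw [fderiv_fourierZInv hf]
      simp
    rw [fourierZInv_const_mul (fun _ => 1 / 2), ← e1]
    have e2 : ((0 : ℂ), A.1) = A.1.re • ((0 : ℂ), (1 : ℂ)) + A.1.im • ((0 : ℂ), Complex.I) := by
      ext1 <;> simp
    rw [e2, map_add, map_smul, map_smul]
    simp [Fin.sum_univ_four, poissonTensor, coordVec, hℓ₁]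
    field_simp
    rw [Complex.I_sq]
    ring
  have c2 : ContDiff ℝ ∞ fun q : ℂ × ℂ => Complex.exp (-starRingEnd ℂ q.1 / 2) :=
    ((Complex.conjCLE.contDiff.comp contDiff_fst).neg.div_const _).cexp
  have c3 : ContDiff ℝ ∞ fun q : ℂ × ℂ => Complex.exp (-q.1 / 2) :=
    (contDiff_fst.neg.div_const _).cexp
  -- The exponents of the two series are `-ξ̄/2` and `-ξ/2`: they complete `w` and `w̄` to `u` and
  -- `ū`.
  have q2 : ∀ ξ : ℂ, (1 / (2 * Complex.I)) * ∑ j, (![-1, 0, Complex.I, 0] : Fin 4 → ℂ) j *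
      (Complex.I * (ξ * starRingEnd ℂ (coordVec j).1).re) = -starRingEnd ℂ ξ / 2 := fun ξ => by
    have : starRingEnd ℂ ξ = ξ.re - ξ.im * Complex.I := by
      apply Complex.ext <;> simp
    rw [this]
    simp [Fin.sum_univ_four, coordVec]
    field_simp
    linear_combination ((ξ.re : ℂ) - Complex.I * ξ.im) * Complex.I_sq
  have q3 : ∀ ξ : ℂ, (1 / (2 * Complex.I)) * ∑ j, (![-1, 0, -Complex.I, 0] : Fin 4 → ℂ) j *
      (Complex.I * (ξ * starRingEnd ℂ (coordVec j).1).re) = -ξ / 2 := fun ξ => by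
    have : ξ = ξ.re + ξ.im * Complex.I := by
      apply Complex.ext <;> simp
    simp [Fin.sum_univ_four, coordVec]
    field_simp
    linear_combination ((ξ.re : ℂ) + Complex.I * ξ.im) * Complex.I_sq + this
  simp_rw [q2, q3]
  have v2 : ContinuousLinearMap.snd ℝ ℂ ℂ x = x.2 := rfl
  have v3 : ℓ₃ x = starRingEnd ℂ x.2 := rfl
  rw [t1, t2, v2, v3, ← fourierZInv_const_mul (fun w => Complex.I / 2 * A.2 * Complex.exp w),
    ← fourierZInv_const_mul (fun w => Complex.I / 2 * starRingEnd ℂ A.2 *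
      Complex.exp (starRingEnd ℂ w))]
  have i1 : IsCc fun q => -fderiv ℝ f q (starRingEnd ℂ A.1, 0) := by
    simpa using (hf.fderiv_apply (starRingEnd ℂ A.1, 0)).mul_left
      (contDiff_const (c := (-1 : ℂ)))
  have i2 : IsCc fun q => (1 / 2 : ℂ) * fderiv ℝ f q (0, A.1) :=
    (hf.fderiv_apply _).mul_left contDiff_const
  have i3 : IsCc fun q : ℂ × ℂ => Complex.I / 2 * A.2 * Complex.exp q.2 *
      (Complex.exp (-starRingEnd ℂ q.1 / 2) * f q) :=
    (hf.mul_left c2).mul_left (contDiff_const.mul contDiff_snd.cexp)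
  have i4 : IsCc fun q : ℂ × ℂ => Complex.I / 2 * starRingEnd ℂ A.2 *
      Complex.exp (starRingEnd ℂ q.2) * (Complex.exp (-q.1 / 2) * f q) :=
    (hf.mul_left c3).mul_left (contDiff_const.mul (Complex.conjCLE.contDiff.comp contDiff_snd).cexp)
  rw [← fourierZInv_add i1 i2, ← fourierZInv_add (i1.add i2) i3,
    ← fourierZInv_add ((i1.add i2).add i3) i4]
  congr 1
  funext q
  have d : ((-starRingEnd ℂ A.1, A.1 / 2) : ℂ × ℂ) =
      -(starRingEnd ℂ A.1, 0) + (1 / 2 : ℝ) • ((0 : ℂ), A.1) := by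
    ext1
    · simp
    · simp
      ring
  simp only [fieldOp]
  rw [d, map_add, map_neg, map_smul, Complex.real_smul]
  have x1 : Complex.exp (q.2 - starRingEnd ℂ q.1 / 2) =
      Complex.exp q.2 * Complex.exp (-starRingEnd ℂ q.1 / 2) := by
    rw [← Complex.exp_add]; ring_nf
  have x2 : Complex.exp (starRingEnd ℂ (q.2 - starRingEnd ℂ q.1 / 2)) =
      Complex.exp (starRingEnd ℂ q.2) * Complex.exp (-q.1 / 2) := by
    rw [← Complex.exp_add, map_sub, map_div₀, Complex.conj_conj, Complex.conj_ofNat]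
    ring_nf
  rw [x1, x2]
  push_cast
  ring

lemma ell_fourierZInv (A : Alg) {f : ℂ × ℂ → ℂ} (hf : IsCc f) :
    ell A (fourierZInv f) = fourierZInv (fieldOp A f) :=
  funext fun x => (hasSum_moyalTerm_hamiltonian A hf x).tsum_eq

lemma ellHat_eq (A : Alg) {f : ℂ × ℂ → ℂ} (hf : IsCc f) : ellHat A f = fieldOp A f := by
  rw [ellHat, ell_fourierZInv A hf, fourierZ_fourierZInv (hf.fieldOp A)]

lemma dWirt_add_dWirtBar (h : ℂ → ℂ) (α u : ℂ) :
    α * dWirt h u + starRingEnd ℂ α * dWirtBar h u = fderiv ℝ h u α := by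
  have e : α = α.re • (1 : ℂ) + α.im • Complex.I := by simp
  have h1 : fderiv ℝ h u α = α.re * fderiv ℝ h u 1 + α.im * fderiv ℝ h u Complex.I := by
    conv_lhs => rw [e, map_add, map_smul, map_smul]
    simp
  have e2 : starRingEnd ℂ α = α.re - α.im * Complex.I := by apply Complex.ext <;> simp
  have e3 : α = α.re + α.im * Complex.I := by apply Complex.ext <;> simp
  rw [h1, e2, dWirt, dWirtBar]
  nth_rewrite 1 [e3]
  linear_combination (-α.im * fderiv ℝ h u Complex.I) * Complex.I_sq

/-- With `v` fixed, moving `u` by `m` moves `(ξ, w)` by `(-m̄, m/2)`; this is the direction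
occurring in `fieldOp`. -/
lemma hasFDerivAt_inUV {f : ℂ × ℂ → ℂ} (hf : Differentiable ℝ f) (u v : ℂ) :
    HasFDerivAt (fun u' => inUV f u' v)
      ((fderiv ℝ f (starRingEnd ℂ (v - u), (u + v) / 2)).comp
        ((-Complex.conjCLE.toContinuousLinearMap).prod
          ((1 / 2 : ℝ) • ContinuousLinearMap.id ℝ ℂ))) u := by
  refine HasFDerivAt.comp u (hf _).hasFDerivAt (HasFDerivAt.prodMk ?_ ?_)
  · have := (Complex.conjCLE.toContinuousLinearMap.hasFDerivAt (x := v - u)).comp u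
      ((hasFDerivAt_id (𝕜 := ℝ) u).const_sub v)
    have h : (-Complex.conjCLE.toContinuousLinearMap) =
        Complex.conjCLE.toContinuousLinearMap.comp (-ContinuousLinearMap.id ℝ ℂ) :=
      ContinuousLinearMap.ext fun m => by simp
    rw [h]
    exact this
  · convert ((hasFDerivAt_id (𝕜 := ℝ) u).add_const v).const_smul (1 / 2 : ℝ) using 1
    funext u'
    simp
    ring

lemma inUV_fieldOp (A : Alg) {f : ℂ × ℂ → ℂ} (hf : Differentiable ℝ f) (u v : ℂ) :
    inUV (fieldOp A f) u v = fderiv ℝ (fun u' => inUV f u' v) u A.1 +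
      Complex.I / 2 * (A.2 * Complex.exp u + starRingEnd ℂ A.2 * Complex.exp (starRingEnd ℂ u)) *
        inUV f u v := by
  rw [(hasFDerivAt_inUV hf u v).fderiv]
  simp only [inUV, fieldOp]
  have e : (u + v) / 2 - starRingEnd ℂ (starRingEnd ℂ (v - u)) / 2 = u := by
    rw [Complex.conj_conj]; ring
  have d : ((-Complex.conjCLE.toContinuousLinearMap).prod
      ((1 / 2 : ℝ) • ContinuousLinearMap.id ℝ ℂ)) A.1 = (-starRingEnd ℂ A.1, A.1 / 2) := by
    ext1
    · simp
    · simp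
      ring
  rw [e, ContinuousLinearMap.comp_apply, d]

/-! ### The cylinder -/

/-- The strip `c ≤ Im x < c + 2π`. -/
def halfStrip (c : ℝ) : Set ℂ := {x : ℂ | c ≤ x.im ∧ x.im < c + 2 * Real.pi}

lemma measurableSet_halfStrip (c : ℝ) : MeasurableSet (halfStrip c) :=
  (measurableSet_le measurable_const Complex.measurable_im).inter
    (measurableSet_lt Complex.measurable_im measurable_const)

lemma cylMeasure_eq : cylMeasure = volume.restrict (halfStrip 0) := by
  simp [cylMeasure, halfStrip]

instance : SFinite cylMeasure := by unfold cylMeasure; infer_instance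

lemma ae_mem_halfStrip : ∀ᵐ x ∂cylMeasure, x ∈ halfStrip 0 := by
  rw [cylMeasure_eq]
  exact ae_restrict_mem (measurableSet_halfStrip 0)

/-- The sheet number of a point of `ℂ` over the cylinder. -/
def sheet (y : ℂ) : ℤ := ⌊y.im / (2 * Real.pi)⌋

lemma oplus_eq (x z : ℂ) :
    oplus x z = x + z - 2 * Real.pi * Complex.I * (sheet (x + z) : ℂ) := by
  have hp := Real.pi_ne_zero
  have h1 : (2 * Real.pi) * Int.fract ((x + z).im / (2 * Real.pi)) =
      (x + z).im - 2 * Real.pi * (sheet (x + z) : ℝ) := by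
    rw [← Int.self_sub_floor, sheet]
    field_simp
  have h2 : (2 * Real.pi * Complex.I * (Int.fract ((x + z).im / (2 * Real.pi)) : ℝ) : ℂ) =
      (((2 * Real.pi) * Int.fract ((x + z).im / (2 * Real.pi)) : ℝ) : ℂ) * Complex.I := by
    push_cast; ring
  rw [oplus, h2, h1]
  push_cast
  linear_combination Complex.re_add_im (x + z)

lemma oplus_comm (x z : ℂ) : oplus x z = oplus z x := by rw [oplus, oplus, add_comm x z]

lemma oplus_re (x z : ℂ) : (oplus x z).re = (x + z).re := by simp [oplus_eq]

lemma oplus_im (x z : ℂ) :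
    (oplus x z).im = (x + z).im - 2 * Real.pi * (sheet (x + z) : ℝ) := by simp [oplus_eq]

lemma sheet_sub (y : ℂ) (n : ℤ) : sheet (y - 2 * Real.pi * Complex.I * n) = sheet y - n := by
  have hp := Real.pi_ne_zero
  unfold sheet
  rw [← Int.floor_sub_intCast]
  congr 1
  simp
  field_simp

lemma sheet_of_mem {x : ℂ} (hx : x ∈ halfStrip 0) : sheet x = 0 := by
  have hp := Real.two_pi_pos
  rw [sheet, Int.floor_eq_zero_iff]
  exact ⟨div_nonneg hx.1 hp.le, by rw [div_lt_one hp]; simpa using hx.2⟩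

lemma oplus_mem (x z : ℂ) : oplus x z ∈ halfStrip 0 := by
  have hp := Real.two_pi_pos
  have h1 := Int.floor_le ((x + z).im / (2 * Real.pi))
  have h2 := Int.lt_floor_add_one ((x + z).im / (2 * Real.pi))
  rw [le_div_iff₀ hp] at h1
  rw [div_lt_iff₀ hp] at h2
  change (sheet (x + z) : ℝ) * _ ≤ _ at h1
  change _ < ((sheet (x + z) : ℝ) + 1) * _ at h2
  constructor
  · rw [oplus_im]; linarith
  · rw [oplus_im]; linarith

lemma oplus_zero {x : ℂ} (hx : x ∈ halfStrip 0) : oplus x 0 = x := by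
  rw [oplus_eq, add_zero, sheet_of_mem hx]
  simp

lemma oplus_oplus (x z z' : ℂ) : oplus (oplus x z) z' = oplus x (z + z') := by
  have e : oplus x z + z' = x + (z + z') - 2 * Real.pi * Complex.I * (sheet (x + z) : ℂ) := by
    rw [oplus_eq]; ring
  rw [oplus_eq (oplus x z), e, sheet_sub, oplus_eq x (z + z')]
  push_cast
  ring

/-- The cocycle identity of the integer parts, from which the factors `e^{2πiθ[·]}` multiply
correctly. -/
lemma sheet_oplus_add (x z z' : ℂ) :
    sheet (oplus x z + z') = sheet (x + (z + z')) - sheet (x + z) := by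
  have e : oplus x z + z' = x + (z + z') - 2 * Real.pi * Complex.I * (sheet (x + z) : ℂ) := by
    rw [oplus_eq]; ring
  rw [e, sheet_sub]

lemma exp_oplus (x z : ℂ) : Complex.exp (oplus x z) = Complex.exp (x + z) := by
  rw [oplus_eq, Complex.exp_sub, mul_comm _ ((sheet (x + z) : ℤ) : ℂ),
    Complex.exp_int_mul_two_pi_mul_I, div_one]

lemma measurable_oplus : Measurable fun p : ℂ × ℂ => oplus p.1 p.2 := by
  unfold oplus
  fun_prop

lemma isAddFundamentalDomain_halfStrip (c : ℝ) :
    IsAddFundamentalDomain (AddSubgroup.zmultiples (2 * Real.pi * Complex.I)) (halfStrip c)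
      (volume : Measure ℂ) := by
  refine IsAddFundamentalDomain.mk' (measurableSet_halfStrip c).nullMeasurableSet fun x => ?_
  have hinj : Function.Injective fun n : ℤ => n • (2 * Real.pi * Complex.I : ℂ) :=
    smul_left_injective ℤ Complex.two_pi_I_ne_zero
  have : Function.Bijective (codRestrict (fun n : ℤ => n • (2 * Real.pi * Complex.I : ℂ))
      (AddSubgroup.zmultiples (2 * Real.pi * Complex.I : ℂ)) fun n => ⟨n, rfl⟩) :=
    (Equiv.ofInjective _ hinj).bijective
  refine this.existsUnique_iff.2 ?_
  have h := existsUnique_add_zsmul_mem_Ico Real.two_pi_pos x.im c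
  convert h using 2 with n
  simp [halfStrip, AddSubgroup.vadd_def, mem_Ico, add_comm]

/-- The map is translation by `z` followed by reduction modulo `2πi`. Translation carries the basic
strip to the one starting at `Im z`. Both are fundamental domains of `2πiℤ`, so an invariant set
meets them in equal measure. -/
lemma measurePreserving_oplus (z : ℂ) :
    MeasurePreserving (fun x => oplus x z) cylMeasure cylMeasure := by
  have hm : Measurable fun x => oplus x z := measurable_oplus.comp (measurable_id.prodMk measurable_const)
  have hm0 : Measurable fun x => oplus x 0 := measurable_oplus.comp (measurable_id.prodMk measurable_const)
  refine ⟨hm, Measure.ext fun E hE => ?_⟩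
  rw [Measure.map_apply hm hE, cylMeasure_eq, Measure.restrict_apply (hm hE),
    Measure.restrict_apply hE]
  have h1 : (fun x => oplus x z) ⁻¹' E ∩ halfStrip 0 =
      (fun x => x + z) ⁻¹' ((fun x => oplus x 0) ⁻¹' E ∩ halfStrip z.im) := by
    ext x
    have e : oplus (x + z) 0 = oplus x z := by simp [oplus]
    simp [e, halfStrip, add_comm _ z.im]
  rw [h1, measure_preimage_add_right, (isAddFundamentalDomain_halfStrip z.im).measure_set_eq
    (isAddFundamentalDomain_halfStrip 0) (hm0 hE)]
  · congr 1
    ext x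
    constructor
    · rintro ⟨h2, h3⟩
      exact ⟨by simpa [oplus_zero h3] using h2, h3⟩
    · rintro ⟨h2, h3⟩
      exact ⟨by simpa [oplus_zero h3] using h2, h3⟩
  · rintro ⟨-, n, rfl⟩
    ext x
    have e : oplus ((fun n : ℤ => n • (2 * Real.pi * Complex.I : ℂ)) n + x) 0 = oplus x 0 := by
      have hp := Real.pi_ne_zero
      have : (((n : ℝ) * (2 * Real.pi) + x.im) / (2 * Real.pi)) = n + x.im / (2 * Real.pi) := by
        field_simp
      simp [oplus, this, Int.fract_intCast_add]
    simp only [AddSubgroup.vadd_def, vadd_eq_add, mem_preimage, e]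

/-! ### The operators `T_θ(g)` -/

section TFun

variable (θ : ℝ)

/-- This holds at every point: the shifts compose, the integer parts satisfy the cocycle identity,
and `e^{x ⊕ z} = e^{x+z}` turns the two phases into that of `w + e^z w'`. -/
lemma TFun_mul (g h : Cover) (f : ℂ → ℂ) (x : ℂ) :
    TFun θ (g * h) f x = TFun θ g (TFun θ h f) x := by
  unfold TFun
  rw [oplus_oplus, ← mul_assoc, ← Complex.exp_add]
  have e1 := sheet_oplus_add x g.z h.z
  simp only [sheet] at e1
  rw [e1, exp_oplus]
  simp only [Cover.mul_z, Cover.mul_w]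
  congr 2
  rw [← mul_add, ← Complex.ofReal_add]
  congr 2
  have e2 : ((g.w + Complex.exp g.z * h.w) * Complex.exp x).re =
      (g.w * Complex.exp x).re + (h.w * Complex.exp (x + g.z)).re := by
    rw [← Complex.add_re, Complex.exp_add]
    congr 1
    ring
  rw [e2]
  push_cast
  ring

lemma TFun_one (f : ℂ → ℂ) {x : ℂ} (hx : x ∈ halfStrip 0) : TFun θ 1 f x = f x := by
  have h := sheet_of_mem hx
  simp only [sheet] at h
  simp [TFun, oplus_zero hx, h]

lemma TFun_congr (g : Cover) {f f' : ℂ → ℂ} (h : f =ᵐ[cylMeasure] f') :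
    TFun θ g f =ᵐ[cylMeasure] TFun θ g f' := by
  filter_upwards [(measurePreserving_oplus g.z).quasiMeasurePreserving.ae_eq_comp h] with x hx
  simp only [TFun]
  rw [show f (oplus x g.z) = f' (oplus x g.z) from hx]

lemma norm_TFun (g : Cover) (f : ℂ → ℂ) (x : ℂ) : ‖TFun θ g f x‖ = ‖f (oplus x g.z)‖ := by
  rw [TFun, norm_mul, mul_comm Complex.I, Complex.norm_exp_ofReal_mul_I, one_mul]

lemma measurable_TFun_factor (g : Cover) : Measurable fun x : ℂ =>
    Complex.exp (Complex.I * (((g.w * Complex.exp x).re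
    + 2 * Real.pi * θ * (⌊(x + g.z).im / (2 * Real.pi)⌋ : ℝ) : ℝ) : ℂ)) := by
  have : Measurable fun x : ℂ => (⌊(x + g.z).im / (2 * Real.pi)⌋ : ℝ) :=
    (measurable_of_countable (fun n : ℤ => (n : ℝ))).comp (by fun_prop)
  fun_prop

lemma aestronglyMeasurable_TFun (g : Cover) {f : ℂ → ℂ} (hf : AEStronglyMeasurable f cylMeasure) :
    AEStronglyMeasurable (TFun θ g f) cylMeasure :=
  (measurable_TFun_factor θ g).aestronglyMeasurable.mul
    (hf.comp_measurePreserving (measurePreserving_oplus g.z))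

lemma eLpNorm_TFun (g : Cover) {f : ℂ → ℂ} (hf : AEStronglyMeasurable f cylMeasure) :
    eLpNorm (TFun θ g f) 2 cylMeasure = eLpNorm f 2 cylMeasure := by
  rw [← eLpNorm_comp_measurePreserving hf (measurePreserving_oplus g.z)]
  exact eLpNorm_congr_norm_ae (Eventually.of_forall fun x => norm_TFun θ g f x)

lemma memLp_TFun (g : Cover) {f : ℂ → ℂ} (hf : MemLp f 2 cylMeasure) :
    MemLp (TFun θ g f) 2 cylMeasure :=
  ⟨aestronglyMeasurable_TFun θ g hf.1, by rw [eLpNorm_TFun θ g hf.1]; exact hf.2⟩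

/-- The isometry `T_θ(g)` of `L²(ℝ × S¹)`. -/
def TIsom (g : Cover) : L2Cyl →ₗᵢ[ℂ] L2Cyl where
  toFun f := (memLp_TFun θ g (Lp.memLp f)).toLp _
  map_add' f f' := by
    refine Lp.ext ?_
    refine (MemLp.coeFn_toLp _).trans (EventuallyEq.trans ?_ (Lp.coeFn_add _ _).symm)
    refine (TFun_congr θ g (Lp.coeFn_add f f')).trans ?_
    filter_upwards [MemLp.coeFn_toLp (memLp_TFun θ g (Lp.memLp f)),
      MemLp.coeFn_toLp (memLp_TFun θ g (Lp.memLp f'))] with x h1 h2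
    simp [h1, h2, TFun, mul_add]
  map_smul' c f := by
    refine Lp.ext ?_
    refine (MemLp.coeFn_toLp _).trans (EventuallyEq.trans ?_ (Lp.coeFn_smul _ _).symm)
    refine (TFun_congr θ g (Lp.coeFn_smul c f)).trans ?_
    filter_upwards [MemLp.coeFn_toLp (memLp_TFun θ g (Lp.memLp f))] with x h1
    simp [h1, TFun, mul_left_comm]
  norm_map' f := by
    change ‖(memLp_TFun θ g (Lp.memLp f)).toLp _‖ = _
    rw [Lp.norm_toLp, Lp.norm_def, eLpNorm_TFun θ g (Lp.aestronglyMeasurable f)]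

lemma TIsom_coe (g : Cover) (f : L2Cyl) : TIsom θ g f =ᵐ[cylMeasure] TFun θ g f :=
  MemLp.coeFn_toLp (memLp_TFun θ g (Lp.memLp f))

lemma TIsom_mul (g h : Cover) (f : L2Cyl) : TIsom θ (g * h) f = TIsom θ g (TIsom θ h f) := by
  refine Lp.ext ?_
  refine (TIsom_coe θ _ f).trans (EventuallyEq.trans ?_ (TIsom_coe θ g _).symm)
  refine EventuallyEq.trans (Eventually.of_forall fun x => TFun_mul θ g h f x)
    (TFun_congr θ g (TIsom_coe θ h f)).symm

lemma TIsom_one (f : L2Cyl) : TIsom θ 1 f = f := by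
  refine Lp.ext ((TIsom_coe θ 1 f).trans ?_)
  filter_upwards [ae_mem_halfStrip] with x hx
  exact TFun_one θ f hx

/-- The unitary representation `T_θ`. -/
def TRep : Cover →* (L2Cyl ≃ₗᵢ[ℂ] L2Cyl) where
  toFun g :=
    { (TIsom θ g) with
      invFun := TIsom θ g⁻¹
      left_inv := fun f => by
        change TIsom θ g⁻¹ (TIsom θ g f) = f
        rw [← TIsom_mul, inv_mul_cancel, TIsom_one]
      right_inv := fun f => by
        change TIsom θ g (TIsom θ g⁻¹ f) = f
        rw [← TIsom_mul, mul_inv_cancel, TIsom_one] }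
  map_one' := LinearIsometryEquiv.ext fun f => TIsom_one θ f
  map_mul' g h := LinearIsometryEquiv.ext fun f => TIsom_mul θ g h f

lemma TRep_coe (g : Cover) (f : L2Cyl) : TRep θ g f =ᵐ[cylMeasure] TFun θ g f :=
  TIsom_coe θ g f

end TFun

/-! ### Irreducibility -/

lemma injOn_exp_halfStrip : InjOn Complex.exp (halfStrip 0) := by
  intro x hx y hy h
  obtain ⟨n, hn⟩ := Complex.exp_eq_exp_iff_exists_int.1 h
  have h1 : x = y - 2 * Real.pi * Complex.I * ((-n : ℤ) : ℂ) := by rw [hn]; push_cast; ring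
  have h2 := congrArg sheet h1
  rw [sheet_sub, sheet_of_mem hx, sheet_of_mem hy] at h2
  have h3 : n = 0 := by omega
  simpa [h3] using hn

/-- The exponential is injective on the strip, so by the Lusin–Souslin theorem it maps Borel subsets
of the strip to Borel sets, and a measure carried by the strip can be recovered from its image. -/
lemma measure_eq_of_map_exp_eq {μ ν : Measure ℂ} (hμ : μ (halfStrip 0)ᶜ = 0)
    (hν : ν (halfStrip 0)ᶜ = 0) (h : μ.map Complex.exp = ν.map Complex.exp) : μ = ν := by
  have hm : Measurable Complex.exp := Complex.measurable_exp
  have key : ∀ (ρ : Measure ℂ), ρ (halfStrip 0)ᶜ = 0 → ∀ E, MeasurableSet E →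
      ρ E = ρ.map Complex.exp (Complex.exp '' (E ∩ halfStrip 0)) := by
    intro ρ hρ E hE
    have hE' := hE.inter (measurableSet_halfStrip 0)
    have hi : MeasurableSet (Complex.exp '' (E ∩ halfStrip 0)) :=
      hE'.image_of_measurable_injOn hm (injOn_exp_halfStrip.mono inter_subset_right)
    rw [Measure.map_apply hm hi, ← measure_inter_add_sdiff (Complex.exp ⁻¹' _)
      (measurableSet_halfStrip 0), ← measure_inter_add_sdiff E (measurableSet_halfStrip 0)]
    congr 1
    · congr 1
      ext x
      constructor
      · rintro ⟨h1, h2⟩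
        exact ⟨⟨x, ⟨h1, h2⟩, rfl⟩, h2⟩
      · rintro ⟨⟨y, ⟨h1, h3⟩, h4⟩, h2⟩
        rw [← injOn_exp_halfStrip h3 h2 h4]
        exact ⟨h1, h3⟩
    · rw [measure_mono_null (sdiff_subset_compl _ _) hρ, measure_mono_null (sdiff_subset_compl _ _) hρ]
  refine Measure.ext fun E hE => ?_
  rw [key μ hμ E hE, key ν hν E hE, h]

lemma continuous_phase (w : ℂ) :
    Continuous fun x : ℂ => Complex.exp (Complex.I * ((w * Complex.exp x).re : ℂ)) := by fun_prop

lemma norm_phase (t : ℝ) : ‖Complex.exp (Complex.I * (t : ℂ))‖ = 1 := by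
  rw [mul_comm, Complex.norm_exp_ofReal_mul_I]

lemma integrable_phase_mul {h : ℂ → ℂ} (hh : Integrable h cylMeasure) (w : ℂ) :
    Integrable (fun x => Complex.exp (Complex.I * ((w * Complex.exp x).re : ℂ)) * h x)
      cylMeasure :=
  hh.bdd_mul (c := 1) (continuous_phase w).aestronglyMeasurable
    (Eventually.of_forall fun _ => (norm_phase _).le)

/-- The positive and negative parts of `r` are densities of finite measures. The hypothesis at `w =
t̄` says that their images under the exponential have equal characteristic functions at `t`, so the
two measures coincide. -/
lemma ae_zero_of_phase_real {r : ℂ → ℝ} (hr : Integrable r cylMeasure)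
    (h : ∀ w : ℂ, ∫ x, Complex.exp (Complex.I * ((w * Complex.exp x).re : ℂ)) * (r x : ℂ)
      ∂cylMeasure = 0) : r =ᵐ[cylMeasure] 0 := by
  have hm : Measurable Complex.exp := Complex.measurable_exp
  set μ := cylMeasure.withDensity fun x => ENNReal.ofReal (r x) with hμ
  set ν := cylMeasure.withDensity fun x => ENNReal.ofReal (-r x) with hν
  have fμ : IsFiniteMeasure μ := isFiniteMeasure_withDensity_ofReal hr.2
  have fν : IsFiniteMeasure ν := isFiniteMeasure_withDensity_ofReal hr.neg.2
  have hnull : cylMeasure (halfStrip 0)ᶜ = 0 := ae_mem_halfStrip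
  have hμν : μ = ν := by
    refine measure_eq_of_map_exp_eq (withDensity_absolutelyContinuous _ _ hnull)
      (withDensity_absolutelyContinuous _ _ hnull) (Measure.ext_of_charFun (funext fun t => ?_))
    have key : ∀ s : ℂ → ℝ, Integrable s cylMeasure →
        charFun ((cylMeasure.withDensity fun x => ENNReal.ofReal (s x)).map Complex.exp) t =
        ∫ x, Complex.exp (Complex.I * ((starRingEnd ℂ t * Complex.exp x).re : ℂ)) *
          ((max (s x) 0 : ℝ) : ℂ) ∂cylMeasure := by
      intro s hs
      rw [charFun_apply, integral_map hm.aemeasurable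
        (Continuous.aestronglyMeasurable (by fun_prop)),
        integral_withDensity_eq_integral_toReal_smul₀ hs.1.aemeasurable.ennreal_ofReal
          (Eventually.of_forall fun x => ENNReal.ofReal_lt_top)]
      refine integral_congr_ae (Eventually.of_forall fun x => ?_)
      simp only [ENNReal.toReal_ofReal', Complex.real_smul, Complex.inner]
      have e : (t * starRingEnd ℂ (Complex.exp x)).re =
          (starRingEnd ℂ t * Complex.exp x).re := by simp [Complex.mul_re]
      rw [e, mul_comm Complex.I]
      ring
    rw [hμ, hν, key r hr, key (fun x => -r x) hr.neg, ← sub_eq_zero, ← integral_sub]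
    · rw [← h (starRingEnd ℂ t)]
      refine integral_congr_ae (Eventually.of_forall fun x => ?_)
      simp only
      rw [← mul_sub, ← Complex.ofReal_sub]
      congr 2
      rcases le_total (r x) 0 with h0 | h0
      · rw [max_eq_right h0, max_eq_left (by linarith)]; ring
      · rw [max_eq_left h0, max_eq_right (by linarith)]; ring
    · exact integrable_phase_mul (hr.pos_part.ofReal) _
    · exact integrable_phase_mul (hr.neg.pos_part.ofReal) _
  have mr : AEMeasurable (fun x => ENNReal.ofReal (-r x)) cylMeasure :=
    hr.1.aemeasurable.neg.ennreal_ofReal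
  rw [hμ, hν, withDensity_eq_iff hr.1.aemeasurable.ennreal_ofReal mr] at hμν
  · filter_upwards [hμν] with x hx
    rcases le_total (r x) 0 with h0 | h0
    · rw [ENNReal.ofReal_of_nonpos h0] at hx
      have := ENNReal.ofReal_eq_zero.1 hx.symm
      simp only [Pi.zero_apply]
      linarith
    · rw [ENNReal.ofReal_of_nonpos (by linarith : -r x ≤ 0)] at hx
      have := ENNReal.ofReal_eq_zero.1 hx
      simp only [Pi.zero_apply]
      linarith
  · exact (hr.lintegral_lt_top).ne

/-- Uniqueness for the Fourier transform in the variable `e ^ x`. -/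
lemma ae_zero_of_phase {h : ℂ → ℂ} (hh : Integrable h cylMeasure)
    (h0 : ∀ w : ℂ, ∫ x, Complex.exp (Complex.I * ((w * Complex.exp x).re : ℂ)) * h x
      ∂cylMeasure = 0) : h =ᵐ[cylMeasure] 0 := by
  -- Conjugating the hypothesis at `-w` gives it for the conjugate of `h`, hence for the real and
  -- imaginary parts.
  have hconj : ∀ w : ℂ, ∫ x, Complex.exp (Complex.I * ((w * Complex.exp x).re : ℂ)) *
      starRingEnd ℂ (h x) ∂cylMeasure = 0 := fun w => by
    have e := congrArg (starRingEnd ℂ) (h0 (-w))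
    rw [← integral_conj, map_zero] at e
    rw [← e]
    refine integral_congr_ae (Eventually.of_forall fun x => ?_)
    simp [← Complex.exp_conj]
    left
    congr 1
    ring
  have hci : Integrable (fun x => starRingEnd ℂ (h x)) cylMeasure :=
    Complex.conjCLE.toContinuousLinearMap.integrable_comp hh
  have hre := ae_zero_of_phase_real hh.re fun w => by
    have e : ∀ x, Complex.exp (Complex.I * ((w * Complex.exp x).re : ℂ)) * ((RCLike.re (h x) : ℝ) : ℂ)
        = (1 / 2) * (Complex.exp (Complex.I * ((w * Complex.exp x).re : ℂ)) * h x +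
          Complex.exp (Complex.I * ((w * Complex.exp x).re : ℂ)) * starRingEnd ℂ (h x)) := fun x => by
      rw [← mul_add, Complex.add_conj]
      simp
      ring
    simp_rw [e]
    rw [integral_const_mul, integral_add (integrable_phase_mul hh w) (integrable_phase_mul hci w),
      h0, hconj]
    simp
  have him := ae_zero_of_phase_real hh.im fun w => by
    have e : ∀ x, Complex.exp (Complex.I * ((w * Complex.exp x).re : ℂ)) * ((RCLike.im (h x) : ℝ) : ℂ)
        = (1 / (2 * Complex.I)) * (Complex.exp (Complex.I * ((w * Complex.exp x).re : ℂ)) * h x -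
          Complex.exp (Complex.I * ((w * Complex.exp x).re : ℂ)) * starRingEnd ℂ (h x)) := fun x => by
      rw [← mul_sub, Complex.sub_conj]
      simp
      field_simp
      rw [Complex.I_sq]
      ring
    simp_rw [e]
    rw [integral_const_mul, integral_sub (integrable_phase_mul hh w) (integrable_phase_mul hci w),
      h0, hconj]
    simp
  filter_upwards [hre, him] with x h1 h2
  exact Complex.ext h1 h2

lemma TFun_eq_phase_mul (θ : ℝ) (z w : ℂ) (f : ℂ → ℂ) (x : ℂ) :
    TFun θ ⟨z, w⟩ f x =
      Complex.exp (Complex.I * ((w * Complex.exp x).re : ℂ)) * TFun θ ⟨z, 0⟩ f x := by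
  simp only [TFun]
  rw [← mul_assoc, ← Complex.exp_add]
  congr 2
  push_cast
  simp
  ring

/-- For fixed `z`, all `w` together form a Fourier transform in `e^x` of `x ↦ ⟪g(x), (T_θ(z, 0)
f)(x)⟫`, so this function vanishes almost everywhere. By Tonelli the integral of `|g(x)|² |f(x ⊕
z)|²` over `x` and `z` is `‖g‖² ‖f‖²`, since the shift in `z` preserves the measure. -/
lemma eq_zero_or_eq_zero_of_inner_TRep {θ : ℝ} {f g : L2Cyl}
    (h : ∀ a : Cover, inner ℂ g (TRep θ a f) = 0) : f = 0 ∨ g = 0 := by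
  have h1 : ∀ z : ℂ, ∀ᵐ x ∂cylMeasure, ‖g x‖ₑ ^ 2 * ‖f (oplus x z)‖ₑ ^ 2 = 0 := by
    intro z
    have hi : Integrable (fun x => inner ℂ (g x) ((TRep θ ⟨z, 0⟩ f) x)) cylMeasure :=
      L2.integrable_inner g (TRep θ ⟨z, 0⟩ f)
    have h2 := ae_zero_of_phase hi fun w => by
      refine Eq.trans ?_ (h ⟨z, w⟩)
      rw [L2.inner_def]
      refine integral_congr_ae ?_
      filter_upwards [TRep_coe θ ⟨z, 0⟩ f, TRep_coe θ ⟨z, w⟩ f] with x e1 e2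
      rw [e2, e1, TFun_eq_phase_mul θ z w]
      simp only [RCLike.inner_apply]
      ring
    filter_upwards [h2, TRep_coe θ ⟨z, 0⟩ f] with x e1 e2
    have e3 : ‖inner ℂ (g x) ((TRep θ ⟨z, 0⟩ f) x)‖ₑ = 0 := by rw [e1]; simp
    rw [e2, RCLike.inner_apply, enorm_mul] at e3
    have e4 : ‖TFun θ ⟨z, 0⟩ f x‖ₑ = ‖f (oplus x z)‖ₑ := by
      rw [← ofReal_norm, ← ofReal_norm, norm_TFun]
    rw [e4, RCLike.enorm_conj] at e3
    rw [← mul_pow, mul_comm ‖g x‖ₑ, e3, zero_pow two_ne_zero]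
  have mf : Measurable fun x => ‖f x‖ₑ ^ 2 := (Lp.stronglyMeasurable f).enorm.pow_const 2
  have mg : Measurable fun x => ‖g x‖ₑ ^ 2 := (Lp.stronglyMeasurable g).enorm.pow_const 2
  have h2 : ∫⁻ z, ∫⁻ x, ‖g x‖ₑ ^ 2 * ‖f (oplus x z)‖ₑ ^ 2 ∂cylMeasure ∂cylMeasure = 0 := by
    simp_rw [lintegral_congr_ae (h1 _)]
    simp
  have h3 : ∀ x, ∫⁻ z, ‖g x‖ₑ ^ 2 * ‖f (oplus x z)‖ₑ ^ 2 ∂cylMeasure =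
      ‖g x‖ₑ ^ 2 * ∫⁻ z, ‖f z‖ₑ ^ 2 ∂cylMeasure := fun x => by
    simp_rw [oplus_comm x]
    have mc : Measurable fun z => ‖f (oplus z x)‖ₑ ^ 2 :=
      mf.comp (measurePreserving_oplus x).measurable
    have hc := (measurePreserving_oplus x).lintegral_comp mf
    rw [lintegral_const_mul _ mc, hc]
  rw [lintegral_lintegral_swap] at h2
  · simp_rw [h3] at h2
    rw [lintegral_mul_const _ mg, mul_eq_zero, lintegral_eq_zero_iff mg,
      lintegral_eq_zero_iff mf] at h2
    have key : ∀ k : L2Cyl, (fun x => ‖k x‖ₑ ^ 2) =ᵐ[cylMeasure] 0 → k = 0 := fun k hk => by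
      refine Lp.ext (EventuallyEq.trans ?_ (Lp.coeFn_zero _ _ _).symm)
      filter_upwards [hk] with x hx
      simpa using hx
    exact h2.symm.imp (key f) (key g)
  · exact ((mg.comp measurable_snd).mul
      (mf.comp (measurable_oplus.comp (measurable_snd.prodMk measurable_fst)))).aemeasurable

instance : Nontrivial L2Cyl := by
  have hs : MeasurableSet (Ioo (0 : ℝ) 1 ×ℂ Ioo (0 : ℝ) 1) :=
    (isOpen_Ioo.reProdIm isOpen_Ioo).measurableSet
  have hsub : (Ioo (0 : ℝ) 1 ×ℂ Ioo (0 : ℝ) 1) ⊆ halfStrip 0 := fun x hx =>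
    ⟨hx.2.1.le, by have := hx.2.2; have := Real.pi_gt_three; simp at *; linarith⟩
  have hv : cylMeasure (Ioo (0 : ℝ) 1 ×ℂ Ioo (0 : ℝ) 1) =
      volume (Ioo (0 : ℝ) 1 ×ℂ Ioo (0 : ℝ) 1) := by
    rw [cylMeasure_eq, Measure.restrict_apply hs, inter_eq_left.2 hsub]
  have hfin : cylMeasure (Ioo (0 : ℝ) 1 ×ℂ Ioo (0 : ℝ) 1) ≠ ⊤ := by
    rw [hv]
    exact ((Metric.isBounded_Ioo 0 1).reProdIm (Metric.isBounded_Ioo 0 1)).measure_lt_top.ne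
  have hpos : cylMeasure (Ioo (0 : ℝ) 1 ×ℂ Ioo (0 : ℝ) 1) ≠ 0 := by
    rw [hv]
    refine ((isOpen_Ioo.reProdIm isOpen_Ioo).measure_pos _ ⟨⟨1 / 2, 1 / 2⟩, ?_⟩).ne'
    simp [Complex.mem_reProdIm]
    norm_num
  refine ⟨indicatorConstLp 2 hs hfin (1 : ℂ), 0, fun h => hpos ?_⟩
  have := norm_indicatorConstLp (c := (1 : ℂ)) (hs := hs) (hμs := hfin) two_ne_zero ENNReal.ofNat_ne_top
  rw [h, norm_zero, norm_one, one_mul] at this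
  have h2 := (Real.rpow_eq_zero measureReal_nonneg (by simp)).1 this.symm
  exact (measureReal_eq_zero_iff hfin).1 h2

lemma isIrred_TRep (θ : ℝ) : IsIrred (TRep θ) := by
  refine ⟨inferInstance, fun W hW hinv => ?_⟩
  by_cases hbot : W = ⊥
  · exact Or.inl hbot
  right
  obtain ⟨f, hf, hf0⟩ := Submodule.exists_mem_ne_zero_of_ne_bot hbot
  have : CompleteSpace W := hW.completeSpace_coe
  rw [← Submodule.orthogonal_eq_bot_iff, Submodule.eq_bot_iff]
  intro g hg
  refine (eq_zero_or_eq_zero_of_inner_TRep (θ := θ) (f := f) (g := g) fun a => ?_).resolve_left hf0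
  exact (Submodule.mem_orthogonal' W g).1 hg _ (hinv a f hf)

/-! ### Dominated convergence in `L²(ℝ × S¹)` -/

lemma norm_sq_eq_integral (f : L2Cyl) : ‖f‖ ^ 2 = ∫ x, ‖f x‖ ^ 2 ∂cylMeasure := by
  have h : ((‖f‖ ^ 2 : ℝ) : ℂ) = ((∫ x, ‖f x‖ ^ 2 ∂cylMeasure : ℝ) : ℂ) := by
    rw [← integral_complex_ofReal]
    have := inner_self_eq_norm_sq_to_K (𝕜 := ℂ) f
    push_cast
    refine this.symm.trans ?_
    rw [L2.inner_def]
    refine integral_congr_ae (Eventually.of_forall fun x => ?_)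
    simp only [inner_self_eq_norm_sq_to_K]
    simp
  exact_mod_cast h

/-- The slab `|Re x| ≤ R`. -/
def slab (R : ℝ) : Set ℂ := {x | |x.re| ≤ R}

lemma measurableSet_slab (R : ℝ) : MeasurableSet (slab R) :=
  measurableSet_le (Complex.measurable_re.norm) measurable_const

lemma isCompact_box (R : ℝ) : IsCompact (Icc (-R) R ×ℂ Icc 0 (2 * Real.pi)) :=
  isCompact_Icc.reProdIm isCompact_Icc

lemma cylMeasure_slab_lt_top (R : ℝ) : cylMeasure (slab R) < ⊤ := by
  rw [cylMeasure_eq, Measure.restrict_apply (measurableSet_slab R)]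
  refine lt_of_le_of_lt (measure_mono ?_) (isCompact_box R).measure_lt_top
  rintro x ⟨h1, h2, h3⟩
  exact ⟨abs_le.1 h1, h2, by simpa using h3.le⟩

lemma integrable_indicator_slab (R M : ℝ) :
    Integrable ((slab R).indicator fun _ => M) cylMeasure :=
  (integrable_indicator_iff (measurableSet_slab R)).2
    (integrableOn_const (cylMeasure_slab_lt_top R).ne)

lemma memLp_of_slab {h : ℂ → ℂ} (hm : AEStronglyMeasurable h cylMeasure) (R M : ℝ)
    (hb : ∀ᵐ x ∂cylMeasure, ‖h x‖ ≤ M) (h0 : ∀ x, x ∉ slab R → h x = 0) :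
    MemLp h 2 cylMeasure := by
  have e : (slab R).indicator h = h := by
    funext x
    by_cases hx : x ∈ slab R
    · rw [indicator_of_mem hx]
    · rw [indicator_of_notMem hx, h0 x hx]
  rw [← e, memLp_indicator_iff_restrict (measurableSet_slab R)]
  have : IsFiniteMeasure (cylMeasure.restrict (slab R)) :=
    ⟨by rw [Measure.restrict_apply_univ]; exact cylMeasure_slab_lt_top R⟩
  exact MemLp.of_bound hm.restrict M (ae_restrict_of_ae hb)

/-- A slab has finite measure on the cylinder, so a constant bound there is square integrable and
dominated convergence applies to the squared difference. -/
lemma tendsto_L2_of_dominated {ι : Type*} {l : Filter ι} [l.IsCountablyGenerated]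
    {F : ι → L2Cyl} {f : L2Cyl} {G : ι → ℂ → ℂ} {g : ℂ → ℂ} (hF : ∀ i, F i =ᵐ[cylMeasure] G i)
    (hf : f =ᵐ[cylMeasure] g) (R M : ℝ)
    (hb : ∀ᶠ i in l, ∀ᵐ x ∂cylMeasure, ‖G i x - g x‖ ≤ (slab R).indicator (fun _ => M) x)
    (hlim : ∀ x, Tendsto (fun i => G i x) l (𝓝 (g x))) : Tendsto F l (𝓝 f) := by
  have hsub : ∀ i, (F i - f : L2Cyl) =ᵐ[cylMeasure] fun x => G i x - g x := fun i => by
    filter_upwards [Lp.coeFn_sub (F i) f, hF i, hf] with x h1 h2 h3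
    rw [h1, Pi.sub_apply, h2, h3]
  rw [tendsto_iff_norm_sub_tendsto_zero]
  have h2 : Tendsto (fun i => ‖F i - f‖ ^ 2) l (𝓝 0) := by
    have e : ∀ i, ‖F i - f‖ ^ 2 = ∫ x, ‖G i x - g x‖ ^ 2 ∂cylMeasure := fun i => by
      rw [norm_sq_eq_integral]
      refine integral_congr_ae ?_
      filter_upwards [hsub i] with x hx
      simp only [hx]
    simp_rw [e]
    have := tendsto_integral_filter_of_dominated_convergence (μ := cylMeasure) (l := l)
      (F := fun i x => ‖G i x - g x‖ ^ 2) (f := fun _ => (0 : ℝ))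
      ((slab R).indicator fun _ => M ^ 2)
      (Eventually.of_forall fun i =>
        (((Lp.aestronglyMeasurable (F i - f)).congr (hsub i)).norm.pow 2))
      (by
        filter_upwards [hb] with i hi
        filter_upwards [hi] with x h3
        rw [norm_pow, norm_norm]
        by_cases hx : x ∈ slab R
        · rw [indicator_of_mem hx] at h3 ⊢
          exact pow_le_pow_left₀ (norm_nonneg _) h3 2
        · rw [indicator_of_notMem hx] at h3 ⊢
          rw [le_antisymm h3 (norm_nonneg _)]
          simp)
      (integrable_indicator_slab R _)
      (Eventually.of_forall fun x => by
        simpa using ((hlim x).sub_const (g x)).norm.pow 2)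
    simpa using this
  have h3 := h2.sqrt
  simpa [Real.sqrt_sq] using h3

/-! ### Smooth quasi-periodic functions -/

/-- Smooth functions on `ℂ` with `h(u + 2πi) = e ^ {2πi θ} h(u)` and support in a slab. -/
structure IsQuasi (θ : ℝ) (h : ℂ → ℂ) : Prop where
  smooth : ContDiff ℝ ∞ h
  quasi : ∀ u, h (u + 2 * Real.pi * Complex.I) = Complex.exp (2 * Real.pi * Complex.I * θ) * h u
  support : ∃ R, ∀ u, u ∉ slab R → h u = 0

lemma quasi_int {θ : ℝ} {h : ℂ → ℂ}
    (hq : ∀ u, h (u + 2 * Real.pi * Complex.I) = Complex.exp (2 * Real.pi * Complex.I * θ) * h u)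
    (n : ℤ) (u : ℂ) :
    h (u + 2 * Real.pi * Complex.I * n) = Complex.exp (2 * Real.pi * Complex.I * θ * n) * h u := by
  induction n using Int.induction_on generalizing u with
  | zero => simp
  | succ n ih =>
    have e : u + 2 * Real.pi * Complex.I * ((n + 1 : ℤ) : ℂ) =
        (u + 2 * Real.pi * Complex.I * (n : ℤ)) + 2 * Real.pi * Complex.I := by push_cast; ring
    rw [e, hq, ih, ← mul_assoc, ← Complex.exp_add]
    congr 2
    push_cast
    ring
  | pred n ih =>
    have h1 := hq (u + 2 * Real.pi * Complex.I * ((-n - 1 : ℤ) : ℂ))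
    have e : u + 2 * Real.pi * Complex.I * ((-n - 1 : ℤ) : ℂ) + 2 * Real.pi * Complex.I =
        u + 2 * Real.pi * Complex.I * ((-n : ℤ) : ℂ) := by push_cast; ring
    rw [e, ih] at h1
    refine mul_left_cancel₀ (Complex.exp_ne_zero (2 * Real.pi * Complex.I * θ)) ?_
    rw [← h1, ← mul_assoc, ← Complex.exp_add]
    congr 2
    push_cast
    ring

/-- On quasi-periodic functions, `T_θ(z, w)` is `e ^ {i Re (w e ^ x)}` times the shift by `z`. -/
lemma TFun_quasi {θ : ℝ} {h : ℂ → ℂ}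
    (hq : ∀ u, h (u + 2 * Real.pi * Complex.I) = Complex.exp (2 * Real.pi * Complex.I * θ) * h u)
    (g : Cover) (x : ℂ) :
    TFun θ g h x = Complex.exp (Complex.I * ((g.w * Complex.exp x).re : ℂ)) * h (x + g.z) := by
  have e : x + g.z = oplus x g.z + 2 * Real.pi * Complex.I * (sheet (x + g.z) : ℂ) := by
    rw [oplus_eq]; ring
  conv_rhs => rw [e, quasi_int hq, ← mul_assoc, ← Complex.exp_add]
  rw [TFun]
  congr 2
  simp only [sheet]
  push_cast
  ring

namespace IsQuasi

variable {θ : ℝ} {h : ℂ → ℂ}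

lemma exists_bound (hh : IsQuasi θ h) : ∃ M, ∀ u, ‖h u‖ ≤ M := by
  obtain ⟨R, hR⟩ := hh.support
  obtain ⟨M, hM⟩ := (isCompact_box R).exists_bound_of_continuousOn hh.smooth.continuous.continuousOn
  refine ⟨max M 0, fun u => ?_⟩
  -- Evaluated at `0` for the shift by `u`, this says that `‖h(u)‖` equals the norm of `h` at the
  -- reduction of `u` to the strip; there the slab is inside a compact box.
  have h1 := norm_TFun θ ⟨u, 0⟩ h 0
  rw [TFun_quasi hh.quasi, norm_mul, norm_phase, one_mul] at h1
  simp only [zero_add] at h1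
  rw [h1]
  by_cases hu : oplus 0 u ∈ slab R
  · refine (hM _ ⟨abs_le.1 hu, ?_⟩).trans (le_max_left _ _)
    have := oplus_mem 0 u
    exact ⟨this.1, by simpa using this.2.le⟩
  · rw [hR _ hu, norm_zero]
    exact le_max_right _ _

lemma memLp (hh : IsQuasi θ h) : MemLp h 2 cylMeasure := by
  obtain ⟨R, hR⟩ := hh.support
  obtain ⟨M, hM⟩ := hh.exists_bound
  exact memLp_of_slab hh.smooth.continuous.aestronglyMeasurable R M (Eventually.of_forall hM) hR

lemma add {h' : ℂ → ℂ} (hh : IsQuasi θ h) (hh' : IsQuasi θ h') : IsQuasi θ fun u => h u + h' u := by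
  obtain ⟨R, hR⟩ := hh.support
  obtain ⟨R', hR'⟩ := hh'.support
  refine ⟨hh.smooth.add hh'.smooth, fun u => by rw [hh.quasi, hh'.quasi, mul_add],
    max R R', fun u hu => ?_⟩
  have h1 : u ∉ slab R := fun h => hu (le_max_of_le_left (a := |u.re|) h)
  have h2 : u ∉ slab R' := fun h => hu (le_max_of_le_right (a := |u.re|) h)
  rw [hR u h1, hR' u h2, add_zero]

lemma periodic_mul (hh : IsQuasi θ h) {p : ℂ → ℂ} (hp : ContDiff ℝ ∞ p)
    (hper : ∀ u, p (u + 2 * Real.pi * Complex.I) = p u) : IsQuasi θ fun u => p u * h u := by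
  obtain ⟨R, hR⟩ := hh.support
  exact ⟨hp.mul hh.smooth, fun u => by rw [hper, hh.quasi]; ring, R, fun u hu => by simp [hR u hu]⟩

lemma shift (hh : IsQuasi θ h) (z : ℂ) : IsQuasi θ fun u => h (u + z) := by
  obtain ⟨R, hR⟩ := hh.support
  refine ⟨hh.smooth.comp (contDiff_id.add contDiff_const), fun u => ?_, R + |z.re|, fun u hu => ?_⟩
  · rw [← hh.quasi]
    congr 1
    ring
  · refine hR _ fun h1 => hu ?_
    simp only [slab, mem_ofPred_eq, Complex.add_re] at h1 ⊢
    have := abs_sub (u.re + z.re) z.re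
    simp only [add_sub_cancel_right] at this
    linarith

lemma act (hh : IsQuasi θ h) (g : Cover) : IsQuasi θ (TFun θ g h) := by
  have e : TFun θ g h = fun x =>
      Complex.exp (Complex.I * ((g.w * Complex.exp x).re : ℂ)) * h (x + g.z) :=
    funext (TFun_quasi hh.quasi g)
  rw [e]
  refine (hh.shift g.z).periodic_mul ?_ fun u => ?_
  · exact (contDiff_const.mul (Complex.ofRealCLM.contDiff.comp (Complex.reCLM.contDiff.comp
      (contDiff_const.mul contDiff_id.cexp)))).cexp
  · rw [Complex.exp_periodic]

end IsQuasi

/-- The vector field operator `α ∂/∂u + ᾱ ∂/∂ū + (i/2) (β e ^ u + β̄ e ^ ū)` on `ℂ`. -/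
def cylOp (A : Alg) (h : ℂ → ℂ) (u : ℂ) : ℂ :=
  fderiv ℝ h u A.1 + Complex.I / 2 * (A.2 * Complex.exp u +
    starRingEnd ℂ A.2 * Complex.exp (starRingEnd ℂ u)) * h u

lemma cylOp_eq (A : Alg) (h : ℂ → ℂ) (u : ℂ) :
    cylOp A h u = fderiv ℝ h u A.1 + Complex.I * ((A.2 * Complex.exp u).re : ℂ) * h u := by
  rw [cylOp, Complex.re_eq_add_conj, map_mul, Complex.exp_conj]
  ring

lemma IsQuasi.cylOp {θ : ℝ} {h : ℂ → ℂ} (hh : IsQuasi θ h) (A : Alg) : IsQuasi θ (cylOp A h) := by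
  have e : AffC.cylOp A h = fun u => fderiv ℝ h u A.1 +
      Complex.I * ((A.2 * Complex.exp u).re : ℂ) * h u := funext (cylOp_eq A h)
  rw [e]
  refine IsQuasi.add ⟨(hh.smooth.fderiv_right (by simp)).clm_apply contDiff_const, fun u => ?_, ?_⟩
    (hh.periodic_mul (contDiff_const.mul (Complex.ofRealCLM.contDiff.comp
      (Complex.reCLM.contDiff.comp (contDiff_const.mul contDiff_id.cexp)))) fun u => ?_)
  · have h1 : fderiv ℝ (fun u => h (u + 2 * Real.pi * Complex.I)) u =
        fderiv ℝ h (u + 2 * Real.pi * Complex.I) := fderiv_comp_add_right _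
    rw [← h1]
    simp_rw [hh.quasi]
    rw [fderiv_const_mul (hh.smooth.differentiable (by simp) u)]
    rfl
  · obtain ⟨R, hR⟩ := hh.support
    refine ⟨R, fun u hu => ?_⟩
    have ho : IsOpen (slab R)ᶜ := by
      have : slab R = (fun x : ℂ => |x.re|) ⁻¹' Iic R := rfl
      rw [this, ← preimage_compl]
      exact (isClosed_Iic.isOpen_compl).preimage (Complex.continuous_re.abs)
    have : h =ᶠ[𝓝 u] fun _ => 0 := by
      filter_upwards [ho.mem_nhds hu] with y hy
      exact hR y hy
    rw [this.fderiv_eq]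
    simp
  · rw [Complex.exp_periodic]

/-- The smooth quasi-periodic functions as a subspace of `L²(ℝ × S¹)`. -/
def quasiSubmodule (θ : ℝ) : Submodule ℂ L2Cyl where
  carrier := {f | ∃ h, IsQuasi θ h ∧ f =ᵐ[cylMeasure] h}
  add_mem' := by
    rintro f f' ⟨h, hh, e⟩ ⟨h', hh', e'⟩
    exact ⟨_, hh.add hh', (Lp.coeFn_add f f').trans (e.add e')⟩
  zero_mem' := ⟨fun _ => 0, ⟨contDiff_const, by simp, 0, by simp⟩, Lp.coeFn_zero _ _ _⟩
  smul_mem' := by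
    rintro c f ⟨h, hh, e⟩
    refine ⟨_, hh.periodic_mul (contDiff_const (c := c)) fun _ => rfl, ?_⟩
    exact (Lp.coeFn_smul c f).trans (e.const_smul c)

lemma TRep_mem_quasiSubmodule {θ : ℝ} (g : Cover) {f : L2Cyl} (hf : f ∈ quasiSubmodule θ) :
    TRep θ g f ∈ quasiSubmodule θ := by
  obtain ⟨h, hh, e⟩ := hf
  exact ⟨_, hh.act g, (TRep_coe θ g f).trans (TFun_congr θ g e)⟩

/-- An invariant subspace of an irreducible representation is zero or dense. -/
lemma IsIrred.dense_of_invariant {G E : Type*} [Group G] [NormedAddCommGroup E]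
    [InnerProductSpace ℂ E] {T : G →* (E ≃ₗᵢ[ℂ] E)} (hT : IsIrred T) (W : Submodule ℂ E)
    (hW : ∀ g, ∀ f ∈ W, T g f ∈ W) {f : E} (hf : f ∈ W) (hf0 : f ≠ 0) : Dense (W : Set E) := by
  rw [Submodule.dense_iff_topologicalClosure_eq_top]
  refine (hT.2 W.topologicalClosure W.isClosed_topologicalClosure fun g k hk => ?_).resolve_left ?_
  · exact map_mem_closure (T g).continuous hk (hW g)
  · intro h
    have := W.le_topologicalClosure hf
    rw [h] at this
    exact hf0 ((Submodule.mem_bot ℂ).1 this)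

/-- The point `i` is interior to the strip, so a continuous function that is nonzero there does not
vanish almost everywhere. -/
lemma ne_zero_of_continuous {f : L2Cyl} {h : ℂ → ℂ} (hf : f =ᵐ[cylMeasure] h)
    (hc : Continuous h) (h1 : h Complex.I ≠ 0) : f ≠ 0 := by
  rintro rfl
  have hU : IsOpen {x : ℂ | 0 < x.im ∧ x.im < 2 * Real.pi} :=
    (isOpen_lt continuous_const Complex.continuous_im).inter
      (isOpen_lt Complex.continuous_im continuous_const)
  have hz : h =ᵐ[cylMeasure] 0 := hf.symm.trans (Lp.coeFn_zero _ _ _)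
  have hz' := ae_restrict_of_ae_restrict_of_subset (s := {x : ℂ | 0 < x.im ∧ x.im < 2 * Real.pi})
    (t := {x : ℂ | 0 ≤ x.im ∧ x.im < 2 * Real.pi}) (fun x hx => ⟨hx.1.le, hx.2⟩) hz
  have := Measure.eqOn_open_of_ae_eq hz' hU hc.continuousOn continuousOn_const
  refine h1 (this ?_)
  have := Real.pi_gt_three
  simp
  linarith

lemma isQuasi_bump (θ : ℝ) : ∃ h, IsQuasi θ h ∧ h Complex.I ≠ 0 := by
  let b : ContDiffBump (0 : ℝ) := ⟨1, 2, one_pos, one_lt_two⟩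
  refine ⟨fun u => Complex.exp (Complex.I * θ * u.im) * (b u.re : ℝ), ⟨?_, fun u => ?_, 2,
    fun u hu => ?_⟩, ?_⟩
  · exact (contDiff_const.mul (Complex.ofRealCLM.contDiff.comp Complex.imCLM.contDiff)).cexp.mul
      (Complex.ofRealCLM.contDiff.comp (b.contDiff.comp Complex.reCLM.contDiff))
  · rw [← mul_assoc, ← Complex.exp_add]
    congr 2
    · simp
      ring
    · simp
  · have : b u.re = 0 := by
      refine b.zero_of_le_dist ?_
      simp only [slab, mem_ofPred_eq, not_le] at hu
      simpa [Real.dist_eq] using hu.le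
    simp [this]
  · have : b 0 = 1 := b.one_of_mem_closedBall (by simp [b])
    simp [this]

/-- A nonzero invariant subspace of an irreducible representation is dense; one bump function
suffices. -/
lemma dense_quasiSubmodule (θ : ℝ) : Dense (quasiSubmodule θ : Set L2Cyl) := by
  obtain ⟨h, hh, h1⟩ := isQuasi_bump θ
  have e := MemLp.coeFn_toLp hh.memLp
  exact (isIrred_TRep θ).dense_of_invariant _ (fun g f hf => TRep_mem_quasiSubmodule g hf)
    (f := hh.memLp.toLp h) ⟨h, hh, e⟩ (ne_zero_of_continuous e hh.smooth.continuous h1)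

/-! ### Strong continuity -/

lemma continuous_z : Continuous fun g : Cover => g.z := continuous_fst.comp Cover.continuous_pair

lemma continuous_w : Continuous fun g : Cover => g.w := continuous_snd.comp Cover.continuous_pair

instance : FirstCountableTopology Cover :=
  TopologicalSpace.firstCountableTopology_induced _ _ _

lemma tendsto_TRep_quasi {θ : ℝ} {f : L2Cyl} (hf : f ∈ quasiSubmodule θ) :
    Tendsto (fun g => TRep θ g f) (𝓝 1) (𝓝 f) := by
  obtain ⟨h, hh, e⟩ := hf
  obtain ⟨R, hR⟩ := hh.support
  obtain ⟨M, hM⟩ := hh.exists_bound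
  have hc := hh.smooth.continuous
  refine tendsto_L2_of_dominated (G := fun g => TFun θ g h) (g := h)
    (fun g => (TRep_coe θ g f).trans (TFun_congr θ g e)) e (R + 1) (2 * M) ?_ fun x => ?_
  · have hz : ∀ᶠ g : Cover in 𝓝 1, |g.z.re| < 1 := by
      have : Continuous fun g : Cover => |g.z.re| := (Complex.continuous_re.comp continuous_z).abs
      exact this.continuousAt.eventually_lt continuousAt_const (by simp)
    filter_upwards [hz] with g hg
    refine Eventually.of_forall fun x => ?_
    rw [TFun_quasi hh.quasi]
    by_cases hx : x ∈ slab (R + 1)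
    · rw [indicator_of_mem hx]
      refine (norm_sub_le _ _).trans ?_
      rw [norm_mul, norm_phase, one_mul]
      linarith [hM (x + g.z), hM x]
    · rw [indicator_of_notMem hx, hR x, hR (x + g.z)]
      · simp
      · intro h1
        apply hx
        simp only [slab, mem_ofPred_eq, Complex.add_re] at h1 ⊢
        have := abs_sub (x.re + g.z.re) g.z.re
        simp only [add_sub_cancel_right] at this
        linarith
      · intro h1
        apply hx
        simp only [slab, mem_ofPred_eq] at h1 ⊢
        linarith
  · have h1 : Continuous fun g : Cover => TFun θ g h x := by
      simp_rw [TFun_quasi hh.quasi]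
      have := continuous_z
      have := continuous_w
      fun_prop
    have h2 := h1.tendsto 1
    have h3 : TFun θ 1 h x = h x := by rw [TFun_quasi hh.quasi]; simp
    rwa [h3] at h2

/-- Continuity at `1` passes from the dense subspace to all vectors because the operators are
isometries, and from `1` to `g` by writing `k = g (g⁻¹ k)`. -/
lemma continuous_TRep (θ : ℝ) (f : L2Cyl) : Continuous fun g => TRep θ g f := by
  have h1 : ∀ f : L2Cyl, Tendsto (fun g => TRep θ g f) (𝓝 1) (𝓝 f) := by
    intro f
    rw [Metric.tendsto_nhds]
    intro ε hε
    obtain ⟨f', hf', hd⟩ := (dense_quasiSubmodule θ).exists_dist_lt f (ε := ε / 3) (by linarith)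
    filter_upwards [(Metric.tendsto_nhds.1 (tendsto_TRep_quasi hf')) (ε / 3) (by linarith)]
      with g hg
    calc dist (TRep θ g f) f ≤ dist (TRep θ g f) (TRep θ g f') + dist (TRep θ g f') f' + dist f' f :=
          dist_triangle4 _ _ _ _
      _ < ε := by
          rw [(TRep θ g).dist_map, dist_comm f' f]
          linarith
  rw [continuous_iff_continuousAt]
  intro g
  have h2 : Tendsto (fun k : Cover => g⁻¹ * k) (𝓝 g) (𝓝 1) := by
    have := (continuous_const_mul g⁻¹).tendsto g
    rwa [inv_mul_cancel] at this
  have h3 := ((TRep θ g).continuous.tendsto f).comp ((h1 f).comp h2)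
  refine h3.congr fun k => ?_
  have h4 : TRep θ g * TRep θ (g⁻¹ * k) = TRep θ k := by rw [← map_mul, mul_inv_cancel_left]
  exact DFunLike.congr_fun h4 f

/-! ### The orbit method -/

lemma coadStab_functional {a b : ℂ} (hb : b ≠ 0) :
    coadStab (functional (a, b)) = {g | ∃ m : ℤ, g = ⟨2 * Real.pi * Complex.I * m, 0⟩} := by
  ext g
  simp only [coadStab, mem_ofPred_eq]
  rw [coad_functional]
  constructor
  · intro h
    have h1 := functional_injective h
    simp only [Prod.mk.injEq] at h1
    have h2 : Complex.exp (-g.z) = 1 := mul_left_cancel₀ hb (h1.2.trans (mul_one b).symm)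
    rw [h2, mul_one, add_eq_left, mul_eq_zero] at h1
    obtain ⟨n, hn⟩ := Complex.exp_eq_one_iff.1 h2
    refine ⟨-n, ?_⟩
    ext
    · rw [← neg_neg g.z, hn]
      push_cast
      ring
    · exact h1.1.resolve_left hb
  · rintro ⟨m, rfl⟩
    have h2 : Complex.exp (-(2 * Real.pi * Complex.I * m)) = 1 :=
      Complex.exp_eq_one_iff.2 ⟨-m, by push_cast; ring⟩
    simp [h2]

/-- The abelian ideal of the translations. -/
def translations : Submodule ℝ Alg := LinearMap.ker (LinearMap.fst ℝ ℂ ℂ)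

lemma mem_translations {A : Alg} : A ∈ translations ↔ A.1 = 0 := Iff.rfl

lemma isPolarization_translations {a b : ℂ} (hb : b ≠ 0) :
    IsPolarization (functional (a, b)) translations where
  lie A _ B _ := rfl
  maximal_isotropic A := by
    rw [mem_translations]
    constructor
    · intro hA B hB
      rw [mem_translations] at hB
      simp [bracket, hA, hB]
    · intro h
      -- Against this translation the form takes the value `|b α|²`.
      have h1 := h (0, starRingEnd ℂ (b * A.1)) rfl
      simp only [functional_apply, bracket, zero_mul, sub_zero, mul_zero, zero_add] at h1
      rw [← mul_assoc, Complex.mul_conj, Complex.ofReal_re, Complex.normSq_eq_zero, mul_eq_zero] at h1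
      exact h1.resolve_left hb
  invariant g _ A hA := hA
  pukanszky F' h := by
    obtain ⟨⟨a', b'⟩, rfl⟩ : ∃ p, F' = functional p := ⟨_, (functional_dualCoord F').symm⟩
    have h2 : b' = b := by
      have e1 := h (0, 1) rfl
      have e2 := h (0, Complex.I) rfl
      simp at e1 e2
      exact Complex.ext e1 e2
    rw [coadOrbit_functional hb, h2]
    exact ⟨a', b, hb, rfl⟩

/-- The subgroup of the `(2πi m, β)`. -/
def polSubgroup : Subgroup Cover where
  carrier := {g | Complex.exp g.z = 1}
  mul_mem' {g h} hg hh := by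
    simp only [mem_ofPred_eq] at *
    rw [Cover.mul_z, Complex.exp_add, hg, hh, one_mul]
  one_mem' := by simp
  inv_mem' {g} hg := by
    simp only [mem_ofPred_eq] at *
    rw [Cover.inv_z, Complex.exp_neg, hg, inv_one]

lemma mem_polSubgroup {g : Cover} : g ∈ polSubgroup ↔ Complex.exp g.z = 1 := Iff.rfl

lemma re_eq_zero_of_exp_eq_one {z : ℂ} (hz : Complex.exp z = 1) : z.re = 0 := by
  have := congrArg norm hz
  rw [Complex.norm_exp, norm_one] at this
  exact Real.exp_eq_one_iff _ |>.1 this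

lemma polSubgroup_eq {a b : ℂ} (hb : b ≠ 0) : (polSubgroup : Set Cover) =
    {g | ∃ s ∈ coadStab (functional (a, b)), ∃ A ∈ translations, g = s * expo A} := by
  rw [coadStab_functional hb]
  ext g
  constructor
  · intro hg
    obtain ⟨m, hm⟩ := Complex.exp_eq_one_iff.1 hg
    have e : g.z = 2 * Real.pi * Complex.I * m := by rw [hm]; ring
    refine ⟨_, ⟨m, rfl⟩, (0, g.w), rfl, ?_⟩
    ext
    · simp [expo, e]
    · simp [expo, ← e, mem_polSubgroup.1 hg]
  · rintro ⟨_, ⟨m, rfl⟩, A, hA, rfl⟩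
    rw [mem_translations] at hA
    change Complex.exp _ = 1
    refine Complex.exp_eq_one_iff.2 ⟨m, ?_⟩
    simp [expo, hA]
    ring

lemma isClosed_polSubgroup : IsClosed (polSubgroup : Set Cover) :=
  isClosed_eq (Complex.continuous_exp.comp continuous_z) continuous_const

/-- The character of `polSubgroup` with differential `2π i ⟨F, ·⟩`, where `F = (a, b)`, and with the
value `e ^ {2πi m θ}` at `(2πi m, 0)`. -/
def polChar (θ : ℝ) (b : ℂ) : polSubgroup →* Circle where
  toFun h := Circle.exp (2 * Real.pi * (b * (h : Cover).w).re + θ * (h : Cover).z.im)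
  map_one' := by simp
  map_mul' g h := by
    rw [← Circle.exp_add]
    congr 1
    simp only [Subgroup.coe_mul, Cover.mul_w, Cover.mul_z, mem_polSubgroup.1 g.2, one_mul, mul_add,
      Complex.add_re, Complex.add_im]
    ring

lemma polChar_apply (θ : ℝ) (b : ℂ) (h : polSubgroup) : (polChar θ b h : ℂ) = Complex.exp
    (Complex.I * ((2 * Real.pi * (b * (h : Cover).w).re + θ * (h : Cover).z.im : ℝ) : ℂ)) := by
  rw [mul_comm]
  exact Circle.coe_exp _

lemma continuous_polChar (θ : ℝ) (b : ℂ) : Continuous (polChar θ b) := by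
  have := continuous_z.comp (continuous_subtype_val (p := fun g => g ∈ polSubgroup))
  have := continuous_w.comp (continuous_subtype_val (p := fun g => g ∈ polSubgroup))
  simp only [Function.comp_def] at *
  exact Circle.exp.continuous.comp (by fun_prop)

/-! ### The homogeneous space and its invariant measure -/

lemma rightRel_polSubgroup_iff {x y : Cover} :
    QuotientGroup.rightRel polSubgroup x y ↔ Complex.exp x.z = Complex.exp y.z := by
  rw [QuotientGroup.rightRel_apply, mem_polSubgroup, Cover.mul_z, Cover.inv_z, Complex.exp_add,
    Complex.exp_neg, mul_inv_eq_one₀ (Complex.exp_ne_zero _), eq_comm]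

/-- The point of `H \ G` over the point `x` of the cylinder, with the coordinate shifted by `c`. -/
def cosetPoint (c x : ℂ) : RightCosets polSubgroup := Quotient.mk'' ⟨x - c, 0⟩

lemma continuous_mk_cover {X : Type*} [TopologicalSpace X] {f g : X → ℂ} (hf : Continuous f)
    (hg : Continuous g) : Continuous fun x => (⟨f x, g x⟩ : Cover) :=
  continuous_induced_rng.2 (hf.prodMk hg)

lemma measurable_cosetPoint (c : ℂ) : Measurable (cosetPoint c) :=
  measurable_quotient_mk''.comp
    (continuous_mk_cover (by fun_prop : Continuous fun x : ℂ => x - c) continuous_const).measurable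

lemma measurable_cosetTranslate (g : Cover) : Measurable (cosetTranslate polSubgroup g) := by
  refine measurable_from_quotient.2 ?_
  exact measurable_quotient_mk''.comp (continuous_mul_const g).measurable

lemma cosetTranslate_cosetPoint (c : ℂ) (g : Cover) (x : ℂ) :
    cosetTranslate polSubgroup g (cosetPoint c x) = cosetPoint c (oplus x g.z) := by
  refine Quotient.sound ?_
  refine rightRel_polSubgroup_iff.2 ?_
  simp only [Cover.mul_z]
  rw [Complex.exp_sub, exp_oplus, ← Complex.exp_sub]
  congr 1
  ring

/-- The invariant measure on `H \ G`. -/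
def cosetMeasure (c : ℂ) : Measure (RightCosets polSubgroup) := cylMeasure.map (cosetPoint c)

lemma cylMeasure_ne_zero : cylMeasure ≠ 0 := by
  intro h
  obtain ⟨f, g, hfg⟩ := exists_pair_ne L2Cyl
  refine hfg (Lp.ext ?_)
  have : ae cylMeasure = ⊥ := ae_eq_bot.2 h
  change ∀ᵐ x ∂cylMeasure, f x = g x
  rw [this]
  exact eventually_bot

lemma map_cosetMeasure (c : ℂ) (g : Cover) :
    (cosetMeasure c).map (cosetTranslate polSubgroup g) = cosetMeasure c := by
  rw [cosetMeasure, Measure.map_map (measurable_cosetTranslate g) (measurable_cosetPoint c)]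
  have : cosetTranslate polSubgroup g ∘ cosetPoint c = cosetPoint c ∘ fun x => oplus x g.z :=
    funext fun x => cosetTranslate_cosetPoint c g x
  rw [this, ← Measure.map_map (measurable_cosetPoint c) (measurePreserving_oplus g.z).measurable,
    (measurePreserving_oplus g.z).map_eq]

lemma re_eq_of_exp_eq {z z' : ℂ} (h : Complex.exp z = Complex.exp z') : z.re = z'.re := by
  have := congrArg norm h
  rw [Complex.norm_exp, Complex.norm_exp] at this
  exact Real.exp_injective this

/-- `Re z` descends to a continuous function on the cosets. It is bounded on a compact set, whose
preimage in the cylinder therefore lies in a slab. -/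
instance (c : ℂ) : IsFiniteMeasureOnCompacts (cosetMeasure c) := by
  refine ⟨fun {K} hK => ?_⟩
  let ρ : RightCosets polSubgroup → ℝ := Quotient.lift (fun g : Cover => g.z.re)
    fun x y h => re_eq_of_exp_eq (rightRel_polSubgroup_iff.1 h)
  have hc : Continuous fun g : Cover => g.z.re := Complex.continuous_re.comp continuous_z
  have hρ : Continuous ρ := hc.quotient_lift _
  have hρm : Measurable ρ := measurable_from_quotient.2 hc.measurable
  obtain ⟨R, hR⟩ := hK.exists_bound_of_continuousOn hρ.continuousOn
  have hsub : K ⊆ ρ ⁻¹' (Icc (-R) R) := fun y hy => abs_le.1 (hR y hy)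
  refine lt_of_le_of_lt (measure_mono hsub) ?_
  rw [cosetMeasure, Measure.map_apply (measurable_cosetPoint c) (hρm measurableSet_Icc)]
  refine lt_of_le_of_lt (measure_mono ?_) (cylMeasure_slab_lt_top (R + |c.re|))
  intro x hx
  have h1 : |x.re - c.re| ≤ R := abs_le.2 hx
  have := abs_sub_abs_le_abs_sub x.re c.re
  simp only [slab, mem_ofPred_eq]
  linarith

/-! ### Sections of the induced representation -/

section Sections

variable {θ : ℝ} {b : ℂ}

lemma section_norm_eq (φ : sections polSubgroup (polChar θ b)) {x y : Cover}
    (h : QuotientGroup.rightRel polSubgroup x y) : ‖φ.1 x‖ = ‖φ.1 y‖ := by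
  rw [QuotientGroup.rightRel_apply] at h
  have := φ.2.2.1 ⟨_, h⟩ x
  simp only [inv_mul_cancel_right] at this
  rw [this, norm_mul, Circle.norm_coe, one_mul]

lemma section_out (φ : sections polSubgroup (polChar θ b)) (x : Cover) :
    ‖φ.1 (Quotient.out (Quotient.mk'' x : RightCosets polSubgroup))‖ = ‖φ.1 x‖ :=
  section_norm_eq φ (Quotient.exact (Quotient.out_eq (Quotient.mk'' x : RightCosets polSubgroup)))

/-- Left translation by `(0, w)` lies in the inducing subgroup, so a section is determined by its
values at the points `(z, 0)`. -/
lemma section_apply (φ : sections polSubgroup (polChar θ b)) (z w : ℂ) :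
    φ.1 ⟨z, w⟩ = Complex.exp (Complex.I * ((2 * Real.pi * (b * w).re : ℝ) : ℂ)) * φ.1 ⟨z, 0⟩ := by
  have h := φ.2.2.1 ⟨⟨0, w⟩, by simp [mem_polSubgroup]⟩ ⟨z, 0⟩
  rw [polChar_apply] at h
  have e : (⟨0, w⟩ * ⟨z, 0⟩ : Cover) = ⟨z, w⟩ := by ext <;> simp
  simp only [e] at h
  simpa using h

lemma section_quasi (φ : sections polSubgroup (polChar θ b)) (z : ℂ) :
    φ.1 ⟨z + 2 * Real.pi * Complex.I, 0⟩ =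
      Complex.exp (2 * Real.pi * Complex.I * θ) * φ.1 ⟨z, 0⟩ := by
  have h := φ.2.2.1 ⟨⟨2 * Real.pi * Complex.I, 0⟩, by simp [mem_polSubgroup]⟩ ⟨z, 0⟩
  rw [polChar_apply] at h
  have e : (⟨2 * Real.pi * Complex.I, 0⟩ * ⟨z, 0⟩ : Cover) = ⟨z + 2 * Real.pi * Complex.I, 0⟩ := by
    ext <;> simp [add_comm]
  simp only [e] at h
  rw [h]
  congr 2
  simp
  ring

lemma section_bound (φ : sections polSubgroup (polChar θ b)) :
    ∃ R M, (∀ x, ‖φ.1 x‖ ≤ M) ∧ ∀ x : Cover, x.z ∉ slab R → φ.1 x = 0 := by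
  obtain ⟨hc, he, K, hK, hs⟩ := φ.2
  obtain ⟨M, hM⟩ := hK.exists_bound_of_continuousOn hc.continuousOn
  obtain ⟨R, hR⟩ := hK.exists_bound_of_continuousOn
    (f := fun x : Cover => x.z.re) (Complex.continuous_re.comp continuous_z).continuousOn
  refine ⟨R, max M 0, fun x => ?_, fun x hx => ?_⟩
  · by_cases h0 : φ.1 x = 0
    · rw [h0, norm_zero]
      exact le_max_right _ _
    · obtain ⟨h, hh⟩ := hs x h0
      have := hM _ hh
      rw [he, norm_mul, Circle.norm_coe, one_mul] at this
      exact this.trans (le_max_left _ _)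
  · by_contra h0
    obtain ⟨h, hh⟩ := hs x h0
    have := hR _ hh
    simp only [Cover.mul_z, Complex.add_re, re_eq_zero_of_exp_eq_one (mem_polSubgroup.1 h.2),
      zero_add] at this
    exact hx this

lemma section_continuous (φ : sections polSubgroup (polChar θ b)) (c : ℂ) :
    Continuous fun x : ℂ => φ.1 ⟨x - c, 0⟩ :=
  φ.2.1.comp (continuous_mk_cover (by fun_prop) continuous_const)

lemma memLp_section (φ : sections polSubgroup (polChar θ b)) (c : ℂ) :
    MemLp (fun x : ℂ => φ.1 ⟨x - c, 0⟩) 2 cylMeasure := by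
  obtain ⟨R, M, hM, hR⟩ := section_bound φ
  refine memLp_of_slab (section_continuous φ c).aestronglyMeasurable (R + |c.re|) M
    (Eventually.of_forall fun x => hM _) fun x hx => hR _ fun h1 => hx ?_
  simp only [slab, mem_ofPred_eq, Complex.sub_re] at h1 ⊢
  have := abs_sub_abs_le_abs_sub x.re c.re
  linarith

/-- The restriction of sections to the cylinder. -/
def sectionEmbed (θ : ℝ) (b c : ℂ) : sections polSubgroup (polChar θ b) →ₗ[ℂ] L2Cyl where
  toFun φ := (memLp_section φ c).toLp _
  map_add' φ ψ := MemLp.toLp_add (memLp_section φ c) (memLp_section ψ c)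
  map_smul' r φ := MemLp.toLp_const_smul r (memLp_section φ c)

lemma sectionEmbed_coe (c : ℂ) (φ : sections polSubgroup (polChar θ b)) :
    sectionEmbed θ b c φ =ᵐ[cylMeasure] fun x => φ.1 ⟨x - c, 0⟩ :=
  MemLp.coeFn_toLp (memLp_section φ c)

/-- Right translation by `(z, w)` moves `(x - c, 0)` to `(x + z - c, e^{x-c} w)`. The character
contributes the phase `2π Re(b e^{x-c} w)`, and `e^c = 2πb` is exactly what turns this into `Re(w
e^x)`. -/
lemma TRep_sectionEmbed {c : ℂ} (hc : Complex.exp c = 2 * Real.pi * b) (g : Cover)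
    (φ : sections polSubgroup (polChar θ b)) :
    TRep θ g (sectionEmbed θ b c φ) =
      sectionEmbed θ b c (sectionTranslate polSubgroup (polChar θ b) g φ) := by
  refine Lp.ext ((TRep_coe θ g _).trans ?_)
  refine (TFun_congr θ g (sectionEmbed_coe c φ)).trans
    (EventuallyEq.trans (Eventually.of_forall fun x => ?_) (sectionEmbed_coe c _).symm)
  rw [TFun_quasi]
  · change _ = φ.1 (⟨x - c, 0⟩ * g)
    have e : (⟨x - c, 0⟩ * g : Cover) = ⟨x + g.z - c, Complex.exp (x - c) * g.w⟩ := by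
      ext
      · simp
        ring
      · simp
    rw [e, section_apply φ (x + g.z - c) (Complex.exp (x - c) * g.w)]
    congr 3
    rw [Complex.exp_sub, hc]
    have hp : (2 * Real.pi : ℂ) ≠ 0 := by
      have := Real.pi_ne_zero
      simp [this]
    have hb : b ≠ 0 := by
      rintro rfl
      rw [mul_zero] at hc
      exact Complex.exp_ne_zero _ hc
    have e2 : b * (Complex.exp x / (2 * Real.pi * b) * g.w) =
        ((2 * Real.pi : ℝ) : ℂ)⁻¹ * (g.w * Complex.exp x) := by
      push_cast
      field_simp
    rw [e2, ← Complex.ofReal_inv, Complex.re_ofReal_mul]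
    have := Real.pi_ne_zero
    field_simp
  · intro u
    have e : u + 2 * Real.pi * Complex.I - c = (u - c) + 2 * Real.pi * Complex.I := by ring
    simp only [e]
    exact section_quasi φ _

lemma exists_section (θ : ℝ) (b c : ℂ) :
    ∃ φ : sections polSubgroup (polChar θ b), φ.1 ⟨Complex.I - c, 0⟩ ≠ 0 := by
  let β : ContDiffBump (-c.re) := ⟨1, 2, one_pos, one_lt_two⟩
  have hz := continuous_z
  have hw := continuous_w
  have hβ := β.continuous
  -- The formula of the character, extended to the whole group, times a bump in `Re z`, which is
  -- invariant under the subgroup. One period of the support, at `w = 0`, is the compact set.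
  refine ⟨⟨fun x => Complex.exp (Complex.I * ((2 * Real.pi * (b * x.w).re + θ * x.z.im : ℝ) : ℂ)) *
    (β x.z.re : ℝ), by fun_prop, fun h x => ?_,
    (fun z => (⟨z, 0⟩ : Cover)) '' (Icc (-c.re - 2) (-c.re + 2) ×ℂ Icc 0 (2 * Real.pi)),
    (isCompact_Icc.reProdIm isCompact_Icc).image (continuous_mk_cover continuous_id continuous_const),
    fun x hx => ?_⟩, ?_⟩
  · have e1 : 2 * Real.pi * (b * ((h : Cover) * x).w).re + θ * ((h : Cover) * x).z.im =
        (2 * Real.pi * (b * (h : Cover).w).re + θ * (h : Cover).z.im) +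
          (2 * Real.pi * (b * x.w).re + θ * x.z.im) := by
      simp only [Cover.mul_w, Cover.mul_z, mem_polSubgroup.1 h.2, one_mul, mul_add,
        Complex.add_re, Complex.add_im]
      ring
    have e2 : ((h : Cover) * x).z.re = x.z.re := by
      simp [re_eq_zero_of_exp_eq_one (mem_polSubgroup.1 h.2)]
    beta_reduce
    rw [e1, e2, polChar_apply, ← mul_assoc, ← Complex.exp_add, ← mul_add, ← Complex.ofReal_add]
  · have h1 : β x.z.re ≠ 0 := fun h => hx (by simp [h])
    have h2 : dist x.z.re (-c.re) < 2 := by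
      by_contra h3
      exact h1 (β.zero_of_le_dist (not_lt.1 h3))
    rw [Real.dist_eq, abs_lt] at h2
    -- The subgroup element that brings `x` back to the basic strip and to `w = 0`.
    refine ⟨⟨⟨-(2 * Real.pi * Complex.I * (sheet x.z : ℂ)), -x.w⟩, ?_⟩, oplus x.z 0, ?_, ?_⟩
    · exact Complex.exp_eq_one_iff.2 ⟨-sheet x.z, by push_cast; ring⟩
    · have h3 := oplus_mem x.z 0
      refine ⟨?_, h3.1, by simpa using h3.2.le⟩
      simp only [mem_preimage, oplus_re, add_zero]
      exact ⟨by linarith, by linarith⟩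
    · have h4 : Complex.exp (-(2 * Real.pi * Complex.I * (sheet x.z : ℂ))) = 1 :=
        Complex.exp_eq_one_iff.2 ⟨-sheet x.z, by push_cast; ring⟩
      ext
      · simp [oplus_eq]
        ring
      · simp [h4]
  · have : β (-c.re) = 1 := β.one_of_mem_closedBall (by simp [β])
    simp [this]

lemma isInduced_TRep (θ : ℝ) {b : ℂ} (hb : b ≠ 0) :
    IsInduced polSubgroup (polChar θ b) (TRep θ) := by
  have h2 : (2 * Real.pi * b : ℂ) ≠ 0 := by
    have := Real.pi_ne_zero
    simp [this, hb]
  set c := Complex.log (2 * Real.pi * b) with hcdef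
  have hc : Complex.exp c = 2 * Real.pi * b := Complex.exp_log h2
  refine ⟨cosetMeasure c, ?_, inferInstance, map_cosetMeasure c, sectionEmbed θ b c, ?_, fun φ => ?_,
    fun g φ => TRep_sectionEmbed hc g φ⟩
  · rw [cosetMeasure, Ne, Measure.map_eq_zero_iff (measurable_cosetPoint c).aemeasurable]
    exact cylMeasure_ne_zero
  · obtain ⟨φ, hφ⟩ := exists_section θ b c
    -- The image of the sections is invariant and nonzero, hence dense by irreducibility.
    have := (isIrred_TRep θ).dense_of_invariant (LinearMap.range (sectionEmbed θ b c))
      (by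
        rintro g _ ⟨ψ, rfl⟩
        exact ⟨_, (TRep_sectionEmbed hc g ψ).symm⟩)
      (LinearMap.mem_range_self _ φ)
      (ne_zero_of_continuous (sectionEmbed_coe c φ) (section_continuous φ c) hφ)
    exact this
  · have hm : Measurable fun y : RightCosets polSubgroup => ‖φ.1 y.out‖ ^ 2 := by
      refine measurable_from_quotient.2 ?_
      have : (fun y : RightCosets polSubgroup => ‖φ.1 y.out‖ ^ 2) ∘ Quotient.mk'' =
          fun x => ‖φ.1 x‖ ^ 2 := funext fun x => by
        simp only [Function.comp_apply, section_out]
      rw [this]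
      exact (φ.2.1.norm.pow 2).measurable
    have e : ∀ x, ‖φ.1 (cosetPoint c x).out‖ ^ 2 = ‖φ.1 ⟨x - c, 0⟩‖ ^ 2 := fun x => by
      rw [cosetPoint, section_out]
    constructor
    · rw [cosetMeasure, integrable_map_measure hm.aestronglyMeasurable
        (measurable_cosetPoint c).aemeasurable]
      simp only [Function.comp_def, e]
      exact (memLp_two_iff_integrable_sq_norm
        (section_continuous φ c).aestronglyMeasurable).1 (memLp_section φ c)
    · rw [cosetMeasure, integral_map (measurable_cosetPoint c).aemeasurable hm.aestronglyMeasurable,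
        norm_sq_eq_integral]
      refine integral_congr_ae ?_
      filter_upwards [sectionEmbed_coe c φ] with x hx
      simp only [hx, e]

end Sections

lemma isOrbitMethodRep_TRep (θ : ℝ) {F : DualAlg} (hF : F ∈ Omega) :
    IsOrbitMethodRep F θ (TRep θ) := by
  rw [Omega_eq] at hF
  obtain ⟨a, b, hb, rfl⟩ := hF
  refine ⟨coadStab_functional hb, translations, polSubgroup, polChar θ b,
    isPolarization_translations hb, polSubgroup_eq hb, isClosed_polSubgroup, continuous_polChar θ b,
    fun h A hA e => ?_, fun h m e => ?_, isInduced_TRep θ hb⟩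
  · rw [mem_translations] at hA
    simp only [polChar, MonoidHom.coe_mk, OneHom.coe_mk, e]
    simp [expo, hA]
  · simp only [polChar, MonoidHom.coe_mk, OneHom.coe_mk, e]
    congr 1
    simp
    ring

/-! ### Cores of generators of unitary groups -/

section Core

variable {E : Type*} [NormedAddCommGroup E] [InnerProductSpace ℂ E]
  {U : ℝ → (E ≃ₗᵢ[ℂ] E)}

lemma unitaryGroup_zero (hU : ∀ s t, U (s + t) = U s * U t) : U 0 = 1 := by
  have h := hU 0 0
  rw [add_zero] at h
  exact (mul_eq_left.1 h.symm)

/-- The group law reduces the derivative at `s` to that at `0`: `U(t) x = U(s) U(t - s) x`. -/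
lemma unitaryGroup_hasDerivAt (hU : ∀ s t, U (s + t) = U s * U t) {x y : E}
    (h : HasDerivAt (fun t => U t x) y 0) (s : ℝ) : HasDerivAt (fun t => U t x) (U s y) s := by
  have h1 : HasDerivAt (fun t => U s (U t x)) (U s y) 0 :=
    ((U s).toContinuousLinearEquiv.toContinuousLinearMap.restrictScalars ℝ).hasFDerivAt.comp_hasDerivAt
      0 h
  have h2 : HasDerivAt (fun t => U s (U (t - s) x)) (U s y) s := by
    have h1' : HasDerivAt (fun t => U s (U t x)) (U s y) (s - s) := by rwa [sub_self]
    exact h1'.comp_sub_const s s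
  refine h2.congr_of_eventuallyEq (Eventually.of_forall fun t => ?_)
  have : U t = U s * U (t - s) := by rw [← hU, add_sub_cancel]
  simp only [this]
  rfl

/-- The operator `∫₀ᵗ U(s) ds`. -/
def unitaryIntegral (hc : ∀ f, Continuous fun t => U t f) (t : ℝ) : E →L[ℝ] E :=
  LinearMap.mkContinuous
    { toFun := fun x => ∫ s in (0 : ℝ)..t, U s x
      map_add' := fun x y => by
        simp_rw [map_add]
        exact intervalIntegral.integral_add ((hc x).intervalIntegrable _ _)
          ((hc y).intervalIntegrable _ _)
      map_smul' := fun c x => by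
        have : ∀ s, U s (c • x) = c • U s x := fun s => (U s).toLinearEquiv.toLinearMap.map_smul_of_tower c x
        simp_rw [this]
        exact intervalIntegral.integral_smul c _ } |t| fun x => by
    have := intervalIntegral.norm_integral_le_of_norm_le_const (a := 0) (b := t)
      (f := fun s => U s x) (C := ‖x‖) fun s _ => ((U s).norm_map x).le
    simpa [mul_comm] using this

lemma unitaryIntegral_apply (hc : ∀ f, Continuous fun t => U t f) (t : ℝ) (x : E) :
    unitaryIntegral hc t x = ∫ s in (0 : ℝ)..t, U s x := rfl

lemma unitaryIntegral_generator [CompleteSpace E] (hU : ∀ s t, U (s + t) = U s * U t)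
    (hc : ∀ f, Continuous fun t => U t f) {x y : E} (h : HasDerivAt (fun t => U t x) y 0) (t : ℝ) :
    unitaryIntegral hc t y = U t x - x := by
  rw [unitaryIntegral_apply, intervalIntegral.integral_eq_sub_of_hasDerivAt
    (fun s _ => unitaryGroup_hasDerivAt hU h s) ((hc y).intervalIntegrable _ _),
    unitaryGroup_zero hU]
  rfl

lemma hasDerivAt_unitaryIntegral [CompleteSpace E] (hU : ∀ s t, U (s + t) = U s * U t)
    (hc : ∀ f, Continuous fun t => U t f) (x : E) :
    HasDerivAt (fun t => unitaryIntegral hc t x) x 0 := by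
  have h := intervalIntegral.integral_hasDerivAt_right (a := (0 : ℝ)) (b := 0)
    ((hc x).intervalIntegrable _ _) ((hc x).stronglyMeasurableAtFilter _ _) (hc x).continuousAt
  rw [unitaryGroup_zero hU] at h
  exact h

/-- The graph is cut out by the equations `∫₀ᵗ U(s) y ds = U(t) x - x` for all `t`, each of which is
a closed condition on `(x, y)`. -/
lemma isClosed_generator [CompleteSpace E] (hU : ∀ s t, U (s + t) = U s * U t)
    (hc : ∀ f, Continuous fun t => U t f) :
    IsClosed {p : E × E | HasDerivAt (fun t => U t p.1) p.2 0} := by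
  have e : {p : E × E | HasDerivAt (fun t => U t p.1) p.2 0} =
      ⋂ t, {p : E × E | unitaryIntegral hc t p.2 = U t p.1 - p.1} := by
    ext p
    simp only [mem_ofPred_eq, mem_iInter]
    constructor
    · intro h t
      exact unitaryIntegral_generator hU hc h t
    · intro h
      have h1 := (hasDerivAt_unitaryIntegral hU hc p.2).add_const p.1
      refine h1.congr_of_eventuallyEq (Eventually.of_forall fun t => ?_)
      simp only [h t, sub_add_cancel]
  rw [e]
  exact isClosed_iInter fun t => isClosed_eq ((unitaryIntegral hc t).continuous.comp continuous_snd)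
    (((U t).continuous.comp continuous_fst).sub continuous_fst)

lemma intervalIntegral_mem_submodule {E : Type*} [NormedAddCommGroup E] [NormedSpace ℝ E]
    [CompleteSpace E] {W : Submodule ℝ E} (hW : IsClosed (W : Set E)) {f : ℝ → E}
    (hf : Continuous f) (hm : ∀ s, f s ∈ W) (t : ℝ) : ∫ s in (0 : ℝ)..t, f s ∈ W := by
  have : CompleteSpace W := hW.completeSpace_coe
  let g : ℝ → W := fun s => ⟨f s, hm s⟩
  have hg : Continuous g := hf.subtype_mk _
  have h := W.subtypeL.intervalIntegral_comp_comm (hg.intervalIntegrable (μ := volume) 0 t)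
  have h2 : ∫ s in (0 : ℝ)..t, f s = W.subtypeL (∫ s in (0 : ℝ)..t, g s) := h
  rw [h2]
  exact (∫ s in (0 : ℝ)..t, g s).2

/-- A dense subspace of the domain of the generator that is invariant under the unitary group is a
core of the generator. -/
theorem closure_eq_generator [CompleteSpace E] (hU : ∀ s t, U (s + t) = U s * U t)
    (hc : ∀ f, Continuous fun t => U t f) (L : Submodule ℝ (E × E))
    (hder : ∀ p ∈ L, HasDerivAt (fun t => U t p.1) p.2 0)
    (hinv : ∀ p ∈ L, ∀ t, ∃ y, (U t p.1, y) ∈ L) (hd : Dense {x | ∃ y, (x, y) ∈ L}) :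
    closure (L : Set (E × E)) = {p | HasDerivAt (fun t => U t p.1) p.2 0} := by
  refine Subset.antisymm (closure_minimal hder (isClosed_generator hU hc)) ?_
  have hcl : IsClosed (L.topologicalClosure : Set (E × E)) := L.isClosed_topologicalClosure
  -- By uniqueness of derivatives the partner of `U(t) x` in `L` can only be `U(t) y`.
  have hpair : ∀ p ∈ L, ∀ t, (U t p.1, U t p.2) ∈ L := by
    intro p hp t
    obtain ⟨y, hy⟩ := hinv p hp t
    have h1 := hder _ hy
    have h2 := unitaryGroup_hasDerivAt hU (hder p hp) t
    have h3 : HasDerivAt (fun s => U s (U t p.1)) (U t p.2) 0 := by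
      have h4 : HasDerivAt (fun s => U s p.1) (U t p.2) (0 + t) := by rwa [zero_add]
      refine (h4.comp_add_const 0 t).congr_of_eventuallyEq (Eventually.of_forall fun s => ?_)
      simp only [hU]
      rfl
    have e : y = U t p.2 := h1.unique h3
    rwa [e] at hy
  -- For `x` in the dense domain this pair is an integral of elements of `L`. Both components are
  -- continuous in `x` on the whole space, so the closure of `L` contains the pair for every `x`.
  have h1 : ∀ t x, (unitaryIntegral hc t x, U t x - x) ∈ L.topologicalClosure := by
    intro t
    have hclosed : IsClosed {x | (unitaryIntegral hc t x, U t x - x) ∈ L.topologicalClosure} :=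
      hcl.preimage ((unitaryIntegral hc t).continuous.prodMk ((U t).continuous.sub continuous_id))
    intro x
    refine hclosed.closure_subset_iff.2 ?_ (hd x)
    rintro x ⟨y, hxy⟩
    have h2 := intervalIntegral_mem_submodule hcl (f := fun s => (U s x, U s y))
      ((hc x).prodMk (hc y)) (fun s => L.le_topologicalClosure (hpair _ hxy s)) t
    have hi : IntervalIntegrable (fun s => (U s x, U s y)) volume 0 t :=
      ((hc x).prodMk (hc y)).intervalIntegrable _ _
    have e1 := (ContinuousLinearMap.fst ℝ E E).intervalIntegral_comp_comm hi
    have e2 := (ContinuousLinearMap.snd ℝ E E).intervalIntegral_comp_comm hi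
    have e : (unitaryIntegral hc t x, U t x - x) = ∫ s in (0 : ℝ)..t, (U s x, U s y) := by
      refine Prod.ext e1 ?_
      simp only
      rw [← unitaryIntegral_generator hU hc (hder _ hxy) t]
      exact e2
    change (unitaryIntegral hc t x, U t x - x) ∈ L.topologicalClosure
    rw [e]
    exact h2
  rintro ⟨x, y⟩ hxy
  -- Dividing these pairs by `t` and letting `t → 0` gives the limit `(x, y)`.
  have l1 := hasDerivAt_iff_tendsto_slope_zero.1 (hasDerivAt_unitaryIntegral hU hc x)
  have l2 := hasDerivAt_iff_tendsto_slope_zero.1 hxy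
  refine hcl.mem_of_tendsto (l1.prodMk_nhds l2) (Eventually.of_forall fun t => ?_)
  have h0 : unitaryIntegral hc 0 x = 0 := by simp [unitaryIntegral_apply]
  have h00 : U 0 x = x := by rw [unitaryGroup_zero hU]; rfl
  have := L.topologicalClosure.smul_mem t⁻¹ (h1 t x)
  change _ ∈ L.topologicalClosure
  simpa [h0, h00] using this

end Core

/-! ### The infinitesimal action on quasi-periodic functions -/

lemma hasDerivAt_expo_w (A : Alg) (t : ℝ) :
    HasDerivAt (fun t : ℝ => (expo (t • A)).w) (A.2 * Complex.exp (t * A.1)) t := by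
  obtain ⟨α, β⟩ := A
  have h0 : HasDerivAt (fun t : ℝ => (t : ℂ)) 1 t := Complex.ofRealCLM.hasDerivAt
  by_cases hα : α = 0
  · subst hα
    simpa [expo] using h0.mul_const β
  · have h1 := ((((h0.mul_const α).cexp).sub_const 1).div_const α).const_mul β
    have h2 : HasDerivAt (fun t : ℝ => β * ((Complex.exp ((t : ℂ) * α) - 1) / α))
        (β * Complex.exp (t * α)) t := by
      refine h1.congr_deriv ?_
      field_simp
    refine h2.congr_of_eventuallyEq (Eventually.of_forall fun s => ?_)
    by_cases hs : s = 0
    · subst hs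
      simp [expo]
    · have hs' : (s : ℂ) ≠ 0 := by exact_mod_cast hs
      simp [expo, hα, hs]
      field_simp

lemma expo_z (A : Alg) (t : ℝ) : (expo (t • A)).z = t * A.1 := by simp [expo]

lemma continuous_expo (A : Alg) : Continuous fun t : ℝ => expo (t • A) := by
  refine continuous_induced_rng.2 ?_
  refine Continuous.prodMk ?_ ?_
  · simp_rw [expo_z]
    fun_prop
  · exact continuous_iff_continuousAt.2 fun t => (hasDerivAt_expo_w A t).continuousAt

/-- The velocity `β e^{tα}` of the second entry of `exp(tA)`, multiplied by `e^x`, is `β e^{x +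
tα}`: the potential at the shifted point. The formula at all `t`, not only at `0`, is needed for the
mean value bound. -/
lemma hasDerivAt_TFun {θ : ℝ} {h : ℂ → ℂ} (hh : IsQuasi θ h) (A : Alg) (x : ℂ) (t : ℝ) :
    HasDerivAt (fun t : ℝ => TFun θ (expo (t • A)) h x) (TFun θ (expo (t • A)) (cylOp A h) x) t := by
  simp_rw [TFun_quasi hh.quasi, TFun_quasi (hh.cylOp A).quasi, cylOp_eq, expo_z]
  have h0 : HasDerivAt (fun t : ℝ => (t : ℂ)) 1 t := Complex.ofRealCLM.hasDerivAt
  have h1 : HasDerivAt (fun t : ℝ => x + (t : ℂ) * A.1) A.1 t := by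
    simpa using (h0.mul_const A.1).const_add x
  have h2 := ((hh.smooth.differentiable (by simp)) (x + t * A.1)).hasFDerivAt.comp_hasDerivAt t h1
  have h3 := (Complex.ofRealCLM.comp Complex.reCLM).hasFDerivAt.comp_hasDerivAt t
    ((hasDerivAt_expo_w A t).mul_const (Complex.exp x))
  have h4 := ((h3.const_mul Complex.I).cexp).mul h2
  refine h4.congr_deriv ?_
  have e : A.2 * Complex.exp (x + t * A.1) = A.2 * Complex.exp (t * A.1) * Complex.exp x := by
    rw [Complex.exp_add]; ring
  rw [e]
  simp only [Function.comp_apply, ContinuousLinearMap.comp_apply, Complex.reCLM_apply,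
    Complex.ofRealCLM_apply]
  ring

lemma hasDerivAt_TRep_quasi {θ : ℝ} {h : ℂ → ℂ} (hh : IsQuasi θ h) (A : Alg) {f f' : L2Cyl}
    (hf : f =ᵐ[cylMeasure] h) (hf' : f' =ᵐ[cylMeasure] cylOp A h) :
    HasDerivAt (fun t : ℝ => TRep θ (expo (t • A)) f) f' 0 := by
  rw [hasDerivAt_iff_tendsto_slope_zero]
  obtain ⟨R, hR⟩ := hh.support
  obtain ⟨R', hR'⟩ := (hh.cylOp A).support
  obtain ⟨M, hM⟩ := (hh.cylOp A).exists_bound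
  have h00 : expo ((0 : ℝ) • A) = 1 := by ext <;> simp [expo]
  have hTM : ∀ (t : ℝ) x, ‖TFun θ (expo (t • A)) (cylOp A h) x‖ ≤ M := fun t x => by
    rw [norm_TFun]
    exact hM _
  have hT0 : ∀ x, TFun θ (expo ((0 : ℝ) • A)) h x = h x := fun x => by
    rw [TFun_quasi hh.quasi, h00]; simp
  have hT0' : ∀ x, TFun θ (expo ((0 : ℝ) • A)) (cylOp A h) x = cylOp A h x := fun x => by
    rw [TFun_quasi (hh.cylOp A).quasi, h00]; simp
  refine tendsto_L2_of_dominated (g := cylOp A h)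
    (G := fun (t : ℝ) x => (t : ℂ)⁻¹ * (TFun θ (expo (t • A)) h x - h x))
    -- For `|t| < 1` the shift moves the support by at most `|Re α|`. The mean value inequality
    -- bounds the difference quotient by `M`, and the limit is bounded by `M` as well.
    (fun t => ?_) hf' (max (R + |A.1.re|) R') (2 * M) ?_ fun x => ?_
  · have e1 := (TRep_coe θ (expo (t • A)) f).trans (TFun_congr θ (expo (t • A)) hf)
    simp only [zero_add, h00, map_one]
    change ((t⁻¹ : ℝ) • (TRep θ (expo (t • A)) f - f) : L2Cyl) =ᵐ[cylMeasure] _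
    filter_upwards [Lp.coeFn_smul (t⁻¹ : ℝ) (TRep θ (expo (t • A)) f - f),
      Lp.coeFn_sub (TRep θ (expo (t • A)) f) f, e1, hf] with x a1 a2 a3 a4
    rw [a1, Pi.smul_apply, a2, Pi.sub_apply, a3, a4, Complex.real_smul, Complex.ofReal_inv]
  · have hsmall : ∀ᶠ t : ℝ in 𝓝[≠] 0, |t| < 1 := by
      refine nhdsWithin_le_nhds ?_
      exact (continuous_abs.continuousAt (x := (0 : ℝ))).eventually_lt continuousAt_const (by simp)
    filter_upwards [hsmall, self_mem_nhdsWithin] with t ht ht0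
    refine Eventually.of_forall fun x => ?_
    have ht0' : t ≠ 0 := ht0
    by_cases hx : x ∈ slab (max (R + |A.1.re|) R')
    · rw [indicator_of_mem hx]
      have hmv := convex_univ.norm_image_sub_le_of_norm_hasDerivWithin_le (𝕜 := ℝ) (s := univ)
        (f := fun t : ℝ => TFun θ (expo (t • A)) h x) (x := 0) (y := t) (C := M)
        (fun s _ => (hasDerivAt_TFun hh A x s).hasDerivWithinAt) (fun s _ => hTM s x)
        (mem_univ _) (mem_univ _)
      rw [hT0, sub_zero] at hmv
      refine (norm_sub_le _ _).trans ?_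
      rw [norm_mul, norm_inv, Complex.norm_real]
      have h5 : ‖t‖⁻¹ * ‖TFun θ (expo (t • A)) h x - h x‖ ≤ M := by
        rw [inv_mul_le_iff₀ (norm_pos_iff.2 ht0'), mul_comm]
        exact hmv
      linarith [hM x]
    · rw [indicator_of_notMem hx]
      simp only [slab, mem_ofPred_eq, not_le, max_lt_iff] at hx
      have z1 : h x = 0 := hR x fun h1 => by
        simp only [slab, mem_ofPred_eq] at h1
        linarith [abs_nonneg A.1.re]
      have z2 : cylOp A h x = 0 := hR' x fun h1 => by
        simp only [slab, mem_ofPred_eq] at h1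
        linarith
      have z3 : TFun θ (expo (t • A)) h x = 0 := by
        rw [TFun_quasi hh.quasi, hR, mul_zero]
        intro h1
        rw [expo_z] at h1
        simp only [slab, mem_ofPred_eq, Complex.add_re, Complex.re_ofReal_mul] at h1
        have h2 := abs_sub (x.re + t * A.1.re) (t * A.1.re)
        simp only [add_sub_cancel_right] at h2
        have h3 : |t * A.1.re| ≤ |A.1.re| := by
          rw [abs_mul]
          exact mul_le_of_le_one_left (abs_nonneg _) ht.le
        linarith
      simp [z1, z2, z3]
  · have h1 := hasDerivAt_iff_tendsto_slope_zero.1 (hasDerivAt_TFun hh A x 0)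
    rw [hT0', hT0] at h1
    simpa using h1

/-! ### Twisted periodization -/

/-- The sum `∑_m e ^ {-2πi m θ} H(u + 2πi m)`. -/
def twistSum (θ : ℝ) (H : ℂ → ℂ) (u : ℂ) : ℂ :=
  ∑' m : ℤ, Complex.exp (-(2 * Real.pi * Complex.I * m * θ)) * H (u + 2 * Real.pi * Complex.I * m)

lemma im_add_two_pi_I_mul (u : ℂ) (m : ℤ) :
    (u + 2 * Real.pi * Complex.I * m).im = u.im + 2 * Real.pi * m := by simp

lemma re_add_two_pi_I_mul (u : ℂ) (m : ℤ) : (u + 2 * Real.pi * Complex.I * m).re = u.re := by simp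

/-- The periodization is locally a finite sum with a fixed index set, so it can be differentiated
termwise. -/
lemma exists_finset_translates {H : ℂ → ℂ} (hH : HasCompactSupport H) (u₀ : ℂ) :
    ∃ s : Finset ℤ, ∀ᶠ u in 𝓝 u₀, ∀ m ∉ s, H (u + 2 * Real.pi * Complex.I * m) = 0 := by
  obtain ⟨R, hR⟩ := hH.isCompact.isBounded.subset_closedBall 0
  obtain ⟨N, hN⟩ := exists_nat_ge (R + |u₀.im| + 1)
  refine ⟨Finset.Icc (-N) N, ?_⟩
  have h1 : ∀ᶠ u : ℂ in 𝓝 u₀, |u.im| < |u₀.im| + 1 :=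
    (Complex.continuous_im.abs.continuousAt).eventually_lt continuousAt_const (by simp)
  filter_upwards [h1] with u hu m hm
  by_contra h
  refine hm ?_
  have h2 : ‖u + 2 * Real.pi * Complex.I * m‖ ≤ R := by
    simpa using hR (subset_tsupport _ (Function.mem_support.2 h))
  have h3 := (Complex.abs_im_le_norm _).trans h2
  rw [im_add_two_pi_I_mul] at h3
  have h4 : |2 * Real.pi * (m : ℝ)| ≤ R + |u.im| := by
    have := abs_sub (u.im + 2 * Real.pi * (m : ℝ)) u.im
    rw [add_sub_cancel_left] at this
    linarith
  rw [abs_mul, abs_of_pos Real.two_pi_pos] at h4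
  have h5 : |(m : ℝ)| ≤ 2 * Real.pi * |(m : ℝ)| := by
    nlinarith [Real.pi_gt_three, abs_nonneg (m : ℝ)]
  have h6 : |(m : ℝ)| ≤ N := by linarith
  rw [abs_le] at h6
  rw [Finset.mem_Icc]
  exact ⟨by exact_mod_cast h6.1, by exact_mod_cast h6.2⟩

lemma twistSum_eventuallyEq (θ : ℝ) {H : ℂ → ℂ} {u₀ : ℂ} {s : Finset ℤ}
    (hs : ∀ᶠ u in 𝓝 u₀, ∀ m ∉ s, H (u + 2 * Real.pi * Complex.I * m) = 0) :
    twistSum θ H =ᶠ[𝓝 u₀] fun u => ∑ m ∈ s, Complex.exp (-(2 * Real.pi * Complex.I * m * θ)) *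
      H (u + 2 * Real.pi * Complex.I * m) := by
  filter_upwards [hs] with u hu
  exact tsum_eq_sum fun m hm => by rw [hu m hm, mul_zero]

lemma isQuasi_twistSum (θ : ℝ) {H : ℂ → ℂ} (hs : ContDiff ℝ ∞ H) (hH : HasCompactSupport H) :
    IsQuasi θ (twistSum θ H) where
  smooth := by
    rw [contDiff_iff_contDiffAt]
    intro u₀
    obtain ⟨s, h⟩ := exists_finset_translates hH u₀
    refine ContDiffAt.congr_of_eventuallyEq ?_ (twistSum_eventuallyEq θ h)
    exact (ContDiff.sum fun m _ => contDiff_const.mul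
      (hs.comp (contDiff_id.add contDiff_const))).contDiffAt
  quasi u := by
    simp only [twistSum]
    -- Shifting `u` by `2πi` amounts to reindexing by `m ↦ m + 1`, which costs the factor
    -- `e^{2πiθ}`.
    rw [← tsum_mul_left, ← (Equiv.addRight (1 : ℤ)).tsum_eq (fun m : ℤ =>
      Complex.exp (2 * Real.pi * Complex.I * θ) * (Complex.exp (-(2 * Real.pi * Complex.I * m * θ)) *
        H (u + 2 * Real.pi * Complex.I * m)))]
    refine tsum_congr fun m => ?_
    rw [Equiv.coe_addRight, ← mul_assoc, ← Complex.exp_add]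
    push_cast
    congr 2 <;> ring
  support := by
    obtain ⟨R, hR⟩ := hH.isCompact.isBounded.subset_closedBall 0
    refine ⟨R, fun u hu => ?_⟩
    refine (tsum_congr fun m => ?_).trans tsum_zero
    rw [mul_eq_zero]
    right
    by_contra h
    refine hu ?_
    have h2 : ‖u + 2 * Real.pi * Complex.I * m‖ ≤ R := by
      simpa using hR (subset_tsupport _ (Function.mem_support.2 h))
    have h3 := (Complex.abs_re_le_norm _).trans h2
    rwa [re_add_two_pi_I_mul] at h3

lemma exp_add_two_pi_I_mul (u : ℂ) (m : ℤ) :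
    Complex.exp (u + 2 * Real.pi * Complex.I * m) = Complex.exp u := by
  rw [mul_comm (2 * Real.pi * Complex.I) (m : ℂ)]
  exact Complex.exp_periodic.int_mul m u

lemma cylOp_translate (A : Alg) (H : ℂ → ℂ) (u : ℂ) (m : ℤ) :
    cylOp A H (u + 2 * Real.pi * Complex.I * m) =
      cylOp A (fun u => H (u + 2 * Real.pi * Complex.I * m)) u := by
  rw [cylOp_eq, cylOp_eq, exp_add_two_pi_I_mul]
  congr 2
  exact (fderiv_comp_add_right _).symm

lemma cylOp_congr (A : Alg) {h h' : ℂ → ℂ} {u : ℂ} (e : h =ᶠ[𝓝 u] h') :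
    cylOp A h u = cylOp A h' u := by
  rw [cylOp, cylOp, e.fderiv_eq, e.eq_of_nhds]

/-- The sum is locally finite, and the potential is `2πi`-periodic, so the operator commutes with
each translation. -/
lemma cylOp_twistSum (θ : ℝ) (A : Alg) {H : ℂ → ℂ} (hd : Differentiable ℝ H)
    (hH : HasCompactSupport H) : cylOp A (twistSum θ H) = twistSum θ (cylOp A H) := by
  funext u
  obtain ⟨s, hs⟩ := exists_finset_translates hH u
  rw [cylOp_congr A (twistSum_eventuallyEq θ hs), twistSum, tsum_eq_sum (s := s)]
  · have hdm : ∀ m : ℤ, Differentiable ℝ fun u => H (u + 2 * Real.pi * Complex.I * m) :=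
      fun m => hd.comp (differentiable_id.add_const _)
    simp only [cylOp_translate]
    simp only [cylOp]
    rw [fderiv_fun_sum fun m _ => ((hdm m).const_mul _) u, sum_apply,
      Finset.mul_sum, ← Finset.sum_add_distrib]
    refine Finset.sum_congr rfl fun m _ => ?_
    rw [fderiv_const_mul (hdm m u), smul_apply, smul_eq_mul]
    ring
  · intro m hm
    rw [cylOp_translate, cylOp_congr A (h' := fun _ => 0) (hs.mono fun u hu => hu m hm)]
    simp [cylOp]

/-! ### The induced operator -/

lemma contDiff_inUV {f : ℂ × ℂ → ℂ} (hf : ContDiff ℝ ∞ f) (v : ℂ) :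
    ContDiff ℝ ∞ fun u => inUV f u v :=
  hf.comp ((Complex.conjCLE.contDiff.comp (contDiff_const.sub contDiff_id)).prodMk
    ((contDiff_id.add contDiff_const).div_const _))

lemma hasCompactSupport_inUV {f : ℂ × ℂ → ℂ} (hf : HasCompactSupport f) (v : ℂ) :
    HasCompactSupport fun u => inUV f u v := by
  have hc : Continuous fun q : ℂ × ℂ => q.2 - starRingEnd ℂ q.1 / 2 := by fun_prop
  refine HasCompactSupport.intro (hf.isCompact.image hc) fun u hu => ?_
  by_contra h
  refine hu ⟨_, subset_tsupport _ (Function.mem_support.2 h), ?_⟩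
  simp only [Complex.conj_conj]
  ring

lemma descend_eq_twistSum (θ : ℝ) (v : ℂ) (f : ℂ × ℂ → ℂ) :
    descend θ v f = twistSum θ fun u => inUV f u v := rfl

lemma isQuasi_descend (θ : ℝ) (v : ℂ) {f : ℂ × ℂ → ℂ} (hf : IsCc f) : IsQuasi θ (descend θ v f) :=
  isQuasi_twistSum θ (contDiff_inUV hf.smooth v) (hasCompactSupport_inUV hf.compact v)

lemma descend_ellHat (θ : ℝ) (v : ℂ) (A : Alg) {f : ℂ × ℂ → ℂ} (hf : IsCc f) :
    descend θ v (ellHat A f) = cylOp A (descend θ v f) := by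
  have hd : Differentiable ℝ f := hf.smooth.differentiable (by simp)
  rw [descend_eq_twistSum, descend_eq_twistSum, cylOp_twistSum θ A
    ((contDiff_inUV hf.smooth v).differentiable (by simp)) (hasCompactSupport_inUV hf.compact v),
    ellHat_eq A hf]
  congr 1
  funext u
  rw [inUV_fieldOp A hd]
  rfl

/-- A smooth function whose translates by `2π ℤ` sum up to `1`. -/
def cutoff (y : ℝ) : ℝ := Real.smoothTransition y - Real.smoothTransition (y - 2 * Real.pi)

lemma cutoff_eq_zero {y : ℝ} (h : y ∉ Icc 0 (2 * Real.pi + 1)) : cutoff y = 0 := by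
  rw [mem_Icc, not_and_or, not_le, not_le] at h
  rw [cutoff]
  rcases h with h | h
  · rw [Real.smoothTransition.zero_of_nonpos h.le,
      Real.smoothTransition.zero_of_nonpos (by linarith [Real.pi_pos]), sub_zero]
  · rw [Real.smoothTransition.one_of_one_le (by linarith [Real.pi_pos]),
      Real.smoothTransition.one_of_one_le (by linarith), sub_self]

lemma contDiff_cutoff : ContDiff ℝ ∞ cutoff :=
  Real.smoothTransition.contDiff.sub
    (Real.smoothTransition.contDiff.comp (contDiff_id.sub contDiff_const))

lemma tsum_cutoff (y : ℝ) : ∑' m : ℤ, ((cutoff (y + 2 * Real.pi * m) : ℝ) : ℂ) = 1 := by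
  set n : ℤ := ⌊y / (2 * Real.pi)⌋ with hn
  have hp := Real.two_pi_pos
  have h1 : (n : ℝ) * (2 * Real.pi) ≤ y := (le_div_iff₀ hp).1 (Int.floor_le _)
  have h2 : y < (n + 1 : ℝ) * (2 * Real.pi) := (div_lt_iff₀ hp).1 (Int.lt_floor_add_one _)
  -- The support of the cutoff exceeds one period by `1`, so only two translates count. With `S` the
  -- transition and `y' = y - 2πn` they contribute `S(y')` and `1 - S(y')`.
  rw [tsum_eq_sum (s := {-n, 1 - n})]
  · rw [Finset.sum_pair (by omega)]
    simp only [cutoff]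
    push_cast
    have e1 : Real.smoothTransition (y + 2 * Real.pi * (1 - n)) = 1 :=
      Real.smoothTransition.one_of_one_le (by nlinarith [Real.pi_gt_three])
    have e2 : Real.smoothTransition (y + 2 * Real.pi * -n - 2 * Real.pi) = 0 :=
      Real.smoothTransition.zero_of_nonpos (by nlinarith)
    have e3 : y + 2 * Real.pi * (1 - n) - 2 * Real.pi = y + 2 * Real.pi * -n := by ring
    rw [e1, e2, e3]
    push_cast
    ring
  · intro m hm
    simp only [Finset.mem_insert, Finset.mem_singleton, not_or] at hm
    rw [cutoff_eq_zero, Complex.ofReal_zero]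
    rintro ⟨h3, h4⟩
    have h5 : -n ≤ m := by
      by_contra h
      have h' : (m : ℝ) + 1 ≤ -n := by exact_mod_cast (by omega : m + 1 ≤ -n)
      nlinarith
    have h6 : m < 2 - n := by
      by_contra h
      have h' : (2 : ℝ) - n ≤ m := by exact_mod_cast (by omega : 2 - n ≤ m)
      nlinarith [Real.pi_gt_three]
    omega

/-- Every quasi-periodic function descends from a test function on a given chart. -/
lemma exists_isTest_descend (k : ℤ) {θ : ℝ} {h : ℂ → ℂ} (hh : IsQuasi θ h) (v : ℂ) :
    ∃ f, IsTest k f ∧ descend θ v f = h := by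
  obtain ⟨R, hR⟩ := hh.support
  let η : ContDiffBump v := ⟨1 / 4, 1 / 2, by norm_num, by norm_num⟩
  -- On the support `Im u` lies in `[a, a + 2π + 1]` and the second variable within `1/2` of the
  -- frozen `v`. Hence `Im w`, half the sum of the two imaginary parts, lies between `2kπ + 1/4` and
  -- `2kπ + π + 5/4`, inside the strip.
  let a : ℝ := 4 * k * Real.pi - v.im + 1
  let f : ℂ × ℂ → ℂ := fun q => (η (q.2 + starRingEnd ℂ q.1 / 2) : ℂ) *
    ((cutoff ((q.2 - starRingEnd ℂ q.1 / 2).im - a) : ℂ) * h (q.2 - starRingEnd ℂ q.1 / 2))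
  have hu : ContDiff ℝ ∞ fun q : ℂ × ℂ => q.2 - starRingEnd ℂ q.1 / 2 :=
    contDiff_snd.sub ((Complex.conjCLE.contDiff.comp contDiff_fst).div_const _)
  have hv : ContDiff ℝ ∞ fun q : ℂ × ℂ => q.2 + starRingEnd ℂ q.1 / 2 :=
    contDiff_snd.add ((Complex.conjCLE.contDiff.comp contDiff_fst).div_const _)
  let K : Set (ℂ × ℂ) := (fun p : ℂ × ℂ => (starRingEnd ℂ (p.2 - p.1), (p.1 + p.2) / 2)) ''
    ((Icc (-R) R ×ℂ Icc a (a + (2 * Real.pi + 1))) ×ˢ Metric.closedBall v (1 / 2))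
  have hK : IsCompact K :=
    ((isCompact_Icc.reProdIm isCompact_Icc).prod (isCompact_closedBall _ _)).image (by fun_prop)
  have hfK : ∀ q ∉ K, f q = 0 := by
    intro q hq
    by_contra hne
    refine hq ⟨(q.2 - starRingEnd ℂ q.1 / 2, q.2 + starRingEnd ℂ q.1 / 2), ⟨⟨?_, ?_⟩, ?_⟩, ?_⟩
    · have h1 : h (q.2 - starRingEnd ℂ q.1 / 2) ≠ 0 := right_ne_zero_of_mul (right_ne_zero_of_mul hne)
      have h2 := mt (hR _) h1
      rw [not_not] at h2
      exact abs_le.1 h2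
    · have h1 := left_ne_zero_of_mul (right_ne_zero_of_mul hne)
      have h2 := mt cutoff_eq_zero (Complex.ofReal_ne_zero.1 h1)
      rw [not_not] at h2
      exact ⟨by linarith [h2.1], by linarith [h2.2]⟩
    · have h1 := Complex.ofReal_ne_zero.1 (left_ne_zero_of_mul hne)
      have h2 : q.2 + starRingEnd ℂ q.1 / 2 ∈ Function.support η := h1
      rw [η.support_eq] at h2
      exact Metric.ball_subset_closedBall h2
    · refine Prod.ext ?_ ?_
      · simp only
        rw [show q.2 + starRingEnd ℂ q.1 / 2 - (q.2 - starRingEnd ℂ q.1 / 2) = starRingEnd ℂ q.1 by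
          ring, Complex.conj_conj]
      · simp only
        ring
  have hKs : K ⊆ chartDomain k := by
    rintro _ ⟨⟨u, w⟩, ⟨⟨-, h1⟩, h2⟩, rfl⟩
    refine ⟨mem_univ _, ?_⟩
    have h3 : |w.im - v.im| ≤ 1 / 2 := by
      rw [← Complex.sub_im]
      exact (Complex.abs_im_le_norm _).trans (mem_closedBall_iff_norm.1 h2)
    rw [abs_le] at h3
    have h4 : a ≤ u.im ∧ u.im ≤ a + (2 * Real.pi + 1) := h1
    have e : ((u + w) / 2).im = (u.im + w.im) / 2 := by simp
    simp only [strip, mem_ofPred_eq, e]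
    simp only [a] at h4
    constructor
    · linarith [h4.1]
    · linarith [h4.2, Real.pi_gt_three]
  refine ⟨f, ⟨?_, HasCompactSupport.intro hK hfK, ?_⟩, ?_⟩
  · exact (Complex.ofRealCLM.contDiff.comp (η.contDiff.comp hv)).mul
      ((Complex.ofRealCLM.contDiff.comp (contDiff_cutoff.comp
        ((Complex.imCLM.contDiff.comp hu).sub contDiff_const))).mul (hh.smooth.comp hu))
  · refine (closure_minimal (fun q hq => ?_) hK.isClosed).trans hKs
    by_contra h1
    exact hq (hfK q h1)
  · funext u
    have e1 : ∀ u, inUV f u v = (cutoff (u.im - a) : ℂ) * h u := by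
      intro u
      simp only [inUV, f, Complex.conj_conj]
      rw [show (u + v) / 2 + (v - u) / 2 = v by ring, show (u + v) / 2 - (v - u) / 2 = u by ring,
        η.one_of_mem_closedBall (Metric.mem_closedBall_self η.rIn_pos.le)]
      simp
    have e2 : ∀ m : ℤ, Complex.exp (-(2 * Real.pi * Complex.I * m * θ)) *
        inUV f (u + 2 * Real.pi * Complex.I * m) v =
        (cutoff ((u.im - a) + 2 * Real.pi * m) : ℂ) * h u := by
      intro m
      rw [e1, quasi_int hh.quasi, im_add_two_pi_I_mul,
        show u.im + 2 * Real.pi * (m : ℝ) - a = (u.im - a) + 2 * Real.pi * m by ring]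
      have e3 : Complex.exp (-(2 * Real.pi * Complex.I * m * θ)) *
          Complex.exp (2 * Real.pi * Complex.I * θ * m) = 1 := by
        rw [← Complex.exp_add, ← Complex.exp_zero]
        congr 1
        ring
      linear_combination (cutoff ((u.im - a) + 2 * Real.pi * m) : ℂ) * h u * e3
    rw [descend, tsum_congr e2, tsum_mul_right, tsum_cutoff, one_mul]

/-- The operator `cylOp A` on smooth quasi-periodic functions, as a graph. -/
def cylGraph (θ : ℝ) (A : Alg) : Submodule ℝ (L2Cyl × L2Cyl) where
  carrier := {p | ∃ h, IsQuasi θ h ∧ p.1 =ᵐ[cylMeasure] h ∧ p.2 =ᵐ[cylMeasure] cylOp A h}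
  add_mem' := by
    rintro ⟨f, g⟩ ⟨f', g'⟩ ⟨h, hh, e1, e2⟩ ⟨h', hh', e1', e2'⟩
    refine ⟨_, hh.add hh', (Lp.coeFn_add f f').trans (e1.add e1'),
      ((Lp.coeFn_add g g').trans (e2.add e2')).trans (Eventually.of_forall fun u => ?_)⟩
    have d := hh.smooth.differentiable (by simp) u
    have d' := hh'.smooth.differentiable (by simp) u
    simp only [cylOp, Pi.add_apply]
    rw [fderiv_fun_add d d', add_apply]
    ring
  zero_mem' := by
    refine ⟨fun _ => 0, ⟨contDiff_const, by simp, 0, by simp⟩, Lp.coeFn_zero _ _ _,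
      (Lp.coeFn_zero _ _ _).trans (Eventually.of_forall fun u => ?_)⟩
    simp [cylOp]
  smul_mem' := by
    rintro c ⟨f, g⟩ ⟨h, hh, e1, e2⟩
    have d := hh.smooth.differentiable (by simp)
    refine ⟨_, hh.periodic_mul (p := fun _ => (c : ℂ)) contDiff_const fun _ => rfl, ?_, ?_⟩
    · filter_upwards [Lp.coeFn_smul c f, e1] with u h1 h2
      change (c • f : L2Cyl) u = _
      rw [h1, Pi.smul_apply, h2, Complex.real_smul]
    · filter_upwards [Lp.coeFn_smul c g, e2] with u h1 h2
      change (c • g : L2Cyl) u = _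
      rw [h1, Pi.smul_apply, h2, Complex.real_smul]
      simp only [cylOp]
      rw [fderiv_const_mul (d u), smul_apply, smul_eq_mul]
      ring

/-- Test functions descend to quasi-periodic ones compatibly with the operators, and by
`exists_isTest_descend` all of them arise; so neither the chart nor the frozen variable matters. -/
lemma ellHatGraph_eq (k : ℤ) (θ : ℝ) (v : ℂ) (A : Alg) : ellHatGraph k θ v A = cylGraph θ A := by
  ext p
  constructor
  · rintro ⟨f, hf, e1, e2⟩
    rw [descend_ellHat θ v A hf.isCc] at e2
    exact ⟨_, isQuasi_descend θ v hf.isCc, e1, e2⟩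
  · rintro ⟨h, hh, e1, e2⟩
    obtain ⟨f, hf, rfl⟩ := exists_isTest_descend k hh v
    refine ⟨f, hf, e1, ?_⟩
    rwa [descend_ellHat θ v A hf.isCc]

theorem isUnitaryExp_ellHatGraph (k : ℤ) (θ : ℝ) (v : ℂ) (A : Alg) :
    IsUnitaryExp (ellHatGraph k θ v A) (TRep θ (expo A)) := by
  have hU : ∀ s t : ℝ, TRep θ (expo ((s + t) • A)) =
      TRep θ (expo (s • A)) * TRep θ (expo (t • A)) := fun s t => by rw [expo_add, map_mul]
  have hc : ∀ f, Continuous fun t : ℝ => TRep θ (expo (t • A)) f := fun f =>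
    (continuous_TRep θ f).comp (continuous_expo A)
  refine ⟨fun t => TRep θ (expo (t • A)), hU, hc, ?_, congrArg (fun B => TRep θ (expo B)) (one_smul ℝ A)⟩
  rw [ellHatGraph_eq]
  refine closure_eq_generator (U := fun t => TRep θ (expo (t • A))) hU hc _ ?_ ?_ ?_
  · rintro p ⟨h, hh, e1, e2⟩
    exact hasDerivAt_TRep_quasi hh A e1 e2
  · rintro p ⟨h, hh, e1, -⟩ t
    have hq := (hh.act (expo (t • A))).cylOp A
    exact ⟨hq.memLp.toLp _, _, hh.act _,
      (TRep_coe θ _ _).trans (TFun_congr θ _ e1), hq.memLp.coeFn_toLp⟩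
  · refine (dense_quasiSubmodule θ).mono ?_
    rintro f ⟨h, hh, e⟩
    exact ⟨(hh.cylOp A).memLp.toLp _, h, hh, e, (hh.cylOp A).memLp.coeFn_toLp⟩

end

end AffC

/-! ### Assembly of the theorem -/

theorem mainTheorem11 :
    -- the orbit `Ω` is open, and the `φ_k` are symplectic charts of it
    (IsOpen AffC.Omega ∧
      AffC.Omega = {F | ∃ a b : ℂ, b ≠ 0 ∧ F = AffC.functional (a, b)} ∧
      (∀ k : ℤ, Set.BijOn AffC.chart (AffC.chartDomain k)
        {F | ∃ a b : ℂ, ¬ (b.im = 0 ∧ 0 ≤ b.re) ∧ F = AffC.functional (a, b)}) ∧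
      (∀ (k : ℤ), ∀ p ∈ AffC.chartDomain k, DifferentiableAt ℝ AffC.chart p ∧
        Function.Bijective (fderiv ℝ AffC.chart p) ∧
        ∀ (A B : AffC.Alg) (X Y : ℂ × ℂ),
          fderiv ℝ AffC.chart p X = AffC.fundField A (AffC.chart p) →
          fderiv ℝ AffC.chart p Y = AffC.fundField B (AffC.chart p) →
          AffC.omegaStd X Y = AffC.chart p (AffC.bracket A B))) ∧
    -- the operators obtained from the Moyal product in the charts
    (∀ (k : ℤ) (A : AffC.Alg) (f : ℂ × ℂ → ℂ), AffC.IsTest k f →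
      (∀ p, Summable (AffC.moyalTerm (fun q => Complex.I * AffC.hamiltonian A q)
        (AffC.fourierZInv f) p)) ∧
      (∀ w, MeasureTheory.Integrable fun z : ℂ => AffC.ell A (AffC.fourierZInv f) (z, w)) ∧
      ∀ u v : ℂ, AffC.inUV (AffC.ellHat A f) u v =
        A.1 * AffC.dWirt (fun u' => AffC.inUV f u' v) u
        + starRingEnd ℂ A.1 * AffC.dWirtBar (fun u' => AffC.inUV f u' v) u
        + Complex.I / 2 * (A.2 * Complex.exp u
            + starRingEnd ℂ A.2 * Complex.exp (starRingEnd ℂ u)) * AffC.inUV f u v) ∧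
    -- they exponentiate to the representations `T_θ`
    ∀ θ : ℝ, ∃ T : AffC.Cover →* (AffC.L2Cyl ≃ₗᵢ[ℂ] AffC.L2Cyl),
      (∀ (g : AffC.Cover) (f : AffC.L2Cyl),
        T g f =ᵐ[AffC.cylMeasure] AffC.TFun θ g f) ∧
      (∀ f : AffC.L2Cyl, Continuous fun g => T g f) ∧
      AffC.IsIrred T ∧
      (∀ F ∈ AffC.Omega, AffC.IsOrbitMethodRep F θ T) ∧
      ∀ (k : ℤ) (v : ℂ) (A : AffC.Alg),
        AffC.IsUnitaryExp (AffC.ellHatGraph k θ v A) (T (AffC.expo A)) := by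
  refine ⟨⟨AffC.isOpen_Omega, AffC.Omega_eq, AffC.bijOn_chart, fun k p _ =>
    ⟨(AffC.hasFDerivAt_chart p).differentiableAt, AffC.bijective_fderiv_chart p,
      fun A B X Y hX hY => AffC.omegaStd_eq_kirillov hX hY⟩⟩, fun k A f hf => ⟨fun p =>
    (AffC.hasSum_moyalTerm_hamiltonian A hf.isCc p).summable, fun w => ?_, fun u v => ?_⟩,
    fun θ => ⟨AffC.TRep θ, AffC.TRep_coe θ, AffC.continuous_TRep θ, AffC.isIrred_TRep θ,
      fun F hF => AffC.isOrbitMethodRep_TRep θ hF,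
      fun k v A => AffC.isUnitaryExp_ellHatGraph k θ v A⟩⟩
  · rw [AffC.ell_fourierZInv A hf.isCc]
    exact AffC.integrable_fourierZInv (hf.isCc.fieldOp A) w
  · rw [AffC.ellHat_eq A hf.isCc, AffC.inUV_fieldOp A (hf.smooth.differentiable (by simp)),
      AffC.dWirt_add_dWirtBar]
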